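/- **Setting.** Let $\mathbb T=\mathbb R/2\pi\mathbb Z$, $\nu_x,\nu_y,\eta_x,\eta_y\ge 0$, $\alpha\ge 0$, $\beta\in\mathbb R$, $N\in\mathbb N_0$, and let $(\omega,\theta)\in C([0,\infty);L^2(\mathbb T\times\mathbb R))^2$ be a distributional solution of the Boussinesq equations linearized around $v=(\beta y,0)$, $\theta=\alpha y$, $$\partial_t\omega+\beta y\,\partial_x\omega=\nu_x\partial_{xx}\omega+\nu_y\partial_{yy}\omega+\partial_x\theta,\qquad \partial_t\theta+\beta y\,\partial_x\theta+\alpha\,\partial_x\Delta^{-1}\omega=\eta_x\partial_{xx}\theta+\eta_y\partial_{yy}\theta,$$ with initial data $\omega_0\in H^N$, $\theta_0\in H^{N+1}$; here $\partial_x\Delta^{-1}$ is the Fourier multiplier with symbol $-ik/(k^2+\xi^2)$ (zero for $k=0$). From now on $\omega(t),\theta(t)$ denote these functions in the coordinates moving with the shear, i.e. $\omega(t,x+\beta ty,y)$, $\theta(t,x+\beta ty,y)$. Write $\tilde f(k,\xi)$, $(k,\xi)\in\mathbb Z\times\mathbb R$, for the Fourier transform, $\|f\|_{H^N}^2=\sum_k\int(1+k^2+\xi^2)^N|\tilde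 f(k,\xi)|^2d\xi$, and $f_{\neq}=f-f_{=}$, where $f_{=}(y)$ is the average of $f$ in $x$. **1. Inviscid case.** Let $\nu_x=\nu_y=\eta_x=\eta_y=0$. Then $\omega(t)\in H^N$ for all $t\ge0$, and $\limsup_{t\to\infty}\|\omega(t)\|_{H^N}=\infty$ if and only if either $\alpha=0$ and $\partial_x\theta_0\ne0$, or $\alpha>0$, $\beta\neq0$ and $(\omega_0,\theta_0)$ is not independent of $x$. **2. Case $\alpha=0$, temperature.** For all $t\ge 0$, $$\|\theta_{\neq}(t)\|_{H^N}\le \exp\!\Big(-\eta_xt-\eta_y\tfrac{\beta^2t^3}{12}\Big)\|\theta_0\|_{H^N}.$$ **3. Case $\alpha=0$, vorticity.** Suppose that at least one of $\nu_x,\nu_y,\eta_x,\eta_y$ is positive and, if $\beta=0$, that $\nu_x$ or $\eta_x$ is positive. Then there is $C=C(\beta,\nu_x,\nu_y,\eta_x,\eta_y)$ such that for all $N$ and all solutions as above the following profile $\omega_1(t)\in L^2$ exists for all $t\ge0$ and satisfies $$\|\omega_{\neq}(t)-\omega_1(t)\|_{H^N}\le C\exp\!\Big(-\max(\eta_y,\nu_y)\tfrac{\beta^2t^3}{12}-\max(\eta_x,\nu_x)t\Big)\big(\|\omega_0\|_{H^N}+\|\partial_x\theta_0\|_{H^N}\big),$$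 $$\|\omega_1(t)\|_{H^N}\le C\,p(t)\exp\!\Big(-\min(\eta_y,\nu_y)\tfrac{\beta^2t^3}{12}-\min(\eta_x,\nu_x)\tfrac t2\Big)\big(\|\omega_0\|_{H^N}+\|\partial_x\theta_0\|_{H^N}\big),$$ where $p(t)=1+t$ in the exceptional case $\nu_x=\eta_x=0$, $\nu_y=\eta_y$, and $p(t)=1$ otherwise. To define $\omega_1$, put for constants $c,d$ $$D_{c,d}(a,b)=\exp\!\Big(-ck^2(b-a)-d\int_a^b(\xi-\beta k\tau)^2d\tau\Big),\qquad K(s)=D_{\nu_x,\nu_y}(s,t)\,D_{\eta_x,\eta_y}(0,s).$$ Then $\tilde\omega_1(t,0,\xi)=0$, and for $k\ne0$ and almost every $\xi$, using the first case that applies, - $\tilde\omega_1=ik\tilde\theta_0\int_0^tK(s)\,ds$ if $\nu_x=\eta_x$ and $\nu_y=\eta_y$; - $\tilde\omega_1=D_{\nu_x,\nu_y}(0,t)\tilde\omega_0+ik\tilde\theta_0\int_0^\infty K(s)\,ds$ if $\nu_x\le\eta_x$, $\nu_y\le\eta_y$ and ($\beta\neq0$ or $\nu_x\ne\eta_x$);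 - $\tilde\omega_1=ik\tilde\theta_0\int_{-\infty}^tK(s)\,ds$ if $\eta_x\le\nu_x$, $\eta_y\le\nu_y$ and ($\beta\neq0$ or $\nu_x\ne\eta_x$); - $\tilde\omega_1=D_{\nu_x,\nu_y}(0,t)\tilde\omega_0+ik\tilde\theta_0\int_0^tK(s)\,ds$ otherwise. **4. Case $\alpha>0$.** Suppose $\min(\nu_x,\eta_x)>0$ or $\min(\nu_y,\eta_y)>0$, and set $$E[\omega,\theta](t)=\alpha\|\omega(t)\|_{H^N}^2+\|\partial_x\theta(t)\|_{H^N}^2+\|(\partial_y-t\beta\partial_x)\theta(t)\|_{H^N}^2 .$$ Then the energy is bounded uniformly in time: $E[\omega,\theta](0)<\infty$ and $E[\omega,\theta](t)\le C\,E[\omega,\theta](0)$ for all $t\ge0$, with $C=C(\beta,\nu_x,\nu_y,\eta_x,\eta_y)$. If moreover $\beta\ne0$, there is $C=C(\beta)$ such that for all $t\ge0$ $$E[\omega_{\neq},\theta_{\neq}](t)\le C(1+t^2)\exp\!\Big(-\min(\nu_y,\eta_y)\tfrac{\beta^2t^3}{12}-\min(\eta_x,\nu_x)t\Big)E[\omega_{\neq},\theta_{\neq}](0).$$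 -/

import Mathlib

open MeasureTheory Filter Topology Set
open scoped ENNReal FourierTransform Real

noncomputable section

namespace Boussinesq

instance fact_two_pi_pos : Fact (0 < 2 * π) := ⟨Real.two_pi_pos⟩

/-- The torus `𝕋 = ℝ / 2πℤ`, so that the frequencies dual to `x` are the integers. -/
abbrev Torus : Type := AddCircle (2 * π)

/-- The infinite periodic channel `𝕋 × ℝ`. -/
abbrev Channel : Type := Torus × ℝ

/-- Lebesgue measure on `𝕋 × ℝ`, with the torus normalized to have mass one. -/
abbrev channelMeasure : Measure Channel :=
  (AddCircle.haarAddCircle : Measure Torus).prod (volume : Measure ℝ)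

/-- The complex space `L²(𝕋 × ℝ)`; it contains the real-valued functions. -/
abbrev L2 : Type := Lp ℂ 2 channelMeasure

/-! ### Fourier transform and Sobolev norms -/

/-- The `k`-th Fourier coefficient in `x`: `f_k(y) = (2π)⁻¹ ∫ e^{-ikx} f(x,y) dx`. -/
def xCoeff (f : Channel → ℂ) (k : ℤ) (y : ℝ) : ℂ :=
  fourierCoeff (fun x : Torus => f (x, y)) k

theorem memLp_xCoeff {f : Channel → ℂ} (hf : MemLp f 2 channelMeasure) (k : ℤ) :
    MemLp (xCoeff f k) 2 (volume : Measure ℝ) := by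
  have hswap : AEStronglyMeasurable (fun q : ℝ × Torus => f (q.2, q.1))
      ((volume : Measure ℝ).prod AddCircle.haarAddCircle) := hf.1.prod_swap
  have hfour : AEStronglyMeasurable (fun q : ℝ × Torus => fourier (-k) q.2 • f (q.2, q.1))
      ((volume : Measure ℝ).prod AddCircle.haarAddCircle) :=
    (((fourier (T := 2 * π) (-k)).continuous.comp continuous_snd).aestronglyMeasurable).smul hswap
  refine ⟨hfour.integral_prod_right', ?_⟩
  have h2 : (2 : ℝ≥0∞) ≠ 0 := by norm_num
  have h2' : (2 : ℝ≥0∞) ≠ ⊤ := by norm_num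
  have hfin := (eLpNorm_lt_top_iff_lintegral_rpow_enorm_lt_top h2 h2').1 hf.2
  rw [eLpNorm_lt_top_iff_lintegral_rpow_enorm_lt_top h2 h2']
  have hprod : ∫⁻ p, ‖f p‖ₑ ^ (2 : ℝ≥0∞).toReal ∂channelMeasure =
      ∫⁻ y : ℝ, ∫⁻ x : Torus, ‖f (x, y)‖ₑ ^ (2 : ℝ≥0∞).toReal ∂AddCircle.haarAddCircle := by
    rw [lintegral_prod_symm]
    exact hf.1.enorm.pow_const _
  rw [hprod] at hfin
  refine lt_of_le_of_lt (lintegral_mono_ae ?_) hfin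
  filter_upwards [hswap.prodMk_left] with y hy
  have h1 : ‖xCoeff f k y‖ₑ ≤ ∫⁻ x : Torus, ‖f (x, y)‖ₑ ∂AddCircle.haarAddCircle := by
    refine (enorm_integral_le_lintegral_enorm _).trans (le_of_eq ?_)
    refine lintegral_congr fun x => ?_
    rw [enorm_smul]
    have : ‖(fourier (-k) x : ℂ)‖ₑ = 1 := by
      rw [← ofReal_norm, fourier_apply, Circle.norm_coe, ENNReal.ofReal_one]
    rw [this, one_mul]
  have h3 := eLpNorm_le_eLpNorm_of_exponent_le (μ := (AddCircle.haarAddCircle : Measure Torus))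
    (p := 1) (q := 2) (by norm_num) hy
  rw [eLpNorm_one_eq_lintegral_enorm] at h3
  calc ‖xCoeff f k y‖ₑ ^ (2 : ℝ≥0∞).toReal
      ≤ (eLpNorm (fun x : Torus => f (x, y)) 2 AddCircle.haarAddCircle) ^ (2 : ℝ≥0∞).toReal :=
        ENNReal.rpow_le_rpow (h1.trans h3) (by norm_num)
    _ = _ := by
        rw [eLpNorm_eq_lintegral_rpow_enorm_toReal h2 h2', ← ENNReal.rpow_mul]
        norm_num

/-- The Fourier transform of `f ∈ L²(𝕋 × ℝ)` at the frequency `(k, ξ) ∈ ℤ × ℝ`: up to a fixed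
normalization `∫∫ e^{-ikx - iξy} f(x,y) dx dy`. Mathlib's transform has the kernel `e^{-2πiηy}`,
hence `η = ξ / 2π`. Like every element of `L²` it is determined for almost every `ξ`. -/
def ft (f : L2) (k : ℤ) (ξ : ℝ) : ℂ :=
  (𝓕 ((memLp_xCoeff (Lp.memLp f) k).toLp (xCoeff f k)) : Lp ℂ 2 (volume : Measure ℝ)) (ξ / (2 * π))

/-- `‖m(D) f‖_{H^N}` for the Fourier multiplier `m(D)` with symbol `m(k,ξ)` (possibly infinite). -/
def multNorm (N : ℕ) (m : ℤ → ℝ → ℂ) (f : L2) : ℝ≥0∞ :=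
  (∑' k : ℤ, ∫⁻ ξ : ℝ,
    ENNReal.ofReal ((1 + (k : ℝ) ^ 2 + ξ ^ 2) ^ N) * ‖m k ξ * ft f k ξ‖ₑ ^ 2) ^ (1 / 2 : ℝ)

/-- The Sobolev norm `‖f‖_{H^N}` (possibly infinite). -/
def sobNorm (N : ℕ) (f : L2) : ℝ≥0∞ := multNorm N (fun _ _ => 1) f

/-- The norm `‖∂ₓ f‖_{H^N}`. -/
def dxNorm (N : ℕ) (f : L2) : ℝ≥0∞ := multNorm N (fun k _ => Complex.I * k) f

/-- The norm `‖(∂_y - s ∂ₓ) f‖_{H^N}`. -/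
def dyShearNorm (N : ℕ) (s : ℝ) (f : L2) : ℝ≥0∞ :=
  multNorm N (fun k ξ => Complex.I * (ξ - s * k)) f

/-- `f ∈ H^N(𝕋 × ℝ)`. -/
def MemH (N : ℕ) (f : L2) : Prop := sobNorm N f < ⊤

/-- The `x`-average `f_=`, as a function on the channel. -/
def xAverage (f : L2) : L2 :=
  ((memLp_xCoeff (Lp.memLp f) 0).comp_snd (AddCircle.haarAddCircle : Measure Torus)).toLp
    (fun p : Channel => xCoeff f 0 p.2)

/-- The complement `f_≠ = f - f_=` of the `x`-average. -/
def nonAverage (f : L2) : L2 := f - xAverage f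

/-! ### Coordinates moving with the shear -/

/-- The shear `(x, y) ↦ (x + a y, y)`. -/
def shear (a : ℝ) (p : Channel) : Channel := (p.1 + ((a * p.2 : ℝ) : Torus), p.2)

theorem measurePreserving_shear (a : ℝ) :
    MeasurePreserving (shear a) channelMeasure channelMeasure := by
  have hc : Continuous (fun q : ℝ × Torus => q.2 + ((a * q.1 : ℝ) : Torus)) :=
    continuous_snd.add ((AddCircle.continuous_mk' (2 * π)).comp (continuous_const.mul continuous_fst))
  have h : MeasurePreserving (fun q : ℝ × Torus => (q.1, q.2 + ((a * q.1 : ℝ) : Torus)))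
      ((volume : Measure ℝ).prod AddCircle.haarAddCircle)
      ((volume : Measure ℝ).prod AddCircle.haarAddCircle) :=
    (MeasurePreserving.id (volume : Measure ℝ)).skew_product
      (g := fun y x => x + ((a * y : ℝ) : Torus)) hc.measurable
      (ae_of_all _ fun y => (measurePreserving_add_right AddCircle.haarAddCircle _).map_eq)
  exact (Measure.measurePreserving_swap.comp h).comp Measure.measurePreserving_swap

/-- The function `(x, y) ↦ f(x + β t y, y)`: the profile `f` at time `t`, in the coordinates that
move with the shear flow `(β y, 0)`. -/
def comoving (β t : ℝ) (f : L2) : L2 :=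
  Lp.compMeasurePreserving (shear (β * t)) (measurePreserving_shear (β * t)) f

/-! ### The linearized Boussinesq equations -/

/-- The partial derivative `∂ₓ` of a function on the channel. -/
def dX (f : Channel → ℂ) (p : Channel) : ℂ := deriv (fun h : ℝ => f (p.1 + (h : Torus), p.2)) 0

/-- The partial derivative `∂_y` of a function on the channel. -/
def dY (f : Channel → ℂ) (p : Channel) : ℂ := deriv (fun y : ℝ => f (p.1, y)) p.2

/-- The partial derivative `∂_t` of a time-dependent function on the channel. -/
def dT (φ : ℝ → Channel → ℂ) (t : ℝ) (p : Channel) : ℂ := deriv (fun s : ℝ => φ s p) t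

/-- Test functions: smooth with compact support in `ℝ × 𝕋 × ℝ`. They need not vanish at `t = 0`. -/
structure IsTest (φ : ℝ → Channel → ℂ) : Prop where
  smooth : ContDiff ℝ ((⊤ : ℕ∞) : WithTop ℕ∞) (fun q : ℝ × ℝ × ℝ => φ q.1 ((q.2.1 : Torus), q.2.2))
  compact : HasCompactSupport (fun q : ℝ × Channel => φ q.1 q.2)

/-- The formal adjoint `∂_t + β y ∂ₓ + c ∂ₓₓ + d ∂_yy` of `-(∂_t + β y ∂ₓ - c ∂ₓₓ - d ∂_yy)`. -/
def adjointOp (β c d : ℝ) (φ : ℝ → Channel → ℂ) (t : ℝ) (p : Channel) : ℂ :=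
  dT φ t p + (β * p.2 : ℝ) * dX (φ t) p + c * dX (dX (φ t)) p + d * dY (dY (φ t)) p

/-- `v = ∂ₓ Δ⁻¹ w`, the Fourier multiplier with symbol `-ik / (k² + ξ²)`. -/
def IsDxInvLaplacian (w v : L2) : Prop :=
  ∀ k : ℤ, ∀ᵐ ξ : ℝ, ft v k ξ = -(Complex.I * k) / ((k : ℂ) ^ 2 + (ξ : ℂ) ^ 2) * ft w k ξ

/-- `(ω, θ)` is a (distributional, `L²`-continuous) solution on `[0, ∞)` of
`∂_t ω + β y ∂ₓ ω = νx ∂ₓₓ ω + νy ∂_yy ω + ∂ₓ θ`,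
`∂_t θ + β y ∂ₓ θ + α ∂ₓ Δ⁻¹ ω = ηx ∂ₓₓ θ + ηy ∂_yy θ` on `𝕋 × ℝ`, with initial data
`(ω 0, θ 0)`. Values at negative times are irrelevant. -/
structure IsSolution (α β νx νy ηx ηy : ℝ) (ω θ : ℝ → L2) : Prop where
  continuous_vorticity : ContinuousOn ω (Ici 0)
  continuous_temperature : ContinuousOn θ (Ici 0)
  vorticity_eq : ∀ φ : ℝ → Channel → ℂ, IsTest φ →
    (∫ t in Ioi (0 : ℝ), ∫ p, (ω t p * adjointOp β νx νy φ t p - θ t p * dX (φ t) p)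
      ∂channelMeasure) + ∫ p, ω 0 p * φ 0 p ∂channelMeasure = 0
  temperature_eq : ∃ v : ℝ → L2, (∀ t, 0 ≤ t → IsDxInvLaplacian (ω t) (v t)) ∧
    ∀ φ : ℝ → Channel → ℂ, IsTest φ →
      (∫ t in Ioi (0 : ℝ), ∫ p, (θ t p * adjointOp β ηx ηy φ t p - α * v t p * φ t p)
        ∂channelMeasure) + ∫ p, θ 0 p * φ 0 p ∂channelMeasure = 0

/-- The energy `α ‖w‖²_{H^N} + ‖∂ₓ g‖²_{H^N} + ‖(∂_y - t β ∂ₓ) g‖²_{H^N}` at time `t`. -/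
def energy (N : ℕ) (α β t : ℝ) (w g : L2) : ℝ≥0∞ :=
  ENNReal.ofReal α * sobNorm N w ^ 2 + dxNorm N g ^ 2 + dyShearNorm N (t * β) g ^ 2

/-! ### The slowly decaying profile of the vorticity for `α = 0` -/

/-- `exp (-c k² (b - a) - d ∫_a^b (ξ - β k τ)² dτ)`: the damping, from time `a` to time `b`, of the
frequency `(k, ξ)` under horizontal and vertical diffusion `c`, `d` in the moving coordinates. -/
def damping (β c d : ℝ) (k : ℤ) (ξ a b : ℝ) : ℝ :=
  Real.exp (-c * (k : ℝ) ^ 2 * (b - a) - d * ∫ τ in a..b, (ξ - β * k * τ) ^ 2)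

/-- The Fourier transform, in moving coordinates, of the profile `ω₁(t)` with data `(ω₀, θ₀)`. -/
def profileFt (β νx νy ηx ηy : ℝ) (ω₀ θ₀ : L2) (t : ℝ) (k : ℤ) (ξ : ℝ) : ℂ :=
  let free : ℂ := damping β νx νy k ξ 0 t * ft ω₀ k ξ
  let K : ℝ → ℝ := fun s => damping β νx νy k ξ s t * damping β ηx ηy k ξ 0 s
  let src : ℂ := Complex.I * k * ft θ₀ k ξ
  open Classical in
  if k = 0 then 0
  else if νx = ηx ∧ νy = ηy then ((∫ s in (0 : ℝ)..t, K s : ℝ) : ℂ) * src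
  else if νx ≤ ηx ∧ νy ≤ ηy ∧ (β ≠ 0 ∨ νx ≠ ηx) then
    free + ((∫ s in Ioi (0 : ℝ), K s : ℝ) : ℂ) * src
  else if ηx ≤ νx ∧ ηy ≤ νy ∧ (β ≠ 0 ∨ νx ≠ ηx) then ((∫ s in Iic t, K s : ℝ) : ℂ) * src
  else free + ((∫ s in (0 : ℝ)..t, K s : ℝ) : ℂ) * src

/-- The function `w` is the profile `ω₁(t)`. -/
def IsProfile (β νx νy ηx ηy : ℝ) (ω₀ θ₀ : L2) (t : ℝ) (w : L2) : Prop :=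
  ∀ k : ℤ, ∀ᵐ ξ : ℝ, ft w k ξ = profileFt β νx νy ηx ηy ω₀ θ₀ t k ξ

end Boussinesq

end

open MeasureTheory Filter Topology Set
open scoped ENNReal FourierTransform Real

noncomputable section

namespace Boussinesq

/-! In the coordinates moving with the shear the transport term disappears, and every Fourier
multiplier in the equations remains a multiplier, with `ξ` replaced by `ξ - β k t`. A solution
therefore splits into linear 2×2 systems in `t`, one for each frequency `(k, ξ)` (`FreqSystem`). The
Sobolev weights do not depend on time in these coordinates, so every norm estimate follows from a
pointwise estimate at one frequency whose constant does not depend on that frequency.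

The reduction is `freq_representation`. Testing the weak equations with one `x`-mode gives an
integral equation in `L²(ℝ)` for that mode (`mode_relation`). Its symbol is unbounded in `ξ`, so it
is cut down to a bounded window of frequencies, where it becomes a linear ODE with bounded
coefficients. Uniqueness identifies its solution with a fundamental matrix of continuous functions
on the window, and evaluating this matrix at a point solves the pointwise system.

For `α = 0` the system is triangular: `θ` is a pure damping and `ω` is given by Duhamel's formula.
Enhanced dissipation is the inequality `∫ (ξ - βkτ)² dτ ≥ β² t³ / 12` for `k ≠ 0`. The Duhamel
integrand is the smaller damping over `[0, t]` times an excess damping that decays away from `s = 0`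
or from `s = t`, depending on which diffusivities are larger. Extending the integral to the matching
half-line costs only a term with the larger damping; what is left is the profile
(`exists_profileBound`).

For `α > 0` the density `α|ω|² + (k² + (ξ - βkt)²)|θ|²` is chosen so that the coupling cancels; only
the motion of its weight can increase it. Uniform boundedness comes from a bounded arctangent weight
that pays for what thermal diffusion does not absorb (`FreqSystem.energyDensity_le_bounded`). The
decay estimate splits the time interval at the critical time `ξ / (βk)`: before it the weight
decreases, and after it the density divided by the weight is damped
(`FreqSystem.energyDensity_le_enhanced`).

Without diffusion, `ω` is linear in time if `α = 0`, and the energy is conserved if `α > 0` and `β =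
0`. If `α > 0` and `β ≠ 0`, time can be rescaled so that each mode solves `f'' = -κ f / (1 + z²)`
with `κ = α / β²`. A quadratic form in `(f, f')` grows at least logarithmically along solutions, and
it is controlled by `f` at two nearby points. Hence `ω` itself cannot stay bounded
(`exists_freq_growth`). -/

/-- The space `L²(ℝ)`. -/
abbrev L2R : Type := Lp ℂ 2 (volume : Measure ℝ)

/-! ### Fourier series in `x`: the channel as a Hilbert sum of copies of `L²(ℝ)` -/

theorem norm_fourier_apply (k : ℤ) (x : Torus) : ‖(fourier k x : ℂ)‖ = 1 := by
  rw [fourier_apply, Circle.norm_coe]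

theorem measurable_fourier_fst (k : ℤ) :
    Measurable (fun p : Channel => (fourier k p.1 : ℂ)) :=
  ((fourier (T := 2 * π) k).continuous.comp continuous_fst).measurable

theorem memLp_tensor (k : ℤ) (a : L2R) :
    MemLp (fun p : Channel => fourier k p.1 * a p.2) 2 channelMeasure := by
  have h := (Lp.memLp a).comp_snd (AddCircle.haarAddCircle : Measure Torus)
  refine h.of_le ((measurable_fourier_fst k).aestronglyMeasurable.mul h.1) (ae_of_all _ fun p => ?_)
  rw [norm_mul, norm_fourier_apply, one_mul]

theorem norm_toLp_tensor (k : ℤ) (a : L2R) : ‖(memLp_tensor k a).toLp‖ = ‖a‖ := by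
  have h1 : eLpNorm (fun p : Channel => fourier k p.1 * a p.2) 2 channelMeasure
      = eLpNorm (fun p : Channel => a p.2) 2 channelMeasure :=
    eLpNorm_congr_norm_ae (ae_of_all _ fun p => by rw [norm_mul, norm_fourier_apply, one_mul])
  have h2 : eLpNorm (fun p : Channel => a p.2) 2 channelMeasure = eLpNorm a 2 volume :=
    eLpNorm_comp_measurePreserving (Lp.memLp a).1 measurePreserving_snd
  rw [Lp.norm_toLp, h1, h2, Lp.norm_def]

/-- The embedding of `L²(ℝ)` as the `k`-th Fourier mode: `a ↦ e^{ikx} a(y)`. -/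
def emb (k : ℤ) : L2R →ₗᵢ[ℂ] L2 where
  toFun a := (memLp_tensor k a).toLp
  map_add' a b := by
    rw [← MemLp.toLp_add]
    refine (MemLp.toLp_eq_toLp_iff _ _).2 ?_
    have := (measurePreserving_snd (μ := (AddCircle.haarAddCircle : Measure Torus))
      (ν := (volume : Measure ℝ))).quasiMeasurePreserving.ae (Lp.coeFn_add a b)
    filter_upwards [this] with p hp
    simp only [Pi.add_apply] at hp ⊢
    rw [hp]; ring
  map_smul' c a := by
    rw [RingHom.id_apply, ← MemLp.toLp_const_smul]
    refine (MemLp.toLp_eq_toLp_iff _ _).2 ?_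
    have := (measurePreserving_snd (μ := (AddCircle.haarAddCircle : Measure Torus))
      (ν := (volume : Measure ℝ))).quasiMeasurePreserving.ae (Lp.coeFn_smul c a)
    filter_upwards [this] with p hp
    simp only [Pi.smul_apply, smul_eq_mul] at hp ⊢
    rw [hp]; ring
  norm_map' a := norm_toLp_tensor k a

theorem coeFn_emb (k : ℤ) (a : L2R) :
    emb k a =ᵐ[channelMeasure] fun p => fourier k p.1 * a p.2 :=
  (memLp_tensor k a).coeFn_toLp

theorem integral_channel {f : Channel → ℂ} (hf : Integrable f channelMeasure) :
    ∫ p, f p ∂channelMeasure = ∫ y : ℝ, ∫ x : Torus, f (x, y) ∂AddCircle.haarAddCircle :=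
  integral_prod_symm _ hf

theorem ae_channel {P : Channel → Prop} (h : ∀ᵐ p ∂channelMeasure, P p) :
    ∀ᵐ y : ℝ, ∀ᵐ x : Torus ∂AddCircle.haarAddCircle, P (x, y) :=
  Measure.ae_ae_of_ae_prod
    ((Measure.measurePreserving_swap (μ := (volume : Measure ℝ))
      (ν := (AddCircle.haarAddCircle : Measure Torus))).quasiMeasurePreserving.ae h)

/-- Fubini. This identifies the adjoint of `emb k` with `xCoeff · k`, so that the coefficient map
`xc k` is linear and continuous for free. -/
theorem inner_emb (k : ℤ) (a : L2R) (f : L2) :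
    inner ℂ (emb k a) f = inner ℂ a ((memLp_xCoeff (Lp.memLp f) k).toLp) := by
  rw [L2.inner_def, L2.inner_def, integral_channel (L2.integrable_inner _ _)]
  refine integral_congr_ae ?_
  filter_upwards [ae_channel (coeFn_emb k a), (memLp_xCoeff (Lp.memLp f) k).coeFn_toLp]
    with y hy hx
  rw [hx, RCLike.inner_apply, xCoeff, fourierCoeff, ← integral_mul_const]
  refine integral_congr_ae ?_
  filter_upwards [hy] with x hx
  rw [hx, RCLike.inner_apply, fourier_neg, smul_eq_mul, map_mul]
  ring

/-- The `k`-th Fourier coefficient in `x`, as a continuous linear map `L²(𝕋 × ℝ) → L²(ℝ)`. -/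
def xc (k : ℤ) : L2 →L[ℂ] L2R := (emb k).toContinuousLinearMap.adjoint

theorem xc_eq_toLp (k : ℤ) (f : L2) : xc k f = (memLp_xCoeff (Lp.memLp f) k).toLp := by
  refine ext_inner_left ℂ fun a => ?_
  rw [xc, ContinuousLinearMap.adjoint_inner_right]
  exact inner_emb k a f

theorem coeFn_xc (k : ℤ) (f : L2) : xc k f =ᵐ[volume] xCoeff f k := by
  rw [xc_eq_toLp]; exact (memLp_xCoeff (Lp.memLp f) k).coeFn_toLp

theorem fourierCoeff_fourier_mul (k j : ℤ) (c : ℂ) :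
    fourierCoeff (fun x : Torus => fourier j x * c) k = if k = j then c else 0 := by
  have h := fourierCoeff.const_mul (fun x : Torus => (fourier j x : ℂ)) c k
  have h2 : fourierCoeff (fun x : Torus => (fourier j x : ℂ)) k = (Pi.single j 1 : ℤ → ℂ) k := by
    rw [← fourierCoeff_fourier (T := 2 * π) j]
  simp only [mul_comm _ c]
  rw [h, h2, Pi.single_apply]
  split_ifs <;> simp

theorem xc_emb (k j : ℤ) (a : L2R) : xc k (emb j a) = if k = j then a else 0 := by
  apply Lp.ext
  have h : xCoeff (emb j a) k =ᵐ[volume] fun y => if k = j then a y else 0 := by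
    filter_upwards [ae_channel (coeFn_emb j a)] with y hy
    rw [xCoeff, fourierCoeff_congr_ae (g := fun x => fourier j x * a y) hy,
      fourierCoeff_fourier_mul]
  filter_upwards [coeFn_xc k (emb j a), h, Lp.coeFn_zero ℂ 2 (volume : Measure ℝ)] with y h1 h2 h3
  rw [h1, h2]
  split_ifs
  · rfl
  · rw [h3]; rfl

theorem orthogonalFamily_emb : OrthogonalFamily ℂ (fun _ : ℤ => L2R) emb := by
  intro i j hij a b
  change inner ℂ ((emb i).toContinuousLinearMap a) (emb j b) = 0
  rw [← ContinuousLinearMap.adjoint_inner_right]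
  change inner ℂ a (xc i (emb j b)) = 0
  rw [xc_emb, if_neg hij, inner_zero_right]

theorem eq_zero_of_fourierCoeff_eq_zero {f : Torus → ℂ} (hf : MemLp f 2 AddCircle.haarAddCircle)
    (h : ∀ k, fourierCoeff f k = 0) : f =ᵐ[AddCircle.haarAddCircle] 0 := by
  have h1 : hf.toLp = 0 := by
    have h2 := tsum_sq_fourierCoeff hf.toLp
    have h3 : ∀ k, fourierCoeff (hf.toLp : Torus → ℂ) k = 0 := fun k => by
      rw [fourierCoeff_congr_ae hf.coeFn_toLp, h]
    simp only [h3, norm_zero, ne_eq, OfNat.ofNat_ne_zero, not_false_eq_true, zero_pow,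
      tsum_zero] at h2
    have h4 := L2.inner_def (𝕜 := ℂ) hf.toLp hf.toLp
    have h5 := integral_ofReal (𝕜 := ℂ) (f := fun t => ‖(hf.toLp : Torus → ℂ) t‖ ^ 2)
      (μ := (AddCircle.haarAddCircle : Measure Torus))
    rw [← h2] at h5
    rw [← inner_self_eq_zero (𝕜 := ℂ), h4]
    refine Eq.trans (integral_congr_ae (ae_of_all _ fun x => ?_)) (h5.trans (by simp))
    simp [inner_self_eq_norm_sq_to_K]
  have := hf.coeFn_toLp
  rw [h1] at this
  exact this.symm.trans (Lp.coeFn_zero _ _ _)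

/-- There are countably many modes, so for almost every `y` all Fourier coefficients of `f (·, y)`
vanish at once. Almost every such slice is in `L²` of the circle, and Parseval makes it zero. -/
theorem eq_zero_of_xc_eq_zero {f : L2} (h : ∀ k, xc k f = 0) : f = 0 := by
  rw [Lp.eq_zero_iff_ae_eq_zero]
  have hk : ∀ᵐ y : ℝ, ∀ k, xCoeff f k y = 0 := by
    rw [ae_all_iff]
    intro k
    filter_upwards [coeFn_xc k f, Lp.coeFn_zero ℂ 2 (volume : Measure ℝ)] with y h1 h2
    rw [← h1, h k, h2]; rfl
  have hm : ∀ᵐ y : ℝ, MemLp (fun x => f (x, y)) 2 (AddCircle.haarAddCircle : Measure Torus) := by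
    have hs : Integrable (fun p => ‖f p‖ ^ 2) channelMeasure := (Lp.memLp f).integrable_norm_pow (by norm_num)
    have hs' := hs.swap.prod_right_ae
    have hme := (Lp.memLp f).1.prod_swap.prodMk_left
    filter_upwards [hs', hme] with y h1 h2
    exact (memLp_two_iff_integrable_sq_norm h2).2 h1
  have : ∀ᵐ y : ℝ, ∀ᵐ x ∂(AddCircle.haarAddCircle : Measure Torus), f (x, y) = 0 := by
    filter_upwards [hk, hm] with y h1 h2
    exact eq_zero_of_fourierCoeff_eq_zero h2 h1
  have hset : MeasurableSet {p : ℝ × Torus | f (p.2, p.1) = 0} :=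
    measurableSet_eq_fun ((Lp.stronglyMeasurable f).measurable.comp measurable_swap)
      measurable_const
  have h3 : ∀ᵐ p ∂((volume : Measure ℝ).prod (AddCircle.haarAddCircle : Measure Torus)),
      f (p.2, p.1) = 0 := (Measure.ae_prod_iff_ae_ae hset).2 this
  exact (Measure.measurePreserving_swap (μ := (AddCircle.haarAddCircle : Measure Torus))
      (ν := (volume : Measure ℝ))).quasiMeasurePreserving.ae h3

/-- Orthogonality is `xc_emb`. Density holds because a vector orthogonal to all ranges has all its
coefficients `xc k` equal to zero. -/
theorem isHilbertSum_emb : IsHilbertSum ℂ (fun _ : ℤ => L2R) emb := by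
  refine IsHilbertSum.mk orthogonalFamily_emb ?_
  rw [top_le_iff, Submodule.topologicalClosure_eq_top_iff, eq_bot_iff]
  intro f hf
  rw [Submodule.mem_bot]
  refine eq_zero_of_xc_eq_zero fun k => ?_
  refine ext_inner_left ℂ fun a => ?_
  rw [xc, ContinuousLinearMap.adjoint_inner_right, inner_zero_right]
  exact (Submodule.mem_orthogonal _ _).1 hf _ (Submodule.mem_iSup_of_mem k ⟨a, rfl⟩)

theorem isHilbertSum_emb_apply (f : L2) (k : ℤ) :
    isHilbertSum_emb.linearIsometryEquiv f k = xc k f := by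
  set W := isHilbertSum_emb.linearIsometryEquiv with hW
  have h := (isHilbertSum_emb.hasSum_linearIsometryEquiv_symm (W f)).mapL (xc k)
  rw [← hW, LinearIsometryEquiv.symm_apply_apply] at h
  simp only [xc_emb] at h
  refine HasSum.unique ?_ h
  have h2 : (fun b => if k = b then W f b else 0) = fun b => if b = k then W f k else 0 := by
    funext b
    by_cases hb : b = k
    · subst hb; simp
    · rw [if_neg hb, if_neg (Ne.symm hb)]
  rw [h2]
  exact hasSum_ite_eq k (W f k)

theorem norm_sq_eq_tsum_xc (f : L2) : ‖f‖ ^ 2 = ∑' k, ‖xc k f‖ ^ 2 := by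
  have h := lp.norm_rpow_eq_tsum (p := 2) (by norm_num) (isHilbertSum_emb.linearIsometryEquiv f)
  simp only [isHilbertSum_emb_apply, LinearIsometryEquiv.norm_map] at h
  exact_mod_cast h

theorem summable_norm_sq_xc (f : L2) : Summable fun k => ‖xc k f‖ ^ 2 := by
  have h := (lp.memℓp (isHilbertSum_emb.linearIsometryEquiv f)).summable (by norm_num)
  simp only [isHilbertSum_emb_apply] at h
  exact_mod_cast h

theorem exists_xc_eq {a : ℤ → L2R} (ha : Summable fun k => ‖a k‖ ^ 2) :
    ∃ f : L2, ∀ k, xc k f = a k := by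
  have hm : Memℓp a 2 := memℓp_gen (by exact_mod_cast ha)
  refine ⟨isHilbertSum_emb.linearIsometryEquiv.symm ⟨a, hm⟩, fun k => ?_⟩
  rw [← isHilbertSum_emb_apply, LinearIsometryEquiv.apply_symm_apply]

/-! ### The Fourier transform in both variables -/

/-- The Fourier transform at the frequency `k` in `x`, with Mathlib's normalization in `y`. -/
def modeFt (k : ℤ) : L2 →L[ℂ] L2R :=
  (Lp.fourierTransformₗᵢ ℝ ℂ).toContinuousLinearEquiv.toContinuousLinearMap.comp (xc k)

theorem modeFt_apply (k : ℤ) (f : L2) : modeFt k f = 𝓕 (xc k f) := rfl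

theorem ft_eq (f : L2) (k : ℤ) (ξ : ℝ) : ft f k ξ = modeFt k f (ξ / (2 * π)) := by
  rw [ft, modeFt_apply, xc_eq_toLp]

theorem ae_scale {P : ℝ → Prop} (h : ∀ᵐ η : ℝ, P η) : ∀ᵐ ξ : ℝ, P (ξ / (2 * π)) := by
  have h2 : (2 * π)⁻¹ ≠ (0 : ℝ) := inv_ne_zero Real.two_pi_pos.ne'
  have hq : Measure.QuasiMeasurePreserving (fun ξ : ℝ => (2 * π)⁻¹ * ξ) volume volume := by
    refine ⟨measurable_const_mul _, ?_⟩
    rw [Real.map_volume_mul_left h2]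
    exact Measure.smul_absolutelyContinuous
  filter_upwards [hq.ae h] with ξ hξ
  rwa [div_eq_inv_mul]

theorem ae_unscale {P : ℝ → Prop} (h : ∀ᵐ ξ : ℝ, P ξ) : ∀ᵐ η : ℝ, P (2 * π * η) := by
  have hq : Measure.QuasiMeasurePreserving (fun ξ : ℝ => 2 * π * ξ) volume volume := by
    refine ⟨measurable_const_mul _, ?_⟩
    rw [Real.map_volume_mul_left Real.two_pi_pos.ne']
    exact Measure.smul_absolutelyContinuous
  exact hq.ae h

theorem two_pi_mul_div (η : ℝ) : 2 * π * η / (2 * π) = η := by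
  field_simp

theorem ft_two_pi_mul (f : L2) (k : ℤ) (η : ℝ) : ft f k (2 * π * η) = modeFt k f η := by
  rw [ft_eq, two_pi_mul_div]

theorem aestronglyMeasurable_ft (f : L2) (k : ℤ) :
    AEStronglyMeasurable (ft f k) (volume : Measure ℝ) := by
  have : ft f k = fun ξ => modeFt k f (ξ / (2 * π)) := funext fun ξ => ft_eq f k ξ
  rw [this]
  exact ((Lp.stronglyMeasurable (modeFt k f)).comp_measurable
    (measurable_id.div_const _)).aestronglyMeasurable

theorem ft_sub (f g : L2) (k : ℤ) : ∀ᵐ ξ : ℝ, ft (f - g) k ξ = ft f k ξ - ft g k ξ := by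
  have h := Lp.coeFn_sub (modeFt k f) (modeFt k g)
  filter_upwards [ae_scale h] with ξ hξ
  rw [ft_eq, ft_eq, ft_eq, map_sub, hξ]; rfl

theorem ft_zero (k : ℤ) : ∀ᵐ ξ : ℝ, ft (0 : L2) k ξ = 0 := by
  filter_upwards [ae_scale (Lp.coeFn_zero ℂ 2 (volume : Measure ℝ))] with ξ hξ
  rw [ft_eq, map_zero, hξ]; rfl

theorem norm_modeFt (k : ℤ) (f : L2) : ‖modeFt k f‖ = ‖xc k f‖ :=
  Lp.norm_fourier_eq _

theorem eq_zero_of_ft_eq_zero {f : L2} (h : ∀ k, ∀ᵐ ξ : ℝ, ft f k ξ = 0) : f = 0 := by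
  refine eq_zero_of_xc_eq_zero fun k => ?_
  rw [← norm_eq_zero, ← norm_modeFt, norm_eq_zero, Lp.eq_zero_iff_ae_eq_zero]
  filter_upwards [ae_unscale (h k)] with η hη
  rw [← ft_two_pi_mul, hη]; rfl

theorem norm_le_of_ft_le {f g : L2} (h : ∀ k, ∀ᵐ ξ : ℝ, ‖ft f k ξ‖ ≤ ‖ft g k ξ‖) :
    ‖f‖ ≤ ‖g‖ := by
  have hk : ∀ k, ‖xc k f‖ ≤ ‖xc k g‖ := fun k => by
    rw [← norm_modeFt, ← norm_modeFt]
    refine Lp.norm_le_norm_of_ae_le ?_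
    filter_upwards [ae_unscale (h k)] with η hη
    rwa [← ft_two_pi_mul, ← ft_two_pi_mul]
  refine le_of_sq_le_sq ?_ (norm_nonneg _)
  rw [norm_sq_eq_tsum_xc, norm_sq_eq_tsum_xc]
  exact (summable_norm_sq_xc f).tsum_le_tsum
    (fun k => pow_le_pow_left₀ (norm_nonneg _) (hk k) 2) (summable_norm_sq_xc g)

/-- Every square-summable family of profiles is a Fourier transform. -/
theorem exists_ft_eq {g : ℤ → ℝ → ℂ} (hm : ∀ k, AEStronglyMeasurable (g k) (volume : Measure ℝ))
    (hfin : ∑' k, ∫⁻ ξ : ℝ, ‖g k ξ‖ₑ ^ 2 < ⊤) : ∃ w : L2, ∀ k, ∀ᵐ ξ : ℝ, ft w k ξ = g k ξ := by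
  have hq : Measure.QuasiMeasurePreserving (fun ξ : ℝ => 2 * π * ξ) volume volume := by
    refine ⟨measurable_const_mul _, ?_⟩
    rw [Real.map_volume_mul_left Real.two_pi_pos.ne']
    exact Measure.smul_absolutelyContinuous
  have hscale : ∀ F : ℝ → ℝ≥0∞, ∫⁻ η : ℝ, F (2 * π * η) =
      ENNReal.ofReal (2 * π)⁻¹ * ∫⁻ ξ : ℝ, F ξ := by
    intro F
    have hme : MeasurableEmbedding (fun ξ : ℝ => 2 * π * ξ) :=
      (Homeomorph.mulLeft₀ (2 * π) Real.two_pi_pos.ne').measurableEmbedding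
    rw [← hme.lintegral_map, Real.map_volume_mul_left Real.two_pi_pos.ne',
      lintegral_smul_measure, abs_of_pos (inv_pos.2 Real.two_pi_pos), smul_eq_mul]
  have hnorm : ∀ F : ℝ → ℂ, eLpNorm F 2 volume = (∫⁻ ξ : ℝ, ‖F ξ‖ₑ ^ 2) ^ (1 / 2 : ℝ) := by
    intro F
    rw [eLpNorm_eq_lintegral_rpow_enorm_toReal (by norm_num) (by norm_num)]
    simp
  -- The prescribed profile in the variable `η = ξ / 2π` of Mathlib's transform; the rescaling only
  -- changes the norms by a fixed factor.
  set b : ℤ → ℝ → ℂ := fun k η => g k (2 * π * η) with hb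
  have hbl : ∀ k, ∫⁻ η : ℝ, ‖b k η‖ₑ ^ 2 = ENNReal.ofReal (2 * π)⁻¹ * ∫⁻ ξ : ℝ, ‖g k ξ‖ₑ ^ 2 :=
    fun k => hscale fun ξ => ‖g k ξ‖ₑ ^ 2
  have hsum : ∑' k, ∫⁻ η : ℝ, ‖b k η‖ₑ ^ 2 < ⊤ := by
    simp only [hbl]
    rw [ENNReal.tsum_mul_left]
    exact ENNReal.mul_lt_top ENNReal.ofReal_lt_top hfin
  have hbm : ∀ k, MemLp (b k) 2 volume := fun k => by
    refine ⟨(hm k).comp_quasiMeasurePreserving hq, ?_⟩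
    rw [hnorm]
    exact ENNReal.rpow_lt_top_of_nonneg (by norm_num)
      ((ENNReal.le_tsum k).trans_lt hsum).ne
  have hs : Summable fun k => ‖(𝓕⁻ (hbm k).toLp : L2R)‖ ^ 2 := by
    have h1 : ∀ k, ‖(𝓕⁻ (hbm k).toLp : L2R)‖ ^ 2 = (∫⁻ η : ℝ, ‖b k η‖ₑ ^ 2).toReal := by
      intro k
      have : ‖(𝓕⁻ (hbm k).toLp : L2R)‖ = ‖(hbm k).toLp‖ :=
        (Lp.fourierTransformₗᵢ ℝ ℂ).symm.norm_map _
      rw [this, Lp.norm_toLp, hnorm, ← ENNReal.toReal_pow, ← ENNReal.rpow_natCast,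
        ← ENNReal.rpow_mul]
      norm_num
    simp only [h1]
    exact ENNReal.summable_toReal hsum.ne
  obtain ⟨w, hw⟩ := exists_xc_eq hs
  refine ⟨w, fun k => ?_⟩
  have h1 : modeFt k w = (hbm k).toLp := by
    rw [modeFt_apply, hw k]; exact FourierTransform.fourier_fourierInv_eq _
  filter_upwards [ae_scale (hbm k).coeFn_toLp] with ξ hξ
  rw [ft_eq, h1, hξ, hb]
  simp only
  rw [mul_div_cancel₀ _ Real.two_pi_pos.ne']

theorem xAverage_eq_emb (f : L2) : xAverage f = emb 0 (xc 0 f) := by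
  apply Lp.ext
  have h1 := ((memLp_xCoeff (Lp.memLp f) 0).comp_snd
    (AddCircle.haarAddCircle : Measure Torus)).coeFn_toLp
  have h2 := (measurePreserving_snd (μ := (AddCircle.haarAddCircle : Measure Torus))
      (ν := (volume : Measure ℝ))).quasiMeasurePreserving.ae (coeFn_xc 0 f)
  filter_upwards [h1, coeFn_emb 0 (xc 0 f), h2] with p h1 h2 h3
  rw [h2, xAverage, h1, fourier_zero, one_mul, h3]

theorem ft_nonAverage (f : L2) (k : ℤ) :
    ∀ᵐ ξ : ℝ, ft (nonAverage f) k ξ = if k = 0 then 0 else ft f k ξ := by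
  have h : modeFt k (nonAverage f) = if k = 0 then 0 else modeFt k f := by
    rw [nonAverage, map_sub, xAverage_eq_emb, modeFt_apply k (emb _ _), xc_emb]
    split_ifs with h
    · subst h; rw [modeFt_apply, sub_self]
    · have : (𝓕 (0 : L2R) : L2R) = 0 := (Lp.fourierTransformₗᵢ ℝ ℂ).map_zero
      rw [this, sub_zero]
  filter_upwards [ae_scale (Lp.coeFn_zero ℂ 2 (volume : Measure ℝ))] with ξ hξ
  rw [ft_eq, h, ft_eq]
  split_ifs
  · rw [hξ]; rfl
  · rfl

/-! ### Fourier transform in `y` and the moving coordinates -/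

/-- The Fourier transform in `L²` is its own transpose. -/
theorem integral_mul_fourier (f : L2R) (h : SchwartzMap ℝ ℂ) :
    ∫ η : ℝ, h η * (𝓕 f : L2R) η = ∫ y : ℝ, 𝓕 (h : ℝ → ℂ) y * f y := by
  have h1 := congrArg (fun T : TemperedDistribution ℝ ℂ => T h) (Lp.fourier_toTemperedDistribution_eq f)
  simp only [TemperedDistribution.fourier_apply, Lp.toTemperedDistribution_apply, smul_eq_mul] at h1
  exact h1.symm

theorem ae_eq_of_integral_schwartz_mul {f g : ℝ → ℂ}
    (hf : LocallyIntegrable f volume) (hg : LocallyIntegrable g volume)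
    (h : ∀ φ : SchwartzMap ℝ ℂ, HasCompactSupport φ → ∫ η : ℝ, φ η * f η = ∫ η : ℝ, φ η * g η) :
    f =ᵐ[volume] g := by
  refine ae_eq_of_integral_contDiff_smul_eq hf hg fun ψ hψ hc => ?_
  have hc' : HasCompactSupport fun x => (ψ x : ℂ) := hc.comp_left (g := fun x : ℝ => (x : ℂ)) rfl
  have hs' : ContDiff ℝ ((⊤ : ℕ∞) : WithTop ℕ∞) fun x => (ψ x : ℂ) :=
    Complex.ofRealCLM.contDiff.comp hψ
  have := h (hc'.toSchwartzMap hs') hc'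
  simpa using this

theorem fourier_shift (h : ℝ → ℂ) (a y : ℝ) :
    𝓕 (fun η => h (η + a)) y = Complex.exp (2 * π * a * y * Complex.I) * 𝓕 h y := by
  rw [Real.fourier_real_eq, Real.fourier_real_eq, ← integral_const_mul,
    ← integral_sub_right_eq_self _ a]
  refine integral_congr_ae (ae_of_all _ fun v => ?_)
  simp only [Circle.smul_def, Real.fourierChar_apply, smul_eq_mul, sub_add_cancel]
  rw [← mul_assoc, ← Complex.exp_add]
  congr 2
  push_cast; ring

theorem measurePreserving_sub_const (a : ℝ) :
    MeasurePreserving (fun η : ℝ => η - a) volume volume := measurePreserving_sub_right _ a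

/-- Proved by duality: against a compactly supported Schwartz function the transform moves to the
test function, where the statement becomes the explicit formula `fourier_shift`. -/
theorem fourier_modulate {f g : L2R} {a : ℝ}
    (h : ∀ᵐ y : ℝ, g y = Complex.exp (2 * π * a * y * Complex.I) * f y) :
    ∀ᵐ η : ℝ, (𝓕 g : L2R) η = (𝓕 f : L2R) (η - a) := by
  refine ae_eq_of_integral_schwartz_mul
    ((Lp.memLp _).locallyIntegrable (by norm_num))
    (((Lp.memLp (𝓕 f : L2R)).comp_measurePreserving
      (measurePreserving_sub_const a)).locallyIntegrable (by norm_num))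
    fun φ hφ => ?_
  have hs : ContDiff ℝ ((⊤ : ℕ∞) : WithTop ℕ∞) fun η => φ (η + a) :=
    (φ.smooth ⊤).comp (contDiff_id.add contDiff_const)
  have hc : HasCompactSupport fun η => φ (η + a) :=
    hφ.comp_homeomorph (Homeomorph.addRight a)
  have h1 := integral_mul_fourier f (hc.toSchwartzMap hs)
  rw [integral_mul_fourier]
  have h2 : ∫ η : ℝ, φ η * (𝓕 f : L2R) (η - a) = ∫ η : ℝ, φ (η + a) * (𝓕 f : L2R) η := by
    rw [← integral_add_right_eq_self (fun η => φ η * (𝓕 f : L2R) (η - a)) a]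
    simp
  refine Eq.trans ?_ h2.symm
  refine Eq.trans ?_ h1.symm
  refine integral_congr_ae ?_
  filter_upwards [h] with y hy
  have h3 : (⇑(hc.toSchwartzMap hs) : ℝ → ℂ) = fun η => φ (η + a) := rfl
  rw [hy, h3, fourier_shift]
  ring

theorem coeFn_comoving (β t : ℝ) (f : L2) :
    comoving β t f =ᵐ[channelMeasure] f ∘ shear (β * t) :=
  Lp.coeFn_compMeasurePreserving f (measurePreserving_shear (β * t))

theorem fourier_add_point (k : ℤ) (x c : Torus) :
    (fourier k (x + c) : ℂ) = fourier k x * fourier k c := by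
  rw [fourier_apply, fourier_apply, fourier_apply, smul_add, AddCircle.toCircle_add, Circle.coe_mul]

theorem xCoeff_comoving (β t : ℝ) (f : L2) (k : ℤ) : ∀ᵐ y : ℝ,
    xCoeff (comoving β t f) k y
      = Complex.exp (2 * π * (β * k * t / (2 * π) : ℝ) * y * Complex.I) * xCoeff f k y := by
  filter_upwards [ae_channel (coeFn_comoving β t f)] with y hy
  rw [xCoeff, fourierCoeff_congr_ae (g := fun x => f (x + ((β * t * y : ℝ) : Torus), y)) hy,
    xCoeff, fourierCoeff, fourierCoeff, ← integral_const_mul,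
    ← integral_add_right_eq_self (fun x : Torus => _ * (fourier (-k) x • f (x, y)))
      ((β * t * y : ℝ) : Torus)]
  refine integral_congr_ae (ae_of_all _ fun x => ?_)
  simp only [smul_eq_mul]
  rw [fourier_add_point, fourier_coe_apply, ← mul_assoc, mul_left_comm, ← Complex.exp_add]
  have : 2 * (π : ℂ) * ((β * k * t / (2 * π) : ℝ) : ℂ) * y * Complex.I +
      2 * π * Complex.I * ((-k : ℤ) : ℂ) * ((β * t * y : ℝ) : ℂ) / ((2 * π : ℝ) : ℂ) = 0 := by
    have : (π : ℂ) ≠ 0 := Complex.ofReal_ne_zero.2 Real.pi_ne_zero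
    push_cast; field_simp; ring
  rw [this, Complex.exp_zero, mul_one]

/-- The shear multiplies the `k`-th mode by `e^{iβkty}`, which translates its transform. This is the
origin of `ξ - β k t` in all later symbols. -/
theorem ft_comoving (β t : ℝ) (f : L2) (k : ℤ) :
    ∀ᵐ ξ : ℝ, ft (comoving β t f) k ξ = ft f k (ξ - β * k * t) := by
  have h : ∀ᵐ y : ℝ, xc k (comoving β t f) y
      = Complex.exp (2 * π * (β * k * t / (2 * π) : ℝ) * y * Complex.I) * xc k f y := by
    filter_upwards [coeFn_xc k (comoving β t f), coeFn_xc k f, xCoeff_comoving β t f k]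
      with y h1 h2 h3
    rw [h1, h2, h3]
  filter_upwards [ae_scale (fourier_modulate h)] with ξ hξ
  rw [ft_eq, ft_eq, modeFt_apply, modeFt_apply, hξ, sub_div]

/-- Composition with a measure preserving map is jointly continuous in the `L²` function and in the
map, the latter in the compact-open topology, and the shears depend continuously on `t` there. -/
theorem continuousOn_comoving (β : ℝ) {f : ℝ → L2} {s : Set ℝ} (hf : ContinuousOn f s) :
    ContinuousOn (fun t => comoving β t (f t)) s := by
  have hc : Continuous fun q : ℝ × Channel => shear (β * q.1) q.2 := by
    unfold shear
    refine Continuous.prodMk ?_ (continuous_snd.comp continuous_snd)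
    exact (continuous_fst.comp continuous_snd).add ((AddCircle.continuous_mk' (2 * π)).comp
      ((continuous_const.mul continuous_fst).mul (continuous_snd.comp continuous_snd)))
  let g : ℝ → C(Channel, Channel) := fun t =>
    ⟨shear (β * t), hc.comp (Continuous.prodMk continuous_const continuous_id)⟩
  have hg : Continuous g :=
    (ContinuousMap.curry (⟨_, hc⟩ : C(ℝ × Channel, Channel))).continuous
  exact hf.compMeasurePreservingLp (g := g) hg.continuousOn
    (fun t => measurePreserving_shear (β * t)) (by norm_num)

/-! ### From weak formulations to integral equations and Fourier relations -/

theorem contDiff_one_of_smooth {F : Type*} [NormedAddCommGroup F] [NormedSpace ℝ F] {f : ℝ → F}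
    (hf : ContDiff ℝ ((⊤ : ℕ∞) : WithTop ℕ∞) f) : ContDiff ℝ 1 f := by
  exact_mod_cast contDiff_infty.1 hf 1

theorem smooth_deriv {F : Type*} [NormedAddCommGroup F] [NormedSpace ℝ F] {f : ℝ → F}
    (hf : ContDiff ℝ ((⊤ : ℕ∞) : WithTop ℕ∞) f) :
    ContDiff ℝ ((⊤ : ℕ∞) : WithTop ℕ∞) (deriv f) := (contDiff_infty_iff_deriv.1 hf).2

/-- Integrating from the right end of the support makes the primitive vanish for large `t`. On the
left it is cut off at negative times, where the weak formulation does not look; hence no condition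
on `∫ ψ` is needed. -/
theorem exists_primitive_cutoff {ψ : ℝ → ℝ} (hψ : ContDiff ℝ ((⊤ : ℕ∞) : WithTop ℕ∞) ψ)
    (hc : HasCompactSupport ψ) :
    ∃ χ : ℝ → ℝ, ContDiff ℝ ((⊤ : ℕ∞) : WithTop ℕ∞) χ ∧ HasCompactSupport χ ∧
      ∀ t, 0 < t → deriv χ t = ψ t := by
  obtain ⟨M, hM⟩ := hc.isCompact.isBounded.subset_closedBall (0 : ℝ)
  have hzero : ∀ t, max M 0 < t → ψ t = 0 := fun t ht => by
    by_contra hne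
    have h1 := hM (subset_tsupport ψ hne)
    rw [mem_closedBall_zero_iff, Real.norm_eq_abs] at h1
    exact absurd ((le_abs_self t).trans h1) (not_le.2 ((le_max_left _ _).trans_lt ht))
  set Ψ : ℝ → ℝ := fun t => ∫ s in (max M 0)..t, ψ s with hΨ
  have hd : ∀ t, HasDerivAt Ψ (ψ t) t := fun t =>
    intervalIntegral.integral_hasDerivAt_right (hψ.continuous.intervalIntegrable _ _)
      hψ.continuous.aestronglyMeasurable.stronglyMeasurableAtFilter hψ.continuous.continuousAt
  have hΨs : ContDiff ℝ ((⊤ : ℕ∞) : WithTop ℕ∞) Ψ := by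
    rw [contDiff_infty_iff_deriv]
    refine ⟨fun t => (hd t).differentiableAt, ?_⟩
    rwa [show deriv Ψ = ψ from funext fun t => (hd t).deriv]
  have hΨ0 : ∀ t, max M 0 ≤ t → Ψ t = 0 := fun t ht => by
    refine (intervalIntegral.integral_congr_ae (g := fun _ => 0) (ae_of_all _ fun s hs => ?_)).trans
      (by simp)
    rw [uIoc_of_le ht] at hs
    exact hzero s hs.1
  refine ⟨fun t => Real.smoothTransition (t + 2) * Ψ t,
    (Real.smoothTransition.contDiff.comp (contDiff_id.add contDiff_const)).mul hΨs, ?_, ?_⟩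
  · refine HasCompactSupport.intro (isCompact_Icc (a := -2) (b := max M 0)) fun t ht => ?_
    rw [mem_Icc, not_and_or, not_le, not_le] at ht
    rcases ht with ht | ht
    · rw [Real.smoothTransition.zero_of_nonpos (by linarith), zero_mul]
    · rw [hΨ0 t ht.le, mul_zero]
  · intro t ht
    have : (fun t => Real.smoothTransition (t + 2) * Ψ t) =ᶠ[𝓝 t] Ψ := by
      filter_upwards [Ioi_mem_nhds ht] with s hs
      rw [Real.smoothTransition.one_of_one_le (by linarith [mem_Ioi.1 hs]), one_mul]
    rw [this.deriv_eq, (hd t).deriv]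

/-- The du Bois-Reymond argument: `a` is compared with the primitive of `b` that starts at `a 0`.
Their difference integrates to zero against every derivative `χ'`, and by `exists_primitive_cutoff`
these are arbitrary on `t > 0`. Since `χ 0` is free, the initial value is part of the relation. -/
theorem eq_integral_of_weak_deriv {a b : ℝ → ℂ} (ha : ContinuousOn a (Ici 0))
    (hb : ContinuousOn b (Ici 0))
    (h : ∀ χ : ℝ → ℝ, ContDiff ℝ ((⊤ : ℕ∞) : WithTop ℕ∞) χ → HasCompactSupport χ →
      (∫ t in Ioi (0 : ℝ), (((deriv χ t : ℝ) : ℂ) * a t + χ t * b t)) + χ 0 * a 0 = 0)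
    {t : ℝ} (ht : 0 ≤ t) : a t = a 0 + ∫ s in (0 : ℝ)..t, b s := by
  -- Freezing both functions at negative times makes them continuous on all of `ℝ`.
  set a' : ℝ → ℂ := fun t => a (max t 0) with ha'
  set b' : ℝ → ℂ := fun t => b (max t 0) with hb'
  have hmax : Continuous fun t : ℝ => max t 0 := continuous_id.max continuous_const
  have hac : Continuous a' := ha.comp_continuous hmax fun t => mem_Ici.2 (le_max_right _ _)
  have hbc : Continuous b' := hb.comp_continuous hmax fun t => mem_Ici.2 (le_max_right _ _)
  set c : ℝ → ℂ := fun t => a 0 + ∫ s in (0 : ℝ)..t, b' s with hc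
  have hcd : ∀ t, HasDerivAt c (b' t) t := fun t =>
    (intervalIntegral.integral_hasDerivAt_right (hbc.intervalIntegrable _ _)
      hbc.aestronglyMeasurable.stronglyMeasurableAtFilter hbc.continuousAt).const_add _
  have hcc : Continuous c := continuous_iff_continuousAt.2 fun t => (hcd t).continuousAt
  have hc0 : c 0 = a 0 := by simp [hc]
  have key : ∀ᵐ t : ℝ, t ∈ Ioi (0 : ℝ) → a' t - c t = 0 := by
    refine isOpen_Ioi.ae_eq_zero_of_integral_contDiff_smul_eq_zero
      ((hac.sub hcc).locallyIntegrable.locallyIntegrableOn _) fun ψ hψ hψc hψs => ?_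
    obtain ⟨χ, hχ, hχc, hχd⟩ := exists_primitive_cutoff hψ hψc
    have h1 := h χ hχ hχc
    have hχ1 : ContDiff ℝ 1 χ := contDiff_one_of_smooth hχ
    have hχ' : Continuous (deriv χ) := hχ1.continuous_deriv le_rfl
    have hcs : ∀ f : ℝ → ℂ, Continuous f → Integrable (fun t => (χ t : ℂ) * f t) := fun f hf =>
      ((Complex.continuous_ofReal.comp hχ.continuous).mul hf).integrable_of_hasCompactSupport
        ((hχc.comp_left (g := fun x : ℝ => (x : ℂ)) rfl).mul_right)
    have hcs' : ∀ f : ℝ → ℂ, Continuous f → Integrable (fun t => ((deriv χ t : ℝ) : ℂ) * f t) :=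
      fun f hf => ((Complex.continuous_ofReal.comp hχ').mul hf).integrable_of_hasCompactSupport
        ((hχc.deriv.comp_left (g := fun x : ℝ => (x : ℂ)) rfl).mul_right)
    have h2 : ∫ t in Ioi (0 : ℝ), (((deriv χ t : ℝ) : ℂ) * c t + χ t * b' t)
        = 0 - (χ 0 : ℂ) * c 0 := by
      refine integral_Ioi_of_hasDerivAt_of_tendsto' (f := fun t => (χ t : ℂ) * c t)
        (fun t _ => ?_) ((hcs' c hcc).add (hcs b' hbc)).integrableOn ?_
      · exact ((hχ1.differentiable one_ne_zero t).hasDerivAt.ofReal_comp).mul (hcd t)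
      · have : HasCompactSupport fun t => (χ t : ℂ) * c t :=
          (hχc.comp_left (g := fun x : ℝ => (x : ℂ)) rfl).mul_right
        exact this.is_zero_at_infty.mono_left (atTop_le_cocompact)
    have h3 : ∫ t in Ioi (0 : ℝ), (((deriv χ t : ℝ) : ℂ) * a t + χ t * b t)
        = ∫ t in Ioi (0 : ℝ), (((deriv χ t : ℝ) : ℂ) * a' t + χ t * b' t) := by
      refine setIntegral_congr_fun measurableSet_Ioi fun t ht => ?_
      simp only [ha', hb', max_eq_left (le_of_lt (mem_Ioi.1 ht))]
    have h4 : ∫ t, ψ t • (a' t - c t) = ∫ t in Ioi (0 : ℝ), ψ t • (a' t - c t) := by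
      refine (setIntegral_eq_integral_of_forall_compl_eq_zero fun t ht => ?_).symm
      have : ψ t = 0 := by
        by_contra hne
        exact ht (hψs (subset_tsupport ψ hne))
      rw [this, zero_smul]
    have h5 : ∫ t in Ioi (0 : ℝ), ψ t • (a' t - c t)
        = ∫ t in Ioi (0 : ℝ), ((((deriv χ t : ℝ) : ℂ) * a' t + χ t * b' t)
          - (((deriv χ t : ℝ) : ℂ) * c t + χ t * b' t)) := by
      refine setIntegral_congr_fun measurableSet_Ioi fun t ht => ?_
      simp only [hχd t ht, Complex.real_smul]
      ring
    have h6 : ∫ t in Ioi (0 : ℝ), ((((deriv χ t : ℝ) : ℂ) * a' t + χ t * b' t)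
          - (((deriv χ t : ℝ) : ℂ) * c t + χ t * b' t)) = _ :=
      integral_sub ((hcs' a' hac).add (hcs b' hbc)).integrableOn
        ((hcs' c hcc).add (hcs b' hbc)).integrableOn
    rw [h4, h5, h6, ← h3, h2, hc0]
    linear_combination h1
  have hEq : EqOn (fun t => a' t - c t) (fun _ => 0) (Ioi 0) := by
    have h1 : (fun t => a' t - c t) =ᵐ[volume.restrict (Ioi 0)] fun _ => 0 :=
      (ae_restrict_iff' measurableSet_Ioi).2 key
    exact Measure.eqOn_of_ae_eq h1 (hac.sub hcc).continuousOn continuousOn_const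
      (by rw [isOpen_Ioi.interior_eq]; exact subset_closure)
  have hcl : a' t = c t := by
    rcases ht.eq_or_lt with rfl | ht
    · rw [hc0]; simp [ha']
    · exact sub_eq_zero.1 (hEq ht)
  simp only [ha', max_eq_left ht] at hcl
  rw [hcl, hc]
  simp only [add_right_inj]
  refine intervalIntegral.integral_congr fun s hs => ?_
  rw [uIcc_of_le ht] at hs
  simp only [hb', max_eq_left hs.1]

theorem exists_cutoff : ∃ ρ : ℝ → ℝ, ContDiff ℝ ((⊤ : ℕ∞) : WithTop ℕ∞) ρ ∧ HasCompactSupport ρ ∧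
    ∀ y, |y| ≤ 1 → ρ y = 1 := by
  let b : ContDiffBump (0 : ℝ) := ⟨1, 2, one_pos, one_lt_two⟩
  exact ⟨b, b.contDiff, b.hasCompactSupport, fun y hy =>
    b.one_of_mem_closedBall (by simpa using hy)⟩

theorem tendsto_integral_mul {Y : L2R} {g : ℕ → ℝ → ℂ} {G : ℝ → ℂ} {B : ℝ → ℝ}
    (hB : MemLp B 2 volume) (hg : ∀ n, Continuous (g n)) (hle : ∀ n y, ‖g n y‖ ≤ B y)
    (hlim : ∀ y, ∀ᶠ n in atTop, g n y = G y) :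
    Tendsto (fun n => ∫ y, Y y * g n y) atTop (𝓝 (∫ y, Y y * G y)) := by
  refine tendsto_integral_of_dominated_convergence (fun y => ‖Y y‖ * B y)
    (fun n => (Lp.memLp Y).1.mul (hg n).aestronglyMeasurable)
    ((Lp.memLp Y).norm.integrable_mul hB) (fun n => ae_of_all _ fun y => ?_)
    (ae_of_all _ fun y => ?_)
  · rw [norm_mul]
    exact mul_le_mul_of_nonneg_left (hle n y) (norm_nonneg _)
  · exact tendsto_const_nhds.congr' ((hlim y).mono fun n hn => by simp only [hn])

/-- The transform of a compactly supported function is Schwartz but need not have compact support,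
so the test class has to be enlarged before passing to the Fourier side. The cutoffs `ρ (ε y) G`
with `ε ≤ 1` have derivatives dominated by those of `G`, and dominated convergence applies. -/
theorem weak_relation_schwartz {Y₀ Y₁ Y₂ : L2R}
    (h : ∀ g : ℝ → ℂ, ContDiff ℝ ((⊤ : ℕ∞) : WithTop ℕ∞) g → HasCompactSupport g →
      (∫ y, Y₀ y * g y) + (∫ y, Y₁ y * deriv g y) + (∫ y, Y₂ y * deriv (deriv g) y) = 0)
    (G : SchwartzMap ℝ ℂ) :
    (∫ y, Y₀ y * G y) + (∫ y, Y₁ y * deriv G y) + (∫ y, Y₂ y * deriv (deriv G) y) = 0 := by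
  obtain ⟨ρ, hρ, hρc, hρ1⟩ := exists_cutoff
  have hbound : ∀ f : ℝ → ℝ, Continuous f → HasCompactSupport f → ∃ C, 0 ≤ C ∧ ∀ y, |f y| ≤ C := by
    intro f hf hfc
    obtain ⟨C, hC⟩ := hf.bounded_above_of_compact_support hfc
    exact ⟨C, (norm_nonneg _).trans (hC 0), hC⟩
  have hρ2 : ContDiff ℝ 1 ρ := contDiff_one_of_smooth hρ
  have hρd : ContDiff ℝ 1 (deriv ρ) := contDiff_one_of_smooth (smooth_deriv hρ)
  obtain ⟨C₀, hC₀, hb₀⟩ := hbound ρ hρ.continuous hρc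
  obtain ⟨C₁, hC₁, hb₁⟩ := hbound (deriv ρ) hρd.continuous hρc.deriv
  obtain ⟨C₂, hC₂, hb₂⟩ := hbound (deriv (deriv ρ)) (hρd.continuous_deriv le_rfl) hρc.deriv.deriv
  set ε : ℕ → ℝ := fun n => 1 / ((n : ℝ) + 1) with hε
  have hε0 : ∀ n, 0 < ε n := fun n => by positivity
  have hε1 : ∀ n, ε n ≤ 1 := fun n => by
    rw [hε, div_le_one (by positivity)]; linarith [Nat.cast_nonneg (α := ℝ) n]
  set g : ℕ → ℝ → ℂ := fun n y => (ρ (ε n * y) : ℂ) * G y with hg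
  set G₁ := SchwartzMap.derivCLM ℂ ℂ G with hG₁
  set G₂ := SchwartzMap.derivCLM ℂ ℂ G₁ with hG₂
  have hGd : ∀ y, HasDerivAt G (G₁ y) y := fun y => G.differentiableAt.hasDerivAt
  have hGd₁ : ∀ y, HasDerivAt G₁ (G₂ y) y := fun y => G₁.differentiableAt.hasDerivAt
  have hderG : deriv G = G₁ := funext fun y => (hGd y).deriv
  have hderG₁ : deriv G₁ = G₂ := funext fun y => (hGd₁ y).deriv
  have hgs : ∀ n, ContDiff ℝ ((⊤ : ℕ∞) : WithTop ℕ∞) (g n) := fun n =>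
    (Complex.ofRealCLM.contDiff.comp (hρ.comp (contDiff_const.mul contDiff_id))).mul (G.smooth ⊤)
  have hgc : ∀ n, HasCompactSupport (g n) := fun n => by
    have : HasCompactSupport fun y => ρ (ε n * y) :=
      hρc.comp_homeomorph (Homeomorph.mulLeft₀ (ε n) (hε0 n).ne')
    exact (this.comp_left (g := fun x : ℝ => (x : ℂ)) rfl).mul_right
  have hscale : ∀ (f f' : ℝ → ℝ), (∀ y, HasDerivAt f (f' y) y) → ∀ n y,
      HasDerivAt (fun y => (f (ε n * y) : ℂ)) ((ε n : ℂ) * f' (ε n * y)) y := by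
    intro f f' hf n y
    have h1 : HasDerivAt (fun y => ε n * y) (ε n) y := by
      simpa using (hasDerivAt_id y).const_mul (ε n)
    have := ((hf (ε n * y)).comp y h1).ofReal_comp
    rw [mul_comm]
    simpa using this
  have hρ' : ∀ y, HasDerivAt ρ (deriv ρ y) y := fun y =>
    (hρ2.differentiable one_ne_zero y).hasDerivAt
  have hρ'' : ∀ y, HasDerivAt (deriv ρ) (deriv (deriv ρ) y) y := fun y =>
    (hρd.differentiable one_ne_zero y).hasDerivAt
  have hd1 : ∀ n, deriv (g n) = fun y => (ε n : ℂ) * deriv ρ (ε n * y) * G y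
      + ρ (ε n * y) * G₁ y := fun n => funext fun y => by
    exact ((hscale ρ _ hρ' n y).mul (hGd y)).deriv
  have hd2 : ∀ n, deriv (deriv (g n)) = fun y =>
      ((ε n : ℂ) * ((ε n : ℂ) * deriv (deriv ρ) (ε n * y)) * G y
        + (ε n : ℂ) * deriv ρ (ε n * y) * G₁ y)
      + ((ε n : ℂ) * deriv ρ (ε n * y) * G₁ y + ρ (ε n * y) * G₂ y) := fun n => by
    rw [hd1]
    funext y
    exact ((((hscale _ _ hρ'' n y).const_mul (ε n : ℂ)).mul (hGd y)).add
      ((hscale ρ _ hρ' n y).mul (hGd₁ y))).deriv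
  -- Equality near `y`, not only at `y`, so that the first and second derivatives eventually agree
  -- as well.
  have hev : ∀ y, ∀ᶠ n in atTop, g n =ᶠ[𝓝 y] G := by
    intro y
    have h1 : Tendsto (fun n => ε n * (|y| + 1)) atTop (𝓝 (0 * (|y| + 1))) :=
      tendsto_one_div_add_atTop_nhds_zero_nat.mul_const _
    rw [zero_mul] at h1
    filter_upwards [h1.eventually (gt_mem_nhds one_pos)] with n hn
    have h2 : ∀ᶠ z in 𝓝 y, |z| < |y| + 1 :=
      continuous_abs.continuousAt.eventually (gt_mem_nhds (lt_add_one _))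
    filter_upwards [h2] with z hz
    rw [hg]
    simp only
    rw [hρ1, Complex.ofReal_one, one_mul]
    rw [abs_mul, abs_of_pos (hε0 n)]
    exact (mul_le_mul_of_nonneg_left hz.le (hε0 n).le).trans hn.le
  have hm : ∀ H : SchwartzMap ℝ ℂ, MemLp (fun y => ‖H y‖) 2 volume := fun H => (H.memLp 2).norm
  have t0 := tendsto_integral_mul (Y := Y₀) (g := g) (G := G) ((hm G).const_mul C₀)
    (fun n => (hgs n).continuous) (fun n y => by
      rw [hg]; simp only; rw [norm_mul, Complex.norm_real]
      exact mul_le_mul_of_nonneg_right (hb₀ _) (norm_nonneg _))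
    (fun y => (hev y).mono fun n hn => hn.self_of_nhds)
  have e1 : ∀ n y, ‖(ε n : ℂ) * deriv ρ (ε n * y)‖ ≤ C₁ := fun n y => by
    rw [norm_mul, Complex.norm_real, Complex.norm_real, Real.norm_of_nonneg (hε0 n).le]
    exact (mul_le_of_le_one_left (norm_nonneg _) (hε1 n)).trans (hb₁ _)
  have e2 : ∀ n y, ‖(ε n : ℂ) * ((ε n : ℂ) * deriv (deriv ρ) (ε n * y))‖ ≤ C₂ := fun n y => by
    rw [norm_mul, norm_mul, Complex.norm_real, Complex.norm_real, Real.norm_of_nonneg (hε0 n).le]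
    exact (mul_le_of_le_one_left (mul_nonneg (hε0 n).le (norm_nonneg _)) (hε1 n)).trans
      ((mul_le_of_le_one_left (norm_nonneg _) (hε1 n)).trans (hb₂ _))
  have e0 : ∀ n y, ‖(ρ (ε n * y) : ℂ)‖ ≤ C₀ := fun n y => by
    rw [Complex.norm_real]; exact hb₀ _
  have t1 := tendsto_integral_mul (Y := Y₁) (g := fun n => deriv (g n)) (G := deriv G)
    (((hm G).const_mul C₁).add ((hm G₁).const_mul C₀))
    (fun n => (smooth_deriv (hgs n)).continuous) (fun n y => by
      rw [hd1]
      refine (norm_add_le _ _).trans (add_le_add ?_ ?_) <;> rw [norm_mul]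
      · exact mul_le_mul_of_nonneg_right (e1 n y) (norm_nonneg _)
      · exact mul_le_mul_of_nonneg_right (e0 n y) (norm_nonneg _))
    (fun y => (hev y).mono fun n hn => hn.deriv_eq)
  have t2 := tendsto_integral_mul (Y := Y₂) (g := fun n => deriv (deriv (g n)))
    (G := deriv (deriv G))
    ((((hm G).const_mul C₂).add ((hm G₁).const_mul C₁)).add
      (((hm G₁).const_mul C₁).add ((hm G₂).const_mul C₀)))
    (fun n => (smooth_deriv (smooth_deriv (hgs n))).continuous) (fun n y => by
      rw [hd2]
      refine (norm_add_le _ _).trans (add_le_add ((norm_add_le _ _).trans (add_le_add ?_ ?_))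
        ((norm_add_le _ _).trans (add_le_add ?_ ?_))) <;> rw [norm_mul]
      · exact mul_le_mul_of_nonneg_right (e2 n y) (norm_nonneg _)
      · exact mul_le_mul_of_nonneg_right (e1 n y) (norm_nonneg _)
      · exact mul_le_mul_of_nonneg_right (e1 n y) (norm_nonneg _)
      · exact mul_le_mul_of_nonneg_right (e0 n y) (norm_nonneg _))
    (fun y => (hev y).mono fun n hn => hn.deriv.deriv_eq)
  refine tendsto_nhds_unique ((t0.add t1).add t2) ?_
  exact tendsto_const_nhds.congr fun n => (h (g n) (hgs n) (hgc n)).symm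

theorem exists_deriv_fourier {ψ : SchwartzMap ℝ ℂ} (hψ : HasCompactSupport ψ) :
    ∃ ψ' : SchwartzMap ℝ ℂ, HasCompactSupport ψ' ∧
      (∀ η, ψ' η = (-2 * π * Complex.I * η) * ψ η) ∧
      deriv (𝓕 (ψ : ℝ → ℂ)) = 𝓕 (ψ' : ℝ → ℂ) := by
  have hs : ContDiff ℝ ((⊤ : ℕ∞) : WithTop ℕ∞) fun η : ℝ => (-2 * π * Complex.I * η) * ψ η :=
    (contDiff_const.mul Complex.ofRealCLM.contDiff).mul (ψ.smooth ⊤)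
  have hc : HasCompactSupport fun η : ℝ => (-2 * π * Complex.I * η) * ψ η := hψ.mul_left
  refine ⟨hc.toSchwartzMap hs, hc, fun η => rfl, ?_⟩
  have hi : Integrable fun η : ℝ => η • ψ η :=
    (continuous_id.smul ψ.continuous).integrable_of_hasCompactSupport hψ.smul_left
  exact Real.deriv_fourier ψ.integrable hi

theorem integrable_schwartz_mul (ψ : SchwartzMap ℝ ℂ) (Y : L2R) :
    Integrable (fun η => ψ η * (𝓕 Y : L2R) η) volume :=
  (ψ.memLp 2).integrable_mul (Lp.memLp (𝓕 Y : L2R))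

theorem integral_schwartz_relation {Y₀ Y₁ Y₂ : L2R}
    (h : ∀ g : ℝ → ℂ, ContDiff ℝ ((⊤ : ℕ∞) : WithTop ℕ∞) g → HasCompactSupport g →
      (∫ y, Y₀ y * g y) + (∫ y, Y₁ y * deriv g y) + (∫ y, Y₂ y * deriv (deriv g) y) = 0)
    {φ : SchwartzMap ℝ ℂ} (hφ : HasCompactSupport φ) :
    ∫ η : ℝ, φ η * ((𝓕 Y₀ : L2R) η + (-2 * π * Complex.I * η) * (𝓕 Y₁ : L2R) η
      + (-2 * π * Complex.I * η) ^ 2 * (𝓕 Y₂ : L2R) η) = 0 := by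
  obtain ⟨φ₁, hc₁, he₁, hd₁⟩ := exists_deriv_fourier hφ
  obtain ⟨φ₂, hc₂, he₂, hd₂⟩ := exists_deriv_fourier hc₁
  have key : (∫ y, Y₀ y * 𝓕 (φ : ℝ → ℂ) y) + (∫ y, Y₁ y * deriv (𝓕 (φ : ℝ → ℂ)) y)
      + (∫ y, Y₂ y * deriv (deriv (𝓕 (φ : ℝ → ℂ))) y) = 0 := weak_relation_schwartz h (𝓕 φ)
  rw [hd₁, hd₂] at key
  have hcomm : ∀ (Y : L2R) (ψ : SchwartzMap ℝ ℂ),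
      ∫ y, Y y * 𝓕 (ψ : ℝ → ℂ) y = ∫ η, ψ η * (𝓕 Y : L2R) η := fun Y ψ => by
    rw [integral_mul_fourier]
    exact integral_congr_ae (ae_of_all _ fun y => mul_comm _ _)
  rw [hcomm Y₀ φ, hcomm Y₁ φ₁, hcomm Y₂ φ₂] at key
  have hsum := integral_add ((integrable_schwartz_mul φ Y₀).add (integrable_schwartz_mul φ₁ Y₁)) (integrable_schwartz_mul φ₂ Y₂)
  have hsum' := integral_add (integrable_schwartz_mul φ Y₀) (integrable_schwartz_mul φ₁ Y₁)
  simp only [Pi.add_apply] at hsum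
  rw [← hsum', ← hsum] at key
  rw [← key]
  refine integral_congr_ae (ae_of_all _ fun η => ?_)
  simp only [he₂, he₁]
  ring

/-- Testing with `g = 𝓕 φ` turns each derivative of `g` into a factor `-2πiη` on `φ`. The
differential relation in `y` thus becomes algebraic at almost every frequency. -/
theorem fourier_relation {Y₀ Y₁ Y₂ : L2R}
    (h : ∀ g : ℝ → ℂ, ContDiff ℝ ((⊤ : ℕ∞) : WithTop ℕ∞) g → HasCompactSupport g →
      (∫ y, Y₀ y * g y) + (∫ y, Y₁ y * deriv g y) + (∫ y, Y₂ y * deriv (deriv g) y) = 0) :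
    ∀ᵐ η : ℝ, (𝓕 Y₀ : L2R) η + (-2 * π * Complex.I * η) * (𝓕 Y₁ : L2R) η
      + (-2 * π * Complex.I * η) ^ 2 * (𝓕 Y₂ : L2R) η = 0 := by
  have hL : ∀ Y : L2R, LocallyIntegrable (𝓕 Y : L2R) volume := fun Y =>
    (Lp.memLp _).locallyIntegrable (by norm_num)
  have hcont : Continuous fun η : ℝ => -2 * π * Complex.I * (η : ℂ) := by fun_prop
  have hl1 : LocallyIntegrable (fun η : ℝ => (-2 * π * Complex.I * η) * (𝓕 Y₁ : L2R) η) volume :=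
    (hL Y₁).continuous_mul hcont
  have hl2 : LocallyIntegrable (fun η : ℝ => (-2 * π * Complex.I * η) ^ 2 * (𝓕 Y₂ : L2R) η)
      volume := (hL Y₂).continuous_mul (hcont.pow 2)
  refine ae_eq_of_integral_schwartz_mul (g := fun _ => 0) (((hL Y₀).add hl1).add hl2)
    locallyIntegrable_zero fun φ hφ => ?_
  simp only [mul_zero, integral_zero]
  exact integral_schwartz_relation h hφ

/-! ### Testing the equations with a single mode -/

/-- The phase by which the `k`-th mode is rotated when passing to the moving coordinates. -/
def phase (k : ℤ) (β t y : ℝ) : ℂ := Complex.exp (Complex.I * k * β * t * y)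

/-- A test function concentrated on one `x`-frequency in the moving coordinates. -/
def modeTest (k : ℤ) (β : ℝ) (χ : ℝ → ℝ) (g : ℝ → ℂ) (t : ℝ) (p : Channel) : ℂ :=
  fourier (-k) p.1 * (χ t * (phase k β t p.2 * g p.2))

theorem hasDerivAt_phase_y (k : ℤ) (β t y : ℝ) :
    HasDerivAt (phase k β t) (Complex.I * k * β * t * phase k β t y) y := by
  have h : HasDerivAt (fun y : ℝ => Complex.I * k * β * t * (y : ℂ)) (Complex.I * k * β * t * 1) y :=
    (Complex.ofRealCLM.hasDerivAt (x := y)).const_mul _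
  refine h.cexp.congr_deriv ?_
  rw [phase]; ring

theorem hasDerivAt_phase_t (k : ℤ) (β t y : ℝ) :
    HasDerivAt (fun t => phase k β t y) (Complex.I * k * β * y * phase k β t y) t := by
  have h : HasDerivAt (fun t : ℝ => Complex.I * k * β * t * (y : ℂ))
      (Complex.I * k * β * 1 * y) t :=
    ((Complex.ofRealCLM.hasDerivAt (x := t)).const_mul _).mul_const _
  refine h.cexp.congr_deriv ?_
  rw [phase]; ring

theorem norm_phase (k : ℤ) (β t y : ℝ) : ‖phase k β t y‖ = 1 := by
  rw [phase, show Complex.I * k * β * t * y = ((k * β * t * y : ℝ) : ℂ) * Complex.I by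
    push_cast; ring, Complex.norm_exp_ofReal_mul_I]

theorem isTest_modeTest (k : ℤ) (β : ℝ) {χ : ℝ → ℝ} {g : ℝ → ℂ}
    (hχ : ContDiff ℝ ((⊤ : ℕ∞) : WithTop ℕ∞) χ) (hχc : HasCompactSupport χ)
    (hg : ContDiff ℝ ((⊤ : ℕ∞) : WithTop ℕ∞) g) (hgc : HasCompactSupport g) :
    IsTest (modeTest k β χ g) := by
  refine ⟨?_, ?_⟩
  · have h0 : ∀ q : ℝ × ℝ × ℝ, modeTest k β χ g q.1 ((q.2.1 : Torus), q.2.2) =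
        Complex.exp (2 * π * Complex.I * ((-k : ℤ) : ℂ) * (q.2.1 : ℂ) / ((2 * π : ℝ) : ℂ)) *
          ((χ q.1 : ℂ) * (Complex.exp (Complex.I * k * β * (q.1 : ℂ) * (q.2.2 : ℂ)) * g q.2.2)) := by
      intro q; rw [modeTest, fourier_coe_apply, phase]
    simp only [h0]
    have c1 : ContDiff ℝ ((⊤ : ℕ∞) : WithTop ℕ∞) fun q : ℝ × ℝ × ℝ => (q.1 : ℂ) :=
      Complex.ofRealCLM.contDiff.comp contDiff_fst
    have c2 : ContDiff ℝ ((⊤ : ℕ∞) : WithTop ℕ∞) fun q : ℝ × ℝ × ℝ => (q.2.1 : ℂ) :=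
      Complex.ofRealCLM.contDiff.comp (contDiff_fst.comp contDiff_snd)
    have c3 : ContDiff ℝ ((⊤ : ℕ∞) : WithTop ℕ∞) fun q : ℝ × ℝ × ℝ => (q.2.2 : ℂ) :=
      Complex.ofRealCLM.contDiff.comp (contDiff_snd.comp contDiff_snd)
    refine ContDiff.mul ((contDiff_const.mul c2).div_const _).cexp
      (ContDiff.mul (Complex.ofRealCLM.contDiff.comp (hχ.comp contDiff_fst))
        (ContDiff.mul ((contDiff_const.mul c1).mul c3).cexp
          (hg.comp (contDiff_snd.comp contDiff_snd))))
  · refine HasCompactSupport.intro (K := tsupport χ ×ˢ ((univ : Set Torus) ×ˢ tsupport g))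
      (hχc.isCompact.prod (isCompact_univ.prod hgc.isCompact)) fun q hq => ?_
    rw [modeTest]
    by_cases h1 : q.1 ∈ tsupport χ
    · have h2 : q.2.2 ∉ tsupport g := fun h2 => hq ⟨h1, mem_univ _, h2⟩
      rw [image_eq_zero_of_notMem_tsupport h2, mul_zero, mul_zero, mul_zero]
    · rw [image_eq_zero_of_notMem_tsupport h1, Complex.ofReal_zero, zero_mul, mul_zero]

/-- The function `e^{imx} u(y)`. -/
def modeFun (m : ℤ) (u : ℝ → ℂ) (p : Channel) : ℂ := fourier m p.1 * u p.2

theorem dX_modeFun (m : ℤ) (u : ℝ → ℂ) :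
    dX (modeFun m u) = modeFun m fun y => Complex.I * m * u y := by
  funext p
  have h1 := (hasDerivAt_fourier (2 * π) m 0).const_mul (fourier m p.1 : ℂ)
  have h2 := h1.mul_const (u p.2)
  have h3 : (fun h : ℝ => modeFun m u (p.1 + (h : Torus), p.2)) =
      fun h : ℝ => (fourier m p.1 : ℂ) * fourier m (h : Torus) * u p.2 :=
    funext fun h => by rw [modeFun, fourier_add_point]
  rw [dX, h3]
  refine h2.deriv.trans ?_
  have hpi : (π : ℂ) ≠ 0 := Complex.ofReal_ne_zero.2 Real.pi_ne_zero
  rw [AddCircle.coe_zero, fourier_eval_zero, modeFun]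
  push_cast
  field_simp

theorem dY_modeFun (m : ℤ) (u : ℝ → ℂ) : dY (modeFun m u) = modeFun m (deriv u) := by
  funext p
  exact deriv_const_mul_field (fourier m p.1 : ℂ)

theorem deriv_phase_mul (k : ℤ) (β t : ℝ) (c : ℂ) {g : ℝ → ℂ} (hg : Differentiable ℝ g) :
    deriv (fun y => c * (phase k β t y * g y)) =
      fun y => c * (phase k β t y * (deriv g y + Complex.I * k * β * t * g y)) := by
  funext y
  have := (((hasDerivAt_phase_y k β t y).mul (hg y).hasDerivAt).const_mul c).deriv
  refine this.trans ?_
  ring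

/-- The operator `-c k² + d (∂_y + i k β t)²` applied to `g`. -/
def modeOp (k : ℤ) (β c d t : ℝ) (g : ℝ → ℂ) (y : ℝ) : ℂ :=
  -(c * k ^ 2 + d * (k * β * t) ^ 2) * g y + 2 * Complex.I * k * β * t * d * deriv g y
    + d * deriv (deriv g) y

/-- The time derivative of the phase, `ikβy`, cancels the transport term `βy ∂ₓ` acting on
`e^{-ikx}`. The price is that `∂_y` becomes `∂_y + ikβt`, which is the content of `modeOp`. -/
theorem adjointOp_modeTest (k : ℤ) (β c d : ℝ) {χ : ℝ → ℝ} {g : ℝ → ℂ}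
    (hχ : ContDiff ℝ ((⊤ : ℕ∞) : WithTop ℕ∞) χ)
    (hg : ContDiff ℝ ((⊤ : ℕ∞) : WithTop ℕ∞) g) (t : ℝ) (p : Channel) :
    adjointOp β c d (modeTest k β χ g) t p = fourier (-k) p.1 * (phase k β t p.2 *
      ((deriv χ t : ℝ) * g p.2 + χ t * modeOp k β c d t g p.2)) := by
  have hgd : Differentiable ℝ g := (contDiff_one_of_smooth hg).differentiable one_ne_zero
  have hgd' : Differentiable ℝ (deriv g) :=
    (contDiff_one_of_smooth (smooth_deriv hg)).differentiable one_ne_zero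
  have hχd : HasDerivAt χ (deriv χ t) t :=
    ((contDiff_one_of_smooth hχ).differentiable one_ne_zero t).hasDerivAt
  have hT : dT (modeTest k β χ g) t p = fourier (-k) p.1 * (((deriv χ t : ℝ) : ℂ) *
      (phase k β t p.2 * g p.2) + χ t * (Complex.I * k * β * p.2 * phase k β t p.2 * g p.2)) := by
    rw [dT]
    unfold modeTest
    exact ((hχd.ofReal_comp.mul ((hasDerivAt_phase_t k β t p.2).mul_const (g p.2))).const_mul
      (fourier (-k) p.1 : ℂ)).deriv
  have hφ : modeTest k β χ g t = modeFun (-k) fun y => (χ t : ℂ) * (phase k β t y * g y) := rfl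
  have hd : Differentiable ℝ fun y => deriv g y + Complex.I * k * β * t * g y :=
    hgd'.add (hgd.const_mul _)
  have hd2 : deriv (fun y => deriv g y + Complex.I * k * β * t * g y) p.2
      = deriv (deriv g) p.2 + Complex.I * k * β * t * deriv g p.2 :=
    ((hgd' p.2).hasDerivAt.add ((hgd p.2).hasDerivAt.const_mul _)).deriv
  rw [adjointOp, hT, hφ, dX_modeFun, dX_modeFun, dY_modeFun, dY_modeFun,
    deriv_phase_mul k β t _ hgd, deriv_phase_mul k β t _ hd]
  simp only [modeFun, hd2]
  rw [modeOp]
  push_cast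
  linear_combination (((d * (χ t * fourier (-k) p.1 * phase k β t p.2 * g p.2)) : ℂ) * (k * β * t) ^ 2
    + c * k ^ 2 * (χ t * fourier (-k) p.1 * phase k β t p.2 * g p.2)) * Complex.I_sq

theorem dX_modeTest (k : ℤ) (β : ℝ) (χ : ℝ → ℝ) (g : ℝ → ℂ) (t : ℝ) (p : Channel) :
    dX (modeTest k β χ g t) p = -(Complex.I * k) *
      (fourier (-k) p.1 * (phase k β t p.2 * (χ t * g p.2))) := by
  have hφ : modeTest k β χ g t = modeFun (-k) fun y => (χ t : ℂ) * (phase k β t y * g y) := rfl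
  rw [hφ, dX_modeFun, modeFun]
  push_cast
  ring

theorem memLp_mode (k : ℤ) (β t : ℝ) {G : ℝ → ℂ} (hG : MemLp G 2 volume) :
    MemLp (fun p : Channel => fourier (-k) p.1 * (phase k β t p.2 * G p.2)) 2 channelMeasure := by
  have hph : Continuous (phase k β t) :=
    continuous_iff_continuousAt.2 fun y => (hasDerivAt_phase_y k β t y).continuousAt
  have h := hG.comp_snd (AddCircle.haarAddCircle : Measure Torus)
  refine h.of_le ((measurable_fourier_fst (-k)).aestronglyMeasurable.mul
    ((hph.comp continuous_snd).aestronglyMeasurable.mul h.1)) (ae_of_all _ fun p => ?_)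
  rw [norm_mul, norm_mul, norm_fourier_apply, norm_phase, one_mul, one_mul]

theorem integrable_mul_mode (k : ℤ) (β t : ℝ) (f : L2) {G : ℝ → ℂ} (hG : MemLp G 2 volume) :
    Integrable (fun p => f p * (fourier (-k) p.1 * (phase k β t p.2 * G p.2))) channelMeasure :=
  (Lp.memLp f).integrable_mul (memLp_mode k β t hG)

/-- Pairing with one mode in the moving coordinates. -/
theorem integral_mul_mode (k : ℤ) (β t : ℝ) (f : L2) {G : ℝ → ℂ} (hG : MemLp G 2 volume) :
    ∫ p, f p * (fourier (-k) p.1 * (phase k β t p.2 * G p.2)) ∂channelMeasure =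
      ∫ y, xc k (comoving β t f) y * G y := by
  refine (integral_channel (integrable_mul_mode k β t f hG)).trans (integral_congr_ae ?_)
  filter_upwards [coeFn_xc k (comoving β t f), xCoeff_comoving β t f k] with y h1 h2
  rw [h1, h2, xCoeff, fourierCoeff, ← integral_const_mul, ← integral_mul_const]
  refine integral_congr_ae (ae_of_all _ fun x => ?_)
  have hpi : (π : ℂ) ≠ 0 := Complex.ofReal_ne_zero.2 Real.pi_ne_zero
  have : phase k β t y = Complex.exp (2 * π * (β * k * t / (2 * π) : ℝ) * y * Complex.I) := by
    rw [phase]; congr 1; push_cast; field_simp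
  simp only [smul_eq_mul]
  rw [this]
  ring

/-- The bilinear pairing `∫ Y g`. -/
def pairing (g : L2R) : L2R →L[ℂ] ℂ :=
  ((ContinuousLinearMap.mul ℂ ℂ).lpPairing (volume : Measure ℝ) 2 2).flip g

theorem pairing_toLp {g : ℝ → ℂ} (hg : MemLp g 2 volume) (Y : L2R) :
    pairing hg.toLp Y = ∫ y, Y y * g y := by
  rw [pairing, ContinuousLinearMap.flip_apply, ContinuousLinearMap.lpPairing_eq_integral]
  refine integral_congr_ae ?_
  filter_upwards [hg.coeFn_toLp] with y hy
  rw [hy]; rfl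

theorem continuousOn_intervalIntegrable {F : Type*} [NormedAddCommGroup F] {f : ℝ → F}
    (hf : ContinuousOn f (Ici 0)) {t : ℝ} (ht : 0 ≤ t) : IntervalIntegrable f volume 0 t :=
  (hf.mono (by rw [uIcc_of_le ht]; exact Icc_subset_Ici_self)).intervalIntegrable

/-- Time and `y` are treated one after the other. For fixed `g` the pairings with `F` satisfy a weak
scalar ODE, hence an integral equation. Pulling the time integral out of the pairings leaves a weak
relation in `y` between `L²`-valued integrals, to which `fourier_relation` applies. -/
theorem mode_relation (k : ℤ) (β c d : ℝ) {F r : ℝ → L2R} (hF : ContinuousOn F (Ici 0))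
    (hr : ContinuousOn r (Ici 0))
    (h : ∀ (χ : ℝ → ℝ) (g : ℝ → ℂ), ContDiff ℝ ((⊤ : ℕ∞) : WithTop ℕ∞) χ → HasCompactSupport χ →
      ContDiff ℝ ((⊤ : ℕ∞) : WithTop ℕ∞) g → HasCompactSupport g →
      (∫ t in Ioi (0 : ℝ), ((∫ y, F t y * ((deriv χ t : ℝ) * g y + χ t * modeOp k β c d t g y))
        + ∫ y, r t y * (χ t * g y))) + ∫ y, F 0 y * (χ 0 * g y) = 0)
    {t : ℝ} (ht : 0 ≤ t) :
    ∀ᵐ η : ℝ, (𝓕 (F t - F 0 + ∫ s in (0 : ℝ)..t,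
          (((c * k ^ 2 + d * (k * β * s) ^ 2 : ℝ) : ℂ) • F s - r s)) : L2R) η
      + (-2 * π * Complex.I * η) *
        (𝓕 (- ∫ s in (0 : ℝ)..t, (2 * Complex.I * k * β * s * d) • F s) : L2R) η
      + (-2 * π * Complex.I * η) ^ 2 * (𝓕 (- ∫ s in (0 : ℝ)..t, (d : ℂ) • F s) : L2R) η = 0 := by
  refine fourier_relation fun g hg hgc => ?_
  have hcs : ∀ f : ℝ → ℂ, Continuous f → HasCompactSupport f → MemLp f 2 volume :=
    fun f hf hfc => hf.memLp_of_hasCompactSupport hfc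
  have hm0 := hcs g hg.continuous hgc
  have hm1 := hcs (deriv g) (smooth_deriv hg).continuous hgc.deriv
  have hm2 := hcs (deriv (deriv g)) (smooth_deriv (smooth_deriv hg)).continuous hgc.deriv.deriv
  rw [← pairing_toLp hm0, ← pairing_toLp hm1, ← pairing_toLp hm2]
  set p0 := pairing hm0.toLp
  set p1 := pairing hm1.toLp
  set p2 := pairing hm2.toLp
  have hi : ∀ (Y : L2R) {f : ℝ → ℂ}, MemLp f 2 volume → Integrable (fun y => Y y * f y) :=
    fun Y f hf => (Lp.memLp Y).integrable_mul hf
  set A : ℝ → ℂ := fun s => ((c * k ^ 2 + d * (k * β * s) ^ 2 : ℝ) : ℂ) with hA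
  set B : ℝ → ℂ := fun s => 2 * Complex.I * k * β * s * d with hB
  have hAc : Continuous A := by rw [hA]; fun_prop
  have hBc : Continuous B := by rw [hB]; fun_prop
  have hop : ∀ s (Y : L2R) (u v : ℂ), ∫ y, Y y * (u * g y + v * modeOp k β c d s g y) =
      u * p0 Y + v * (- A s * p0 Y + B s * p1 Y + d * p2 Y) := by
    intro s Y u v
    have e : ∀ y, Y y * (u * g y + v * modeOp k β c d s g y) = (u - v * A s) * (Y y * g y)
        + (v * B s) * (Y y * deriv g y) + (v * d) * (Y y * deriv (deriv g) y) := by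
      intro y
      rw [modeOp, hA, hB]; push_cast; ring
    simp only [e]
    have e1 := integral_add (((hi Y hm0).const_mul (u - v * A s)).add
      ((hi Y hm1).const_mul (v * B s))) ((hi Y hm2).const_mul (v * d))
    have e2 := integral_add ((hi Y hm0).const_mul (u - v * A s)) ((hi Y hm1).const_mul (v * B s))
    simp only [Pi.add_apply] at e1
    rw [e1, e2, integral_const_mul, integral_const_mul, integral_const_mul,
      ← pairing_toLp hm0, ← pairing_toLp hm1, ← pairing_toLp hm2]
    ring
  have hsrc : ∀ (Y : L2R) (u : ℂ), ∫ y, Y y * (u * g y) = u * p0 Y := fun Y u => by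
    rw [pairing_toLp hm0, ← integral_const_mul]
    exact integral_congr_ae (ae_of_all _ fun y => by ring)
  have hAF : ContinuousOn (fun s => A s • F s - r s) (Ici 0) := (hAc.continuousOn.smul hF).sub hr
  have hBF : ContinuousOn (fun s => B s • F s) (Ici 0) := hBc.continuousOn.smul hF
  have hdF : ContinuousOn (fun s => (d : ℂ) • F s) (Ici 0) := hF.const_smul (d : ℂ)
  have key := eq_integral_of_weak_deriv (a := fun s => p0 (F s))
    (b := fun s => - p0 (A s • F s - r s) + p1 (B s • F s) + p2 ((d : ℂ) • F s))
    (p0.continuous.comp_continuousOn hF)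
    (((p0.continuous.comp_continuousOn hAF).neg.add (p1.continuous.comp_continuousOn hBF)).add
      (p2.continuous.comp_continuousOn hdF)) (fun χ hχ hχc => ?_) ht
  · have i0 := continuousOn_intervalIntegrable hAF ht
    have i1 := continuousOn_intervalIntegrable hBF ht
    have i2 := continuousOn_intervalIntegrable hdF ht
    have j0 := continuousOn_intervalIntegrable (p0.continuous.comp_continuousOn hAF).neg ht
    have j1 := continuousOn_intervalIntegrable (p1.continuous.comp_continuousOn hBF) ht
    have j2 := continuousOn_intervalIntegrable (p2.continuous.comp_continuousOn hdF) ht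
    have s1 := intervalIntegral.integral_add (j0.add j1) j2
    have s2 := intervalIntegral.integral_add j0 j1
    have s3 := intervalIntegral.integral_neg (μ := volume) (a := 0) (b := t)
      (f := fun s => p0 (A s • F s - r s))
    simp only [Function.comp_apply, Function.comp_def, Pi.neg_apply] at s1 s2 key
    rw [s1, s2, s3, p0.intervalIntegral_comp_comm i0, p1.intervalIntegral_comp_comm i1,
      p2.intervalIntegral_comp_comm i2] at key
    rw [map_add, map_sub, map_neg, map_neg, key]
    ring
  · have := h χ g hχ hχc hg hgc
    simp only [hop, hsrc] at this
    refine Eq.trans ?_ this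
    congr 2
    funext s
    simp only [map_sub, map_smul, smul_eq_mul]
    ring

theorem memLp_modeOp (k : ℤ) (β c d t : ℝ) {g : ℝ → ℂ}
    (hg : ContDiff ℝ ((⊤ : ℕ∞) : WithTop ℕ∞) g) (hgc : HasCompactSupport g) (u v : ℂ) :
    MemLp (fun y => u * g y + v * modeOp k β c d t g y) 2 volume := by
  have h0 := hg.continuous.memLp_of_hasCompactSupport (p := 2) (μ := volume) hgc
  have h1 := (smooth_deriv hg).continuous.memLp_of_hasCompactSupport (p := 2) (μ := volume) hgc.deriv
  have h2 := (smooth_deriv (smooth_deriv hg)).continuous.memLp_of_hasCompactSupport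
    (p := 2) (μ := volume) hgc.deriv.deriv
  exact (h0.const_mul u).add ((((h0.const_mul _).add (h1.const_mul _)).add (h2.const_mul _)).const_mul v)

/-- The `k`-th mode of a solution in the moving coordinates. -/
def movingMode (k : ℤ) (β : ℝ) (f : ℝ → L2) (t : ℝ) : L2R := xc k (comoving β t (f t))

theorem continuousOn_movingMode (k : ℤ) (β : ℝ) {f : ℝ → L2} (hf : ContinuousOn f (Ici 0)) :
    ContinuousOn (movingMode k β f) (Ici 0) :=
  (xc k).continuous.comp_continuousOn (continuousOn_comoving β hf)

/-- The source `S` is kept abstract so that the lemma serves both equations: `r` is the mode of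
`∂ₓθ` in one case and that of `-α ∂ₓΔ⁻¹ω` in the other. -/
theorem weak_mode_eq (k : ℤ) (β c d : ℝ) {f : ℝ → L2} {r : ℝ → L2R} {S : (ℝ → Channel → ℂ) → ℝ → Channel → ℂ}
    (hweak : ∀ φ : ℝ → Channel → ℂ, IsTest φ →
      (∫ t in Ioi (0 : ℝ), ∫ p, (f t p * adjointOp β c d φ t p - S φ t p) ∂channelMeasure)
        + ∫ p, f 0 p * φ 0 p ∂channelMeasure = 0)
    (hS : ∀ (χ : ℝ → ℝ) (g : ℝ → ℂ), MemLp g 2 volume → ∀ t,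
      Integrable (S (modeTest k β χ g) t) channelMeasure ∧
      ∫ p, S (modeTest k β χ g) t p ∂channelMeasure = -∫ y, r t y * (χ t * g y))
    (χ : ℝ → ℝ) (g : ℝ → ℂ) (hχ : ContDiff ℝ ((⊤ : ℕ∞) : WithTop ℕ∞) χ) (hχc : HasCompactSupport χ)
    (hg : ContDiff ℝ ((⊤ : ℕ∞) : WithTop ℕ∞) g) (hgc : HasCompactSupport g) :
    (∫ t in Ioi (0 : ℝ),
      ((∫ y, movingMode k β f t y * ((deriv χ t : ℝ) * g y + χ t * modeOp k β c d t g y))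
        + ∫ y, r t y * (χ t * g y))) + ∫ y, movingMode k β f 0 y * (χ 0 * g y) = 0 := by
  have h := hweak _ (isTest_modeTest k β hχ hχc hg hgc)
  have hm0 := hg.continuous.memLp_of_hasCompactSupport (p := 2) (μ := volume) hgc
  have e1 : ∀ t, ∫ p, (f t p * adjointOp β c d (modeTest k β χ g) t p - S (modeTest k β χ g) t p)
      ∂channelMeasure =
      (∫ y, movingMode k β f t y * ((deriv χ t : ℝ) * g y + χ t * modeOp k β c d t g y))
        + ∫ y, r t y * (χ t * g y) := by
    intro t
    have hG := memLp_modeOp k β c d t hg hgc ((deriv χ t : ℝ) : ℂ) (χ t : ℂ)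
    have hi := integrable_mul_mode k β t (f t) hG
    simp only [adjointOp_modeTest k β c d hχ hg]
    rw [integral_sub hi (hS χ g hm0 t).1, (hS χ g hm0 t).2, integral_mul_mode k β t (f t) hG,
      sub_neg_eq_add]
    rfl
  have e2 : ∫ p, f 0 p * modeTest k β χ g 0 p ∂channelMeasure =
      ∫ y, movingMode k β f 0 y * (χ 0 * g y) := by
    rw [movingMode, ← integral_mul_mode k β 0 (f 0) (hm0.const_mul (χ 0 : ℂ))]
    refine integral_congr_ae (ae_of_all _ fun p => ?_)
    simp only [modeTest]
    ring
  rw [← h, e2]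
  simp only [e1]

theorem vorticity_source (k : ℤ) (β : ℝ) (θ : ℝ → L2) (χ : ℝ → ℝ) (g : ℝ → ℂ)
    (hg : MemLp g 2 volume) (t : ℝ) :
    Integrable (fun p => θ t p * dX (modeTest k β χ g t) p) channelMeasure ∧
      ∫ p, θ t p * dX (modeTest k β χ g t) p ∂channelMeasure =
        -∫ y, ((Complex.I * k) • movingMode k β θ t) y * (χ t * g y) := by
  have hg' := hg.const_mul (χ t : ℂ)
  have e : ∀ p, θ t p * dX (modeTest k β χ g t) p = -(Complex.I * k) *
      (θ t p * (fourier (-k) p.1 * (phase k β t p.2 * (χ t * g p.2)))) := fun p => by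
    rw [dX_modeTest]; ring
  simp only [e]
  refine ⟨(integrable_mul_mode k β t (θ t) hg').const_mul _, ?_⟩
  rw [integral_const_mul, integral_mul_mode k β t (θ t) hg', neg_mul, ← integral_const_mul]
  congr 1
  refine integral_congr_ae ?_
  filter_upwards [Lp.coeFn_smul (Complex.I * k) (movingMode k β θ t)] with y hy
  rw [hy, Pi.smul_apply, smul_eq_mul, movingMode]
  ring

theorem temperature_source (k : ℤ) (β α : ℝ) (v : ℝ → L2) (χ : ℝ → ℝ) (g : ℝ → ℂ)
    (hg : MemLp g 2 volume) (t : ℝ) :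
    Integrable (fun p => α * v t p * modeTest k β χ g t p) channelMeasure ∧
      ∫ p, α * v t p * modeTest k β χ g t p ∂channelMeasure =
        -∫ y, ((-(α : ℂ)) • movingMode k β v t) y * (χ t * g y) := by
  have hg' := hg.const_mul (χ t : ℂ)
  have e : ∀ p, α * v t p * modeTest k β χ g t p = (α : ℂ) *
      (v t p * (fourier (-k) p.1 * (phase k β t p.2 * (χ t * g p.2)))) := fun p => by
    rw [modeTest]; ring
  simp only [e]
  refine ⟨(integrable_mul_mode k β t (v t) hg').const_mul _, ?_⟩
  rw [integral_const_mul, integral_mul_mode k β t (v t) hg', ← integral_const_mul, ← integral_neg]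
  refine integral_congr_ae ?_
  filter_upwards [Lp.coeFn_smul (-(α : ℂ)) (movingMode k β v t)] with y hy
  rw [hy, Pi.smul_apply, smul_eq_mul, movingMode]
  ring

/-! ### The operator `∂ₓΔ⁻¹` along a solution -/

theorem norm_symbol_le (k : ℤ) (ξ : ℝ) :
    ‖-(Complex.I * k) / ((k : ℂ) ^ 2 + (ξ : ℂ) ^ 2)‖ ≤ 1 := by
  rw [norm_div, norm_neg, norm_mul, Complex.norm_I, one_mul, Complex.norm_intCast]
  have h : (k : ℂ) ^ 2 + (ξ : ℂ) ^ 2 = (((k : ℝ) ^ 2 + ξ ^ 2 : ℝ) : ℂ) := by push_cast; ring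
  rw [h, Complex.norm_real, Real.norm_of_nonneg (by positivity)]
  refine div_le_one_of_le₀ ?_ (by positivity)
  rcases eq_or_ne k 0 with rfl | hk
  · simp; positivity
  · have h1 : (1 : ℝ) ≤ |(k : ℝ)| := by exact_mod_cast Int.one_le_abs hk
    nlinarith [sq_abs (k : ℝ), sq_nonneg ξ]

/-- The definition of a solution prescribes `v t` only for each time separately. Continuity in time
comes from the symbol being bounded by `1`, which makes `v` vary no more than `w`. -/
theorem continuousOn_dxInvLaplacian {w v : ℝ → L2} (hw : ContinuousOn w (Ici 0))
    (h : ∀ t, 0 ≤ t → IsDxInvLaplacian (w t) (v t)) : ContinuousOn v (Ici 0) := by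
  have hle : ∀ s ∈ Ici (0 : ℝ), ∀ t ∈ Ici (0 : ℝ), dist (v s) (v t) ≤ dist (w s) (w t) := by
    intro s hs t ht
    rw [dist_eq_norm, dist_eq_norm]
    refine norm_le_of_ft_le fun k => ?_
    filter_upwards [ft_sub (v s) (v t) k, ft_sub (w s) (w t) k, h s hs k, h t ht k]
      with ξ h1 h2 h3 h4
    rw [h1, h2, h3, h4, ← mul_sub, norm_mul]
    exact mul_le_of_le_one_left (norm_nonneg _) (norm_symbol_le k ξ)
  rw [Metric.continuousOn_iff] at hw ⊢
  intro t ht ε hε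
  obtain ⟨δ, hδ, hδ'⟩ := hw t ht ε hε
  exact ⟨δ, hδ, fun s hs hst => (hle s hs t ht).trans_lt (hδ' s hs hst)⟩

theorem dxInvLaplacian_moving {w v : L2} (h : IsDxInvLaplacian w v) (k : ℤ) (β t : ℝ) :
    ∀ᵐ η : ℝ, modeFt k (comoving β t v) η = -(Complex.I * k) /
      ((k : ℂ) ^ 2 + ((2 * π * η - β * k * t : ℝ) : ℂ) ^ 2) * modeFt k (comoving β t w) η := by
  have h1 : ∀ᵐ ξ : ℝ, ft v k (ξ - β * k * t) = -(Complex.I * k) /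
      ((k : ℂ) ^ 2 + ((ξ - β * k * t : ℝ) : ℂ) ^ 2) * ft w k (ξ - β * k * t) :=
    (measurePreserving_sub_const (β * k * t)).quasiMeasurePreserving.ae (h k)
  filter_upwards [ae_unscale h1, ae_unscale (ft_comoving β t v k), ae_unscale (ft_comoving β t w k)]
    with η h1 h2 h3
  rw [← ft_two_pi_mul, ← ft_two_pi_mul, h2, h3, h1]

/-! ### Linear differential equations in Banach spaces -/

section LinearODE

variable {F : Type*} [NormedAddCommGroup F] [NormedSpace ℝ F]

/-- The Picard iterates of a linear differential equation. -/
def picardIterate (A : ℝ → F →L[ℝ] F) (x₀ : F) : ℕ → ℝ → F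
  | 0 => fun _ => x₀
  | n + 1 => fun t => ∫ s in (0 : ℝ)..t, A s (picardIterate A x₀ n s)

theorem continuous_picardIterate [CompleteSpace F] {A : ℝ → F →L[ℝ] F} (hA : Continuous A) (x₀ : F)
    (n : ℕ) : Continuous (picardIterate A x₀ n) := by
  induction n with
  | zero => exact continuous_const
  | succ n ih =>
    exact intervalIntegral.continuous_primitive (fun a b =>
      (hA.clm_apply ih).intervalIntegrable a b) 0

theorem hasDerivAt_picardIterate [CompleteSpace F] {A : ℝ → F →L[ℝ] F} (hA : Continuous A) (x₀ : F)
    (n : ℕ) (t : ℝ) :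
    HasDerivAt (picardIterate A x₀ (n + 1)) (A t (picardIterate A x₀ n t)) t := by
  have h := hA.clm_apply (continuous_picardIterate hA x₀ n)
  exact intervalIntegral.integral_hasDerivAt_right (h.intervalIntegrable _ _)
    h.aestronglyMeasurable.stronglyMeasurableAtFilter h.continuousAt

/-- Each time integration contributes one more factor of the factorial, so the iterates are summable
on every bounded interval, whatever the size of `A`. -/
theorem norm_picardIterate_le {A : ℝ → F →L[ℝ] F} {x₀ : F} {M T : ℝ} (hM : 0 ≤ M)
    (hAM : ∀ t, |t| ≤ T → ‖A t‖ ≤ M) (n : ℕ) {t : ℝ} (ht : |t| ≤ T) :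
    ‖picardIterate A x₀ n t‖ ≤ ‖x₀‖ * ((M * |t|) ^ n / n.factorial) := by
  induction n generalizing t with
  | zero => simp [picardIterate]
  | succ n ih =>
    have hsub : ∀ s ∈ uIoc 0 t, |s| ≤ |t| := fun s hs => by
      have := abs_sub_left_of_mem_uIcc (uIoc_subset_uIcc hs)
      simpa using this
    have h1 : ‖picardIterate A x₀ (n + 1) t‖ ≤
        ∫ s in uIoc 0 t, M * (‖x₀‖ * ((M * |s - 0|) ^ n / n.factorial)) := by
      refine (intervalIntegral.norm_integral_le_integral_norm_uIoc).trans ?_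
      refine integral_mono_of_nonneg (ae_of_all _ fun s => norm_nonneg _) ?_ ?_
      · have hc : Continuous fun s : ℝ => M * (‖x₀‖ * ((M * |s - 0|) ^ n / n.factorial)) := by
          fun_prop
        exact (hc.integrableOn_Icc).mono_set uIoc_subset_uIcc
      · filter_upwards [ae_restrict_mem measurableSet_uIoc] with s hs
        have hsT := (hsub s hs).trans ht
        have := (A s).le_opNorm (picardIterate A x₀ n s)
        rw [sub_zero]
        exact this.trans (mul_le_mul (hAM s hsT) (ih hsT) (norm_nonneg _) hM)
    refine h1.trans (le_of_eq ?_)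
    have h2 : ∀ s : ℝ, M * (‖x₀‖ * ((M * |s - 0|) ^ n / n.factorial))
        = (‖x₀‖ * (M ^ (n + 1) / n.factorial)) * |s - 0| ^ n := fun s => by
      rw [mul_pow]; ring
    simp only [h2]
    rw [integral_const_mul, integral_pow_abs_sub_uIoc, sub_zero, mul_pow, Nat.factorial_succ]
    push_cast
    field_simp

/-- Global solvability of linear differential equations in a Banach space. -/
theorem exists_linear_ode [CompleteSpace F] {A : ℝ → F →L[ℝ] F} (hA : Continuous A) (x₀ : F) :
    ∃ x : ℝ → F, x 0 = x₀ ∧ ∀ t, HasDerivAt x (A t (x t)) t := by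
  -- The iterates are the successive terms of the Dyson series, not partial sums; differentiating
  -- term by term shifts the index by one and reproduces the whole series under `A t`.
  refine ⟨fun t => x₀ + ∑' n, picardIterate A x₀ (n + 1) t, ?_, fun t => ?_⟩
  · simp [picardIterate]
  · set T := |t| + 1
    obtain ⟨M, hM⟩ := (isCompact_Icc (a := -T) (b := T)).exists_bound_of_continuousOn
      hA.norm.continuousOn
    have hAM : ∀ s, |s| ≤ T → ‖A s‖ ≤ M := fun s hs => by
      simpa using hM s (abs_le.1 hs)
    have hT : 0 ≤ T := by positivity
    have hM0 : 0 ≤ M := (norm_nonneg _).trans (hAM 0 (by simpa using hT))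
    have hu : Summable fun n : ℕ => ‖x₀‖ * ((M * T) ^ n / n.factorial) :=
      (Real.summable_pow_div_factorial (M * T)).mul_left _
    have hb : ∀ n s, |s| ≤ T → ‖picardIterate A x₀ n s‖ ≤ ‖x₀‖ * ((M * T) ^ n / n.factorial) := by
      intro n s hs
      refine (norm_picardIterate_le hM0 hAM n hs).trans ?_
      gcongr
    have hball : ∀ s ∈ Ioo (-T) T, |s| ≤ T := fun s hs => (abs_lt.2 hs).le
    have hmem : t ∈ Ioo (-T) T := abs_lt.1 (lt_add_one _)
    have hmem0 : (0 : ℝ) ∈ Ioo (-T) T := by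
      have : 0 < T := by positivity
      exact ⟨by linarith, this⟩
    have hs0 : ∀ s, |s| ≤ T → Summable fun n => picardIterate A x₀ n s := fun s hs =>
      Summable.of_norm_bounded hu fun n => hb n s hs
    have key := hasDerivAt_tsum_of_isPreconnected (hu.mul_left M) isOpen_Ioo
      (convex_Ioo (-T) T).isPreconnected (fun n s _ => hasDerivAt_picardIterate hA x₀ n s)
      (fun n s hs => ((A s).le_opNorm _).trans
        (mul_le_mul (hAM s (hball s hs)) (hb n s (hball s hs)) (norm_nonneg _) hM0))
      hmem0 ((summable_nat_add_iff 1).2 (hs0 0 (hball 0 hmem0))) hmem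
    refine (key.const_add x₀).congr_deriv ?_
    rw [← (A t).map_tsum (hs0 t (hball t hmem)), (hs0 t (hball t hmem)).tsum_eq_zero_add]
    rfl

/-- Grönwall, with the bound of `A` on the compact interval as Lipschitz constant. Only right
derivatives of `x` are assumed, since solutions of the equations are given only for `t ≥ 0`. -/
theorem linear_ode_unique {A : ℝ → F →L[ℝ] F} (hA : Continuous A) {x y : ℝ → F} {T : ℝ}
    (hT : 0 ≤ T) (hx : ContinuousOn x (Icc 0 T))
    (hx' : ∀ t ∈ Ico 0 T, HasDerivWithinAt x (A t (x t)) (Ici t) t)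
    (hy : ∀ t, HasDerivAt y (A t (y t)) t) (h0 : x 0 = y 0) : x T = y T := by
  obtain ⟨M, hM⟩ := (isCompact_Icc (a := 0) (b := T)).exists_bound_of_continuousOn
    hA.norm.continuousOn
  have hyc : Continuous y := continuous_iff_continuousAt.2 fun t => (hy t).continuousAt
  have := ODE_solution_unique_of_mem_Icc_right (v := fun t x => A t x) (s := fun _ => univ)
    (K := M.toNNReal) (a := 0) (b := T) (f := x) (g := y) (fun t ht => ?_) hx hx'
    (fun _ _ => mem_univ _) hyc.continuousOn (fun t _ => (hy t).hasDerivWithinAt)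
    (fun _ _ => mem_univ _) h0
  · exact this ⟨hT, le_rfl⟩
  · refine ((A t).lipschitz.weaken ?_).lipschitzOnWith
    rw [← NNReal.coe_le_coe, coe_nnnorm]
    have := hM t (Ico_subset_Icc_self ht)
    simp only [norm_norm] at this
    exact this.trans (Real.le_coe_toNNReal M)

end LinearODE

/-! ### Restriction to bounded windows of frequencies -/

/-- A bounded window of frequencies. -/
abbrev Window (R : ℝ) : Type := Icc (-R) R

/-- Extension by zero of a continuous function on a window. -/
def windowExt {R : ℝ} (b : C(Window R, ℂ)) : ℝ → ℂ := Function.extend Subtype.val b 0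

theorem windowExt_of_mem {R : ℝ} (b : C(Window R, ℂ)) {η : ℝ} (h : η ∈ Icc (-R) R) :
    windowExt b η = b ⟨η, h⟩ :=
  Subtype.val_injective.extend_apply b 0 ⟨η, h⟩

theorem windowExt_of_notMem {R : ℝ} (b : C(Window R, ℂ)) {η : ℝ} (h : η ∉ Icc (-R) R) :
    windowExt b η = 0 :=
  Function.extend_apply' _ _ _ fun ⟨a, ha⟩ => h (ha ▸ a.2)

theorem measurable_windowExt {R : ℝ} (b : C(Window R, ℂ)) : Measurable (windowExt b) :=
  (MeasurableEmbedding.subtype_coe measurableSet_Icc).measurable_extend b.continuous.measurable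
    measurable_const

theorem norm_windowExt_le {R : ℝ} (b : C(Window R, ℂ)) (η : ℝ) : ‖windowExt b η‖ ≤ ‖b‖ := by
  by_cases h : η ∈ Icc (-R) R
  · rw [windowExt_of_mem b h]; exact b.norm_coe_le_norm _
  · rw [windowExt_of_notMem b h, norm_zero]; exact norm_nonneg _

theorem memLp_windowExt_mul {R : ℝ} (b : C(Window R, ℂ)) (f : L2R) :
    MemLp (fun η => windowExt b η * f η) 2 volume :=
  ((Lp.memLp f).const_mul (‖b‖ : ℂ)).of_le
    ((measurable_windowExt b).aestronglyMeasurable.mul (Lp.memLp f).1) (ae_of_all _ fun η => by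
      rw [norm_mul, norm_mul, Complex.norm_real, norm_norm]
      exact mul_le_mul_of_nonneg_right (norm_windowExt_le b η) (norm_nonneg _))

theorem windowExt_add {R : ℝ} (b c : C(Window R, ℂ)) (η : ℝ) :
    windowExt (b + c) η = windowExt b η + windowExt c η := by
  by_cases h : η ∈ Icc (-R) R
  · simp [windowExt_of_mem _ h]
  · simp [windowExt_of_notMem _ h]

theorem windowExt_mul {R : ℝ} (b c : C(Window R, ℂ)) (η : ℝ) :
    windowExt (b * c) η = windowExt b η * windowExt c η := by
  by_cases h : η ∈ Icc (-R) R
  · simp [windowExt_of_mem _ h]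
  · simp [windowExt_of_notMem _ h]

theorem windowExt_smul {R : ℝ} (a : ℂ) (b : C(Window R, ℂ)) (η : ℝ) :
    windowExt (a • b) η = a * windowExt b η := by
  by_cases h : η ∈ Icc (-R) R
  · simp [windowExt_of_mem _ h]
  · simp [windowExt_of_notMem _ h]

/-- Multiplication of an `L²` function by a continuous function on a window. -/
def windowMul (R : ℝ) : C(Window R, ℂ) →L[ℂ] L2R →L[ℂ] L2R :=
  LinearMap.mkContinuous₂
    (LinearMap.mk₂ ℂ (fun b f => (memLp_windowExt_mul b f).toLp)
      (fun b c f => by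
        rw [← MemLp.toLp_add]
        refine (MemLp.toLp_eq_toLp_iff _ _).2 (ae_of_all _ fun η => ?_)
        simp only [Pi.add_apply, windowExt_add]; ring)
      (fun a b f => by
        rw [← MemLp.toLp_const_smul]
        refine (MemLp.toLp_eq_toLp_iff _ _).2 (ae_of_all _ fun η => ?_)
        simp only [Pi.smul_apply, windowExt_smul, smul_eq_mul]; ring)
      (fun b f g => by
        rw [← MemLp.toLp_add]
        refine (MemLp.toLp_eq_toLp_iff _ _).2 ?_
        filter_upwards [Lp.coeFn_add f g] with η hη
        simp only [Pi.add_apply] at hη ⊢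
        rw [hη]; ring)
      (fun a b f => by
        rw [← MemLp.toLp_const_smul]
        refine (MemLp.toLp_eq_toLp_iff _ _).2 ?_
        filter_upwards [Lp.coeFn_smul a f] with η hη
        simp only [Pi.smul_apply, smul_eq_mul] at hη ⊢
        rw [hη]; ring)) 1 fun b f => by
    rw [LinearMap.mk₂_apply, one_mul]
    refine Lp.norm_le_mul_norm_of_ae_le_mul ?_
    filter_upwards [(memLp_windowExt_mul b f).coeFn_toLp] with η hη
    rw [hη, norm_mul]
    exact mul_le_mul_of_nonneg_right (norm_windowExt_le b η) (norm_nonneg _)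

theorem coeFn_windowMul {R : ℝ} (b : C(Window R, ℂ)) (f : L2R) :
    windowMul R b f =ᵐ[volume] fun η => windowExt b η * f η :=
  (memLp_windowExt_mul b f).coeFn_toLp

theorem windowMul_windowMul {R : ℝ} (b c : C(Window R, ℂ)) (f : L2R) :
    windowMul R b (windowMul R c f) = windowMul R (b * c) f := by
  apply Lp.ext
  filter_upwards [coeFn_windowMul b (windowMul R c f), coeFn_windowMul c f,
    coeFn_windowMul (b * c) f] with η h1 h2 h3
  rw [h1, h2, h3, windowExt_mul, mul_assoc]

/-- The curve of functions on a window associated with a continuous function of time and frequency. -/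
def windowCurve (R : ℝ) (f : C(ℝ × ℝ, ℂ)) : C(ℝ, C(Window R, ℂ)) :=
  (f.comp ⟨fun q : ℝ × Window R => (q.1, (q.2 : ℝ)),
    continuous_fst.prodMk (continuous_subtype_val.comp continuous_snd)⟩).curry

theorem windowCurve_apply (R : ℝ) (f : C(ℝ × ℝ, ℂ)) (t : ℝ) (η : Window R) :
    windowCurve R f t η = f (t, η) := rfl

/-- The Fourier symbol `c k² + d (2πη - β k t)²` of the diffusion in the moving coordinates. -/
def diffusionSymbol (k : ℤ) (β c d : ℝ) : C(ℝ × ℝ, ℂ) where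
  toFun q := ((c * k ^ 2 + d * (2 * π * q.2 - β * k * q.1) ^ 2 : ℝ) : ℂ)
  continuous_toFun := by fun_prop

/-- The symbol `-2πiη` on a window. -/
def derivSymbol (R : ℝ) : C(Window R, ℂ) where
  toFun η := -2 * π * Complex.I * (η : ℝ)
  continuous_toFun := by fun_prop

/-- Expanding the square in `2πη - βkt` by powers of `-2πiη` gives exactly the three coefficients
that `mode_relation` produces. -/
theorem diffusionSymbol_eq (R : ℝ) (k : ℤ) (β c d t : ℝ) :
    windowCurve R (diffusionSymbol k β c d) t =
      ((c * k ^ 2 + d * (k * β * t) ^ 2 : ℝ) : ℂ) • 1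
        - (2 * Complex.I * k * β * t * d) • derivSymbol R
        - (d : ℂ) • (derivSymbol R * derivSymbol R) := by
  ext η
  rw [windowCurve_apply]
  simp only [diffusionSymbol, derivSymbol, ContinuousMap.coe_mk, ContinuousMap.sub_apply,
    ContinuousMap.smul_apply, ContinuousMap.mul_apply, ContinuousMap.one_apply, smul_eq_mul]
  push_cast
  linear_combination (-(4 * π * k * β * t * d * η) + 4 * d * π ^ 2 * η ^ 2 : ℂ) * Complex.I_sq

/-- The Fourier transform of `L²(ℝ)` as a continuous linear map. -/
def fourierL : L2R →L[ℂ] L2R :=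
  (Lp.fourierTransformₗᵢ ℝ ℂ).toContinuousLinearEquiv.toContinuousLinearMap

/-- The evolution of one mode, on a window of frequencies. -/
theorem window_evolution (R : ℝ) (k : ℤ) (β c d : ℝ) {F r : ℝ → L2R} (hF : ContinuousOn F (Ici 0))
    (hr : ContinuousOn r (Ici 0)) {t : ℝ} (ht : 0 ≤ t)
    (h : ∀ᵐ η : ℝ, (𝓕 (F t - F 0 + ∫ s in (0 : ℝ)..t,
          (((c * k ^ 2 + d * (k * β * s) ^ 2 : ℝ) : ℂ) • F s - r s)) : L2R) η
      + (-2 * π * Complex.I * η) *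
        (𝓕 (- ∫ s in (0 : ℝ)..t, (2 * Complex.I * k * β * s * d) • F s) : L2R) η
      + (-2 * π * Complex.I * η) ^ 2 * (𝓕 (- ∫ s in (0 : ℝ)..t, (d : ℂ) • F s) : L2R) η = 0) :
    windowMul R 1 (fourierL (F t)) = windowMul R 1 (fourierL (F 0)) + ∫ s in (0 : ℝ)..t,
      (windowMul R 1 (fourierL (r s))
        - windowMul R (windowCurve R (diffusionSymbol k β c d) s) (fourierL (F s))) := by
  set A : ℝ → ℂ := fun s => ((c * k ^ 2 + d * (k * β * s) ^ 2 : ℝ) : ℂ) with hA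
  set B : ℝ → ℂ := fun s => 2 * Complex.I * k * β * s * d with hB
  have hAc : Continuous A := by rw [hA]; fun_prop
  have hBc : Continuous B := by rw [hB]; fun_prop
  have i0 := continuousOn_intervalIntegrable ((hAc.continuousOn.smul hF).sub hr) ht
  have i1 := continuousOn_intervalIntegrable (hBc.continuousOn.smul hF) ht
  have i2 := continuousOn_intervalIntegrable (hF.const_smul (d : ℂ)) ht
  set e := derivSymbol R with he
  set T0 : L2R →L[ℂ] L2R := (windowMul R 1).comp fourierL with hT0
  set T1 : L2R →L[ℂ] L2R := (windowMul R e).comp fourierL with hT1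
  set T2 : L2R →L[ℂ] L2R := (windowMul R (e * e)).comp fourierL with hT2
  -- The relation `h` times the indicator of the window; there the powers of `-2πiη` are the bounded
  -- symbols `1`, `e`, `e * e`.
  have h1 : T0 (F t - F 0 + ∫ s in (0 : ℝ)..t, (A s • F s - r s))
      + T1 (- ∫ s in (0 : ℝ)..t, B s • F s) + T2 (- ∫ s in (0 : ℝ)..t, (d : ℂ) • F s) = 0 := by
    set Y0 := F t - F 0 + ∫ s in (0 : ℝ)..t, (A s • F s - r s)
    set Y1 := - ∫ s in (0 : ℝ)..t, B s • F s
    set Y2 := - ∫ s in (0 : ℝ)..t, (d : ℂ) • F s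
    apply Lp.ext
    filter_upwards [h, coeFn_windowMul 1 (fourierL Y0), coeFn_windowMul e (fourierL Y1),
      coeFn_windowMul (e * e) (fourierL Y2), Lp.coeFn_add (T0 Y0 + T1 Y1) (T2 Y2),
      Lp.coeFn_add (T0 Y0) (T1 Y1), Lp.coeFn_zero ℂ 2 (volume : Measure ℝ)]
      with η h a0 a1 a2 b1 b2 b3
    rw [b1, Pi.add_apply, b2, Pi.add_apply, b3, Pi.zero_apply]
    simp only [hT0, hT1, hT2, ContinuousLinearMap.comp_apply]
    rw [a0, a1, a2]
    by_cases hη : η ∈ Icc (-R) R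
    · rw [windowExt_of_mem _ hη, windowExt_of_mem _ hη, windowExt_of_mem _ hη]
      rw [← h]
      simp only [ContinuousMap.one_apply, ContinuousMap.mul_apply, he, derivSymbol,
        ContinuousMap.coe_mk, one_mul]
      rw [sq]; rfl
    · rw [windowExt_of_notMem _ hη, windowExt_of_notMem _ hη, windowExt_of_notMem _ hη]
      ring
  have c0 := T0.intervalIntegral_comp_comm i0
  have c1 := T1.intervalIntegral_comp_comm i1
  have c2 := T2.intervalIntegral_comp_comm i2
  have k0 := continuousOn_intervalIntegrable
    (T0.continuous.comp_continuousOn ((hAc.continuousOn.smul hF).sub hr)) ht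
  have k1 := continuousOn_intervalIntegrable
    (T1.continuous.comp_continuousOn (hBc.continuousOn.smul hF)) ht
  have k2 := continuousOn_intervalIntegrable
    (T2.continuous.comp_continuousOn (hF.const_smul (d : ℂ))) ht
  have s1 := intervalIntegral.integral_sub (k0.sub k1) k2
  have s2 := intervalIntegral.integral_sub k0 k1
  simp only [Function.comp_def, Pi.smul_apply', Pi.sub_apply, Pi.smul_apply] at c0 c1 c2 s1 s2
  have hfin : ∫ s in (0 : ℝ)..t, (windowMul R 1 (fourierL (r s))
        - windowMul R (windowCurve R (diffusionSymbol k β c d) s) (fourierL (F s)))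
      = - ∫ s in (0 : ℝ)..t, (T0 (A s • F s - r s) - T1 (B s • F s) - T2 ((d : ℂ) • F s)) := by
    rw [← intervalIntegral.integral_neg]
    refine intervalIntegral.integral_congr fun s _ => ?_
    simp only [diffusionSymbol_eq, map_sub, map_smul, sub_apply,
      smul_apply, hT0, hT1, hT2, ContinuousLinearMap.comp_apply]
    abel
  rw [hfin, s1, s2, c0, c1, c2]
  rw [map_add, map_sub, map_neg, map_neg] at h1
  change T0 (F t) = T0 (F 0) + _
  rw [← sub_eq_zero, ← h1]
  abel

/-! ### Two-component linear systems over an algebra of symbols -/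

section LinearSystem

variable {B E : Type*} [NormedRing B] [NormedAlgebra ℂ B] [NormedAddCommGroup E] [NormedSpace ℂ E]

/-- `(x, y)` solves `x' = a x + b y`, `y' = c x + d y`, where the coefficients act through `L`. -/
def SolvesSystem (L : B →L[ℂ] E →L[ℂ] E) (a b c d : ℝ → B) (x y : ℝ → E) : Prop :=
  ∀ t, HasDerivAt x (L (a t) (x t) + L (b t) (y t)) t ∧
    HasDerivAt y (L (c t) (x t) + L (d t) (y t)) t

/-- The generator of a two-component linear system. -/
def systemOp (L : B →L[ℂ] E →L[ℂ] E) (a b c d : B) : E × E →L[ℝ] E × E :=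
  (((ContinuousLinearMap.inl ℂ E E).comp ((L a).comp (ContinuousLinearMap.fst ℂ E E)
      + (L b).comp (ContinuousLinearMap.snd ℂ E E)))
    + (ContinuousLinearMap.inr ℂ E E).comp ((L c).comp (ContinuousLinearMap.fst ℂ E E)
      + (L d).comp (ContinuousLinearMap.snd ℂ E E))).restrictScalars ℝ

theorem systemOp_apply (L : B →L[ℂ] E →L[ℂ] E) (a b c d : B) (z : E × E) :
    systemOp L a b c d z = (L a z.1 + L b z.2, L c z.1 + L d z.2) := by
  ext <;> simp [systemOp]

theorem continuous_systemOp (L : B →L[ℂ] E →L[ℂ] E) {a b c d : ℝ → B} (ha : Continuous a)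
    (hb : Continuous b) (hc : Continuous c) (hd : Continuous d) :
    Continuous fun t => systemOp L (a t) (b t) (c t) (d t) := by
  have hL : ∀ {f : ℝ → B}, Continuous f → Continuous fun t => L (f t) := fun hf =>
    L.continuous.comp hf
  refine (ContinuousLinearMap.restrictScalarsIsometry ℂ (E × E) (E × E) ℝ ℝ).continuous.comp ?_
  exact (continuous_const.clm_comp (((hL ha).clm_comp continuous_const).add
      ((hL hb).clm_comp continuous_const))).add
    (continuous_const.clm_comp (((hL hc).clm_comp continuous_const).add
      ((hL hd).clm_comp continuous_const)))

theorem exists_solvesSystem [CompleteSpace E] (L : B →L[ℂ] E →L[ℂ] E) {a b c d : ℝ → B}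
    (ha : Continuous a) (hb : Continuous b) (hc : Continuous c) (hd : Continuous d) (x₀ y₀ : E) :
    ∃ x y : ℝ → E, x 0 = x₀ ∧ y 0 = y₀ ∧ SolvesSystem L a b c d x y := by
  obtain ⟨z, hz0, hz⟩ := exists_linear_ode (continuous_systemOp L ha hb hc hd) (x₀, y₀)
  refine ⟨fun t => (z t).1, fun t => (z t).2, by simp only [hz0], by simp only [hz0], fun t => ?_⟩
  have h := hz t
  rw [systemOp_apply] at h
  exact ⟨(ContinuousLinearMap.fst ℝ E E).hasFDerivAt.comp_hasDerivAt t h,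
    (ContinuousLinearMap.snd ℝ E E).hasFDerivAt.comp_hasDerivAt t h⟩

theorem solvesSystem_unique (L : B →L[ℂ] E →L[ℂ] E) {a b c d : ℝ → B}
    (ha : Continuous a) (hb : Continuous b) (hc : Continuous c) (hd : Continuous d)
    {x y x' y' : ℝ → E} (h' : SolvesSystem L a b c d x' y') {T : ℝ} (hT : 0 ≤ T)
    (hx : ∀ t, 0 ≤ t → HasDerivWithinAt x (L (a t) (x t) + L (b t) (y t)) (Ici 0) t)
    (hy : ∀ t, 0 ≤ t → HasDerivWithinAt y (L (c t) (x t) + L (d t) (y t)) (Ici 0) t)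
    (hx0 : x 0 = x' 0) (hy0 : y 0 = y' 0) : x T = x' T ∧ y T = y' T := by
  have h := linear_ode_unique (continuous_systemOp L ha hb hc hd) (x := fun t => (x t, y t))
    (y := fun t => (x' t, y' t)) hT (fun t ht => ?_) (fun t ht => ?_) (fun t => ?_)
    (by simp only [hx0, hy0])
  · exact ⟨congrArg Prod.fst h, congrArg Prod.snd h⟩
  · exact ((hx t ht.1).continuousWithinAt.prodMk (hy t ht.1).continuousWithinAt).mono
      Icc_subset_Ici_self
  · rw [systemOp_apply]
    exact ((hx t ht.1).prodMk (hy t ht.1)).mono (Ici_subset_Ici.2 ht.1)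
  · rw [systemOp_apply]
    exact (h' t).1.prodMk (h' t).2

/-- Solutions in the algebra act on vectors: if `L` is multiplicative, an algebra-valued solution
applied to a fixed `f` solves the system in `E`. One fundamental matrix of symbols thus produces the
solution for all initial data. -/
theorem SolvesSystem.action {L : B →L[ℂ] E →L[ℂ] E}
    (hL : ∀ u v f, L (u * v) f = L u (L v f)) {a b c d x y : ℝ → B}
    (h : SolvesSystem (ContinuousLinearMap.mul ℂ B) a b c d x y) (f : E) :
    SolvesSystem L a b c d (fun t => L (x t) f) fun t => L (y t) f := by
  intro t
  have e := ((L.flip f).restrictScalars ℝ).hasFDerivAt (x := x t)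
  have e' := ((L.flip f).restrictScalars ℝ).hasFDerivAt (x := y t)
  refine ⟨(e.comp_hasDerivAt t (h t).1).congr_deriv ?_,
    (e'.comp_hasDerivAt t (h t).2).congr_deriv ?_⟩ <;>
  simp [hL]

theorem SolvesSystem.add {L : B →L[ℂ] E →L[ℂ] E} {a b c d : ℝ → B} {x y x' y' : ℝ → E}
    (h : SolvesSystem L a b c d x y) (h' : SolvesSystem L a b c d x' y') :
    SolvesSystem L a b c d (fun t => x t + x' t) fun t => y t + y' t := by
  intro t
  refine ⟨((h t).1.add (h' t).1).congr_deriv ?_, ((h t).2.add (h' t).2).congr_deriv ?_⟩ <;>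
  · simp only [map_add]; abel

end LinearSystem

/-! ### Reduction to an ordinary differential system at each frequency -/

/-- The Fourier symbol of the coupling `-α ∂ₓ Δ⁻¹` in the moving coordinates. -/
def couplingSymbol (α β : ℝ) (k : ℤ) : C(ℝ × ℝ, ℂ) where
  toFun q := α * (Complex.I * k) / ((k : ℂ) ^ 2 + ((2 * π * q.2 - β * k * q.1 : ℝ) : ℂ) ^ 2)
  continuous_toFun := by
    rcases eq_or_ne k 0 with rfl | hk
    · simpa using continuous_const
    · refine Continuous.div continuous_const (by fun_prop) fun q => ?_
      have : (k : ℂ) ^ 2 + ((2 * π * q.2 - β * k * q.1 : ℝ) : ℂ) ^ 2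
          = (((k : ℝ) ^ 2 + (2 * π * q.2 - β * k * q.1) ^ 2 : ℝ) : ℂ) := by push_cast; ring
      rw [this, Complex.ofReal_ne_zero]
      have : (k : ℝ) ≠ 0 := by exact_mod_cast hk
      positivity

theorem hasDerivWithinAt_of_integral {E : Type*} [NormedAddCommGroup E] [NormedSpace ℝ E]
    [CompleteSpace E] {x g : ℝ → E} (hg : ContinuousOn g (Ici 0))
    (h : ∀ t, 0 ≤ t → x t = x 0 + ∫ s in (0 : ℝ)..t, g s) {t : ℝ} (ht : 0 ≤ t) :
    HasDerivWithinAt x (g t) (Ici 0) t := by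
  have hc : Continuous fun s => g (max s 0) :=
    hg.comp_continuous (continuous_id.max continuous_const) fun s => mem_Ici.2 (le_max_right _ _)
  have h1 : HasDerivAt (fun t => x 0 + ∫ s in (0 : ℝ)..t, g (max s 0)) (g (max t 0)) t :=
    (intervalIntegral.integral_hasDerivAt_right (hc.intervalIntegrable _ _)
      hc.aestronglyMeasurable.stronglyMeasurableAtFilter hc.continuousAt).const_add _
  rw [max_eq_left ht] at h1
  have h2 : ∀ s ∈ Ici (0 : ℝ), x s = x 0 + ∫ r in (0 : ℝ)..s, g (max r 0) := fun s hs => by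
    rw [h s hs]
    congr 1
    refine intervalIntegral.integral_congr fun r hr => ?_
    rw [uIcc_of_le (mem_Ici.1 hs)] at hr
    simp only [max_eq_left hr.1]
  exact h1.hasDerivWithinAt.congr h2 (h2 t ht)

/-- On a window of frequencies, a mode of a solution satisfies a linear system in `L²`. -/
theorem window_system {α β νx νy ηx ηy : ℝ} {ω θ : ℝ → L2}
    (hsol : IsSolution α β νx νy ηx ηy ω θ) (k : ℤ) (R : ℝ) {t : ℝ} (ht : 0 ≤ t) :
    HasDerivWithinAt (fun s => windowMul R 1 (fourierL (movingMode k β ω s)))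
      (windowMul R (-windowCurve R (diffusionSymbol k β νx νy) t)
          (windowMul R 1 (fourierL (movingMode k β ω t)))
        + windowMul R ((Complex.I * k) • 1)
          (windowMul R 1 (fourierL (movingMode k β θ t)))) (Ici 0) t ∧
    HasDerivWithinAt (fun s => windowMul R 1 (fourierL (movingMode k β θ s)))
      (windowMul R (windowCurve R (couplingSymbol α β k) t)
          (windowMul R 1 (fourierL (movingMode k β ω t)))
        + windowMul R (-windowCurve R (diffusionSymbol k β ηx ηy) t)
          (windowMul R 1 (fourierL (movingMode k β θ t)))) (Ici 0) t := by
  have hω := continuousOn_movingMode k β hsol.continuous_vorticity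
  have hθ := continuousOn_movingMode k β hsol.continuous_temperature
  obtain ⟨v, hv, hveq⟩ := hsol.temperature_eq
  have hvc := continuousOn_movingMode k β (continuousOn_dxInvLaplacian hsol.continuous_vorticity hv)
  have hcont : ∀ {f r : ℝ → L2R} (c d : ℝ), ContinuousOn f (Ici 0) → ContinuousOn r (Ici 0) →
      ContinuousOn (fun s => windowMul R 1 (fourierL (r s))
        - windowMul R (windowCurve R (diffusionSymbol k β c d) s) (fourierL (f s))) (Ici 0) := by
    intro f r c d hf hr
    refine (((windowMul R 1).comp fourierL).continuous.comp_continuousOn hr).sub ?_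
    exact ((windowMul R).continuous.comp (windowCurve R _).continuous).continuousOn.clm_apply
      (fourierL.continuous.comp_continuousOn hf)
  constructor
  · have hr : ContinuousOn (fun s => (Complex.I * k) • movingMode k β θ s) (Ici 0) :=
      hθ.const_smul (Complex.I * k)
    have hw := weak_mode_eq k β νx νy (f := ω) (r := fun s => (Complex.I * k) • movingMode k β θ s)
      (S := fun φ t p => θ t p * dX (φ t) p) hsol.vorticity_eq
      fun χ g hg t => vorticity_source k β θ χ g hg t
    refine (hasDerivWithinAt_of_integral (hcont νx νy hω hr) (fun s hs =>
      window_evolution R k β νx νy hω hr hs (mode_relation k β νx νy hω hr hw hs)) ht).congr_deriv ?_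
    rw [windowMul_windowMul, windowMul_windowMul, mul_one, mul_one, map_smul, map_smul, map_smul,
      map_neg, neg_apply, smul_apply]
    abel
  · have hr : ContinuousOn (fun s => (-(α : ℂ)) • movingMode k β v s) (Ici 0) :=
      hvc.const_smul (-(α : ℂ))
    have hw := weak_mode_eq k β ηx ηy (f := θ) (r := fun s => (-(α : ℂ)) • movingMode k β v s)
      (S := fun φ t p => α * v t p * φ t p) hveq
      fun χ g hg t => temperature_source k β α v χ g hg t
    refine (hasDerivWithinAt_of_integral (hcont ηx ηy hθ hr) (fun s hs =>
      window_evolution R k β ηx ηy hθ hr hs (mode_relation k β ηx ηy hθ hr hw hs)) ht).congr_deriv ?_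
    -- The minus sign of `-α v` meets the minus sign in the symbol of `∂ₓΔ⁻¹`.
    have hcoup : windowMul R 1 (fourierL ((-(α : ℂ)) • movingMode k β v t)) =
        windowMul R (windowCurve R (couplingSymbol α β k) t) (fourierL (movingMode k β ω t)) := by
      rw [map_smul]
      apply Lp.ext
      filter_upwards [coeFn_windowMul 1 ((-(α : ℂ)) • fourierL (movingMode k β v t)),
        coeFn_windowMul (windowCurve R (couplingSymbol α β k) t) (fourierL (movingMode k β ω t)),
        Lp.coeFn_smul (-(α : ℂ)) (fourierL (movingMode k β v t)),
        dxInvLaplacian_moving (hv t ht) k β t] with η h1 h2 h3 h4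
      rw [h1, h2, h3]
      by_cases hη : η ∈ Icc (-R) R
      · rw [windowExt_of_mem _ hη, windowExt_of_mem _ hη, windowCurve_apply, Pi.smul_apply]
        change 1 * (-(α : ℂ) * modeFt k (comoving β t (v t)) η) =
          _ * modeFt k (comoving β t (ω t)) η
        rw [h4]
        simp only [couplingSymbol, ContinuousMap.coe_mk]
        ring
      · rw [windowExt_of_notMem _ hη, windowExt_of_notMem _ hη, zero_mul, zero_mul]
    rw [hcoup, windowMul_windowMul, windowMul_windowMul, mul_one, mul_one,
      map_neg, neg_apply]
    abel

/-- The pointwise system satisfied by one frequency `(k, ξ)` of a solution in the moving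
coordinates. -/
structure FreqSystem (α β νx νy ηx ηy : ℝ) (k : ℤ) (ξ : ℝ) (w θ : ℝ → ℂ) : Prop where
  vorticity : ∀ t, HasDerivAt w (-(((νx * k ^ 2 + νy * (ξ - β * k * t) ^ 2 : ℝ) : ℂ)) * w t
    + Complex.I * k * θ t) t
  temperature : ∀ t, HasDerivAt θ (α * (Complex.I * k) /
      (((k : ℝ) ^ 2 + (ξ - β * k * t) ^ 2 : ℝ) : ℂ) * w t
    - ((ηx * k ^ 2 + ηy * (ξ - β * k * t) ^ 2 : ℝ) : ℂ) * θ t) t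

theorem exists_freqSystem (α β νx νy ηx ηy : ℝ) (k : ℤ) (ξ : ℝ) (w₀ θ₀ : ℂ) :
    ∃ w θ : ℝ → ℂ, w 0 = w₀ ∧ θ 0 = θ₀ ∧
      SolvesSystem (ContinuousLinearMap.mul ℂ ℂ)
        (fun t => -diffusionSymbol k β νx νy (t, ξ / (2 * π)))
        (fun _ => Complex.I * k) (fun t => couplingSymbol α β k (t, ξ / (2 * π)))
        (fun t => -diffusionSymbol k β ηx ηy (t, ξ / (2 * π))) w θ := by
  have h : ∀ f : C(ℝ × ℝ, ℂ), Continuous fun t => f (t, ξ / (2 * π)) := fun f =>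
    f.continuous.comp (continuous_id.prodMk continuous_const)
  exact exists_solvesSystem _ (h _).neg continuous_const (h _) (h _).neg w₀ θ₀

theorem solvesSystem_freqSystem {α β νx νy ηx ηy : ℝ} {k : ℤ} {ξ : ℝ} {w θ : ℝ → ℂ}
    (h : SolvesSystem (ContinuousLinearMap.mul ℂ ℂ)
        (fun t => -diffusionSymbol k β νx νy (t, ξ / (2 * π)))
        (fun _ => Complex.I * k) (fun t => couplingSymbol α β k (t, ξ / (2 * π)))
        (fun t => -diffusionSymbol k β ηx ηy (t, ξ / (2 * π))) w θ) :
    FreqSystem α β νx νy ηx ηy k ξ w θ := by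
  have e : 2 * π * (ξ / (2 * π)) = ξ := mul_div_cancel₀ _ Real.two_pi_pos.ne'
  refine ⟨fun t => (h t).1.congr_deriv ?_, fun t => (h t).2.congr_deriv ?_⟩
  · simp only [diffusionSymbol, ContinuousMap.coe_mk, e, ContinuousLinearMap.mul_apply']
  · simp only [diffusionSymbol, couplingSymbol, ContinuousMap.coe_mk, e,
      ContinuousLinearMap.mul_apply']
    push_cast
    ring

/-- On a window, the modes of a solution are given by the pointwise system. -/
theorem window_representation {α β νx νy ηx ηy : ℝ} {ω θ : ℝ → L2}
    (hsol : IsSolution α β νx νy ηx ηy ω θ) (k : ℤ) (R : ℝ) {W Θ : ℝ → ℝ → ℂ}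
    (hW0 : ∀ᵐ η : ℝ, W η 0 = fourierL (movingMode k β ω 0) η)
    (hΘ0 : ∀ᵐ η : ℝ, Θ η 0 = fourierL (movingMode k β θ 0) η)
    (hsys : ∀ η, SolvesSystem (ContinuousLinearMap.mul ℂ ℂ)
        (fun t => -diffusionSymbol k β νx νy (t, η))
        (fun _ => Complex.I * k) (fun t => couplingSymbol α β k (t, η))
        (fun t => -diffusionSymbol k β ηx ηy (t, η)) (W η) (Θ η)) {t : ℝ} (ht : 0 ≤ t) :
    ∀ᵐ η : ℝ, η ∈ Icc (-R) R → fourierL (movingMode k β ω t) η = W η t ∧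
      fourierL (movingMode k β θ t) η = Θ η t := by
  set a : ℝ → C(Window R, ℂ) := fun t => -windowCurve R (diffusionSymbol k β νx νy) t with ha
  set b : ℝ → C(Window R, ℂ) := fun _ => (Complex.I * k) • 1 with hb
  set c : ℝ → C(Window R, ℂ) := fun t => windowCurve R (couplingSymbol α β k) t with hc
  set d : ℝ → C(Window R, ℂ) := fun t => -windowCurve R (diffusionSymbol k β ηx ηy) t with hd
  have hac : Continuous a := (windowCurve R _).continuous.neg
  have hbc : Continuous b := continuous_const
  have hcc : Continuous c := (windowCurve R _).continuous
  have hdc : Continuous d := (windowCurve R _).continuous.neg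
  -- The two columns of the fundamental matrix, with entries that are continuous functions on the
  -- window.
  obtain ⟨x, y, hx0, hy0, hxy⟩ := exists_solvesSystem
    (ContinuousLinearMap.mul ℂ C(Window R, ℂ)) hac hbc hcc hdc 1 0
  obtain ⟨x', y', hx0', hy0', hxy'⟩ := exists_solvesSystem
    (ContinuousLinearMap.mul ℂ C(Window R, ℂ)) hac hbc hcc hdc 0 1
  set F := fourierL (movingMode k β ω 0) with hF
  set G := fourierL (movingMode k β θ 0) with hG
  have hact := (hxy.action (L := windowMul R) (fun u v f => (windowMul_windowMul u v f).symm) F).add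
    (hxy'.action (L := windowMul R) (fun u v f => (windowMul_windowMul u v f).symm) G)
  have huniq := solvesSystem_unique (windowMul R) hac hbc hcc hdc hact ht
    (fun s hs => (window_system hsol k R hs).1) (fun s hs => (window_system hsol k R hs).2)
    (by simp [hx0, hx0', hF]) (by simp [hy0, hy0', hG])
  have hpt : ∀ η (hη : η ∈ Icc (-R) R), W η 0 = F η → Θ η 0 = G η →
      x t ⟨η, hη⟩ * F η + x' t ⟨η, hη⟩ * G η = W η t ∧
      y t ⟨η, hη⟩ * F η + y' t ⟨η, hη⟩ * G η = Θ η t := by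
    intro η hη h1 h2
    -- Evaluation at `η` is a continuous algebra homomorphism, so it carries the fundamental matrix
    -- to solutions of the pointwise system.
    have hev : ∀ {p q : ℝ → C(Window R, ℂ)} (f : ℂ),
        SolvesSystem (ContinuousLinearMap.mul ℂ C(Window R, ℂ)) a b c d p q →
        SolvesSystem (ContinuousLinearMap.mul ℂ ℂ)
          (fun t => -diffusionSymbol k β νx νy (t, η))
          (fun _ => Complex.I * k) (fun t => couplingSymbol α β k (t, η))
          (fun t => -diffusionSymbol k β ηx ηy (t, η))
          (fun t => p t ⟨η, hη⟩ * f) (fun t => q t ⟨η, hη⟩ * f) := by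
      intro p q f h s
      have e1 := ((ContinuousMap.evalCLM (M := ℂ) ℝ (⟨η, hη⟩ : Window R)).hasFDerivAt.comp_hasDerivAt
        s (h s).1).mul_const f
      have e2 := ((ContinuousMap.evalCLM (M := ℂ) ℝ (⟨η, hη⟩ : Window R)).hasFDerivAt.comp_hasDerivAt
        s (h s).2).mul_const f
      refine ⟨e1.congr_deriv ?_, e2.congr_deriv ?_⟩ <;>
      · simp [ha, hb, hc, hd, windowCurve_apply]
        ring
    have hsum := (hev (F η) hxy).add (hev (G η) hxy')
    have hcs : ∀ f : C(ℝ × ℝ, ℂ), Continuous fun t => f (t, η) := fun f =>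
      f.continuous.comp (continuous_id.prodMk continuous_const)
    have := solvesSystem_unique (ContinuousLinearMap.mul ℂ ℂ) (hcs _).neg continuous_const (hcs _)
      (hcs _).neg (hsys η) ht (fun s _ => (hsum s).1.hasDerivWithinAt)
      (fun s _ => (hsum s).2.hasDerivWithinAt) (by simp [hx0, hx0', h1]) (by simp [hy0, hy0', h2])
    exact this
  have hcomb : ∀ (p q : C(Window R, ℂ)) (f : L2R),
      windowMul R 1 f = windowMul R p F + windowMul R q G →
      ∀ᵐ η : ℝ, ∀ hη : η ∈ Icc (-R) R, f η = p ⟨η, hη⟩ * F η + q ⟨η, hη⟩ * G η := by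
    intro p q f h
    filter_upwards [coeFn_windowMul 1 f, coeFn_windowMul p F, coeFn_windowMul q G,
      Lp.coeFn_add (windowMul R p F) (windowMul R q G)] with η h1 h2 h3 h4 hη
    rw [h, h4, Pi.add_apply, h2, h3, windowExt_of_mem _ hη, windowExt_of_mem _ hη,
      windowExt_of_mem _ hη, ContinuousMap.one_apply, one_mul] at h1
    exact h1.symm
  filter_upwards [hcomb _ _ _ huniq.1, hcomb _ _ _ huniq.2, hW0, hΘ0] with η h1 h2 h3 h4 hη
  rw [h1 hη, h2 hη]
  exact hpt η hη h3 h4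

/-- For almost every frequency, a solution is given by the solution of the pointwise system. -/
theorem freq_representation {α β νx νy ηx ηy : ℝ} {ω θ : ℝ → L2}
    (hsol : IsSolution α β νx νy ηx ηy ω θ) (k : ℤ) :
    ∃ W Θ : ℝ → ℝ → ℂ, (∀ ξ, FreqSystem α β νx νy ηx ηy k ξ (W ξ) (Θ ξ)) ∧
      (∀ ξ, W ξ 0 = ft (ω 0) k ξ) ∧ (∀ ξ, Θ ξ 0 = ft (θ 0) k ξ) ∧
      ∀ t, 0 ≤ t → ∀ᵐ ξ : ℝ, ft (comoving β t (ω t)) k ξ = W ξ t ∧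
        ft (comoving β t (θ t)) k ξ = Θ ξ t := by
  -- The pointwise solutions are chosen frequency by frequency, with no claim of measurability in
  -- `ξ`; they enter only through almost everywhere equality with the transforms.
  choose W Θ hW0 hΘ0 hsys using fun ξ : ℝ =>
    exists_freqSystem α β νx νy ηx ηy k ξ (ft (ω 0) k ξ) (ft (θ 0) k ξ)
  refine ⟨W, Θ, fun ξ => solvesSystem_freqSystem (hsys ξ), hW0, hΘ0, fun t ht => ?_⟩
  have hinit : ∀ f : ℝ → L2, ∀ᵐ η : ℝ, ft (f 0) k (2 * π * η) = fourierL (movingMode k β f 0) η := by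
    intro f
    filter_upwards [ae_unscale (ft_comoving β 0 (f 0) k)] with η hη
    rw [mul_zero, sub_zero] at hη
    rw [← hη, ft_two_pi_mul]; rfl
  -- Countably many windows exhaust the line, so a single null set suffices.
  have h : ∀ n : ℕ, ∀ᵐ η : ℝ, η ∈ Icc (-(n : ℝ)) n →
      fourierL (movingMode k β ω t) η = W (2 * π * η) t ∧
      fourierL (movingMode k β θ t) η = Θ (2 * π * η) t := by
    intro n
    refine window_representation hsol k n (W := fun η => W (2 * π * η))
      (Θ := fun η => Θ (2 * π * η)) ?_ ?_ (fun η => ?_) ht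
    · filter_upwards [hinit ω] with η hη
      rw [hW0, hη]
    · filter_upwards [hinit θ] with η hη
      rw [hΘ0, hη]
    · have := hsys (2 * π * η)
      rwa [two_pi_mul_div] at this
  filter_upwards [ae_scale (ae_all_iff.2 h)] with ξ hξ
  obtain ⟨n, hn⟩ := exists_nat_ge |ξ / (2 * π)|
  have := hξ n (abs_le.1 hn)
  rw [mul_div_cancel₀ _ Real.two_pi_pos.ne'] at this
  rw [ft_eq, ft_eq]
  exact this

/-! ### The damping factor and enhanced dissipation -/

section Damping

variable {β c d : ℝ} {k : ℤ} {ξ : ℝ}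

theorem integral_sq_shear (β : ℝ) (k : ℤ) (ξ a b : ℝ) : ∫ τ in a..b, (ξ - β * k * τ) ^ 2 =
    (ξ ^ 2 * b - ξ * (β * k) * b ^ 2 + (β * k) ^ 2 * b ^ 3 / 3)
      - (ξ ^ 2 * a - ξ * (β * k) * a ^ 2 + (β * k) ^ 2 * a ^ 3 / 3) := by
  refine intervalIntegral.integral_eq_sub_of_hasDerivAt
    (f := fun τ => ξ ^ 2 * τ - ξ * (β * k) * τ ^ 2 + (β * k) ^ 2 * τ ^ 3 / 3) (fun τ _ => ?_)
    (Continuous.intervalIntegrable (by fun_prop) _ _)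
  have h := (((hasDerivAt_id τ).const_mul (ξ ^ 2)).sub
    (((hasDerivAt_id τ).pow 2).const_mul (ξ * (β * k)))).add
    ((((hasDerivAt_id τ).pow 3).const_mul ((β * k) ^ 2)).div_const 3)
  refine h.congr_deriv ?_
  simp
  ring

theorem damping_eq (β c d : ℝ) (k : ℤ) (ξ a b : ℝ) : damping β c d k ξ a b =
    Real.exp (-c * k ^ 2 * (b - a) - d * ((ξ ^ 2 * b - ξ * (β * k) * b ^ 2 + (β * k) ^ 2 * b ^ 3 / 3)
      - (ξ ^ 2 * a - ξ * (β * k) * a ^ 2 + (β * k) ^ 2 * a ^ 3 / 3))) := by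
  rw [damping, integral_sq_shear]

theorem damping_pos (β c d : ℝ) (k : ℤ) (ξ a b : ℝ) : 0 < damping β c d k ξ a b := Real.exp_pos _

theorem damping_self (β c d : ℝ) (k : ℤ) (ξ a : ℝ) : damping β c d k ξ a a = 1 := by
  rw [damping_eq]; simp

theorem damping_mul (β c d : ℝ) (k : ℤ) (ξ a b e : ℝ) :
    damping β c d k ξ a b * damping β c d k ξ b e = damping β c d k ξ a e := by
  rw [damping_eq, damping_eq, damping_eq, ← Real.exp_add]
  congr 1; ring

theorem damping_add (β c d c' d' : ℝ) (k : ℤ) (ξ a b : ℝ) :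
    damping β c d k ξ a b * damping β c' d' k ξ a b = damping β (c + c') (d + d') k ξ a b := by
  rw [damping_eq, damping_eq, damping_eq, ← Real.exp_add]
  congr 1; ring

theorem continuous_damping (β c d : ℝ) (k : ℤ) :
    Continuous fun q : ℝ × ℝ × ℝ => damping β c d k q.1 q.2.1 q.2.2 := by
  simp only [damping_eq]
  fun_prop

theorem hasDerivAt_damping_right (β c d : ℝ) (k : ℤ) (ξ a b : ℝ) :
    HasDerivAt (fun b => damping β c d k ξ a b)
      (-(c * k ^ 2 + d * (ξ - β * k * b) ^ 2) * damping β c d k ξ a b) b := by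
  have hc : Continuous fun τ : ℝ => (ξ - β * k * τ) ^ 2 := by fun_prop
  have h1 := intervalIntegral.integral_hasDerivAt_right (hc.intervalIntegrable a b)
    hc.aestronglyMeasurable.stronglyMeasurableAtFilter hc.continuousAt
  have h2 : HasDerivAt (fun b => -c * (k : ℝ) ^ 2 * (b - a) - d * ∫ τ in a..b, (ξ - β * k * τ) ^ 2)
      (-c * (k : ℝ) ^ 2 * 1 - d * (ξ - β * k * b) ^ 2) b :=
    (((hasDerivAt_id b).sub_const a).const_mul (-c * (k : ℝ) ^ 2)).sub (h1.const_mul d)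
  refine h2.exp.congr_deriv ?_
  rw [damping]
  ring

theorem damping_symm (β c d : ℝ) (k : ℤ) (ξ a b : ℝ) :
    damping β c d k ξ b a = (damping β c d k ξ a b)⁻¹ :=
  eq_inv_of_mul_eq_one_left (by rw [damping_mul, damping_self])

theorem hasDerivAt_damping_left (β c d : ℝ) (k : ℤ) (ξ a b : ℝ) :
    HasDerivAt (fun a => damping β c d k ξ a b)
      ((c * k ^ 2 + d * (ξ - β * k * a) ^ 2) * damping β c d k ξ a b) a := by
  have h := (hasDerivAt_damping_right β c d k ξ b a).inv (damping_pos _ _ _ _ _ _ _).ne'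
  have e : (fun a => damping β c d k ξ b a)⁻¹ = fun a => damping β c d k ξ a b :=
    funext fun a => (damping_symm β c d k ξ b a).symm
  rw [e] at h
  refine h.congr_deriv ?_
  rw [damping_symm β c d k ξ b a]
  field_simp

theorem one_le_sq_of_ne_zero (hk : k ≠ 0) : (1 : ℝ) ≤ (k : ℝ) ^ 2 := by
  have : (1 : ℤ) ≤ k ^ 2 := by have := Int.one_le_abs hk; nlinarith [sq_abs k]
  exact_mod_cast this

/-- The integral equals `(b - a)` times the square of `ξ - βkτ` at the midpoint plus `β²k²(b - a)³ /
12`. The worst `ξ` is the one critical at the midpoint, and `k² ≥ 1`. -/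
theorem integral_sq_shear_ge (hk : k ≠ 0) (β ξ : ℝ) {a b : ℝ} (hab : a ≤ b) :
    β ^ 2 * (b - a) ^ 3 / 12 ≤ ∫ τ in a..b, (ξ - β * k * τ) ^ 2 := by
  rw [integral_sq_shear]
  have h1 := one_le_sq_of_ne_zero hk
  have h2 : 0 ≤ (b - a) * (ξ - β * k * (a + b) / 2) ^ 2 :=
    mul_nonneg (sub_nonneg.2 hab) (sq_nonneg _)
  have h3 : 0 ≤ (b - a) ^ 3 * β ^ 2 * ((k : ℝ) ^ 2 - 1) :=
    mul_nonneg (mul_nonneg (pow_nonneg (sub_nonneg.2 hab) 3) (sq_nonneg _)) (by linarith)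
  nlinarith [h2, h3]

theorem damping_le (hc : 0 ≤ c) (hd : 0 ≤ d) (hk : k ≠ 0) {a b : ℝ} (hab : a ≤ b) :
    damping β c d k ξ a b ≤
      Real.exp (-d * (β ^ 2 * (b - a) ^ 3 / 12) - c * (b - a)) := by
  rw [damping]
  refine Real.exp_le_exp.2 ?_
  have h1 := mul_le_mul_of_nonneg_left (integral_sq_shear_ge hk β ξ hab) hd
  have h2 := mul_le_mul_of_nonneg_left (one_le_sq_of_ne_zero hk)
    (mul_nonneg hc (sub_nonneg.2 hab))
  nlinarith

theorem damping_le_one (hc : 0 ≤ c) (hd : 0 ≤ d) {a b : ℝ} (hab : a ≤ b) :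
    damping β c d k ξ a b ≤ 1 := by
  rw [damping, Real.exp_le_one_iff]
  have h1 : 0 ≤ ∫ τ in a..b, (ξ - β * k * τ) ^ 2 :=
    intervalIntegral.integral_nonneg hab fun τ _ => sq_nonneg _
  have h2 := mul_nonneg (mul_nonneg hc (sq_nonneg (k : ℝ))) (sub_nonneg.2 hab)
  nlinarith [mul_nonneg hd h1]

/-- The exponential rate that dominates the damping. -/
def dampingRate (β c d : ℝ) : ℝ := c + d * β ^ 2 / 12

/-- Uses `u³ ≥ u - 1` for `u ≥ 0` to replace the cubic exponent by a linear one, at the price of a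
constant factor. -/
theorem damping_le_exp (hc : 0 ≤ c) (hd : 0 ≤ d) (hk : k ≠ 0) {a b : ℝ} (hab : a ≤ b) :
    damping β c d k ξ a b ≤
      Real.exp (d * β ^ 2 / 12) * Real.exp (-dampingRate β c d * (b - a)) := by
  refine (damping_le hc hd hk hab).trans ?_
  rw [← Real.exp_add, dampingRate]
  refine Real.exp_le_exp.2 ?_
  have hu := sub_nonneg.2 hab
  have h1 : 0 ≤ (b - a) ^ 3 - (b - a) + 1 := by
    nlinarith [mul_nonneg hu (sq_nonneg (b - a - 1)), sq_nonneg (b - a - 1)]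
  nlinarith [mul_nonneg (mul_nonneg hd (sq_nonneg β)) h1]

/-- The constant bounding the time integral of the damping. -/
def dampingMass (β c d : ℝ) : ℝ := Real.exp (d * β ^ 2 / 12) / dampingRate β c d

theorem continuous_damping_right (β c d : ℝ) (k : ℤ) (ξ a : ℝ) :
    Continuous fun s => damping β c d k ξ a s :=
  (continuous_damping β c d k).comp (continuous_const.prodMk (continuous_const.prodMk continuous_id))

theorem continuous_damping_left (β c d : ℝ) (k : ℤ) (ξ b : ℝ) :
    Continuous fun s => damping β c d k ξ s b :=
  (continuous_damping β c d k).comp (continuous_const.prodMk (continuous_id.prodMk continuous_const))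

/-- The exponential majorant does not depend on `k ≠ 0` or `ξ`; this gives the profile estimates a
constant that does not depend on the frequency. -/
theorem integrableOn_damping_Ioi (hc : 0 ≤ c) (hd : 0 ≤ d) (hk : k ≠ 0)
    (hr : 0 < dampingRate β c d) (a : ℝ) :
    IntegrableOn (fun s => damping β c d k ξ a s) (Ioi a) ∧
      ∫ s in Ioi a, damping β c d k ξ a s ≤ dampingMass β c d := by
  set l := dampingRate β c d with hl
  set M := Real.exp (d * β ^ 2 / 12) with hM
  have e : ∀ s, M * Real.exp (-l * (s - a)) = (M * Real.exp (l * a)) * Real.exp (-l * s) := by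
    intro s; rw [mul_assoc, ← Real.exp_add (_ * _)]; congr 2; ring
  have hi : IntegrableOn (fun s => M * Real.exp (-l * (s - a))) (Ioi a) := by
    simp only [e]
    exact (exp_neg_integrableOn_Ioi a hr).const_mul _
  have hle : ∀ s ∈ Ioi a, damping β c d k ξ a s ≤ M * Real.exp (-l * (s - a)) := fun s hs =>
    damping_le_exp hc hd hk (le_of_lt hs)
  have hint : IntegrableOn (fun s => damping β c d k ξ a s) (Ioi a) := by
    refine Integrable.mono' hi (continuous_damping_right β c d k ξ a).aestronglyMeasurable ?_
    filter_upwards [ae_restrict_mem measurableSet_Ioi] with s hs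
    rw [Real.norm_of_nonneg (damping_pos _ _ _ _ _ _ _).le]
    exact hle s hs
  refine ⟨hint, (setIntegral_mono_on hint hi measurableSet_Ioi hle).trans (le_of_eq ?_)⟩
  simp only [e]
  rw [integral_const_mul, integral_exp_mul_Ioi (by linarith), dampingMass, ← hl, ← hM, neg_div_neg_eq,
    mul_assoc, ← mul_div_assoc, ← Real.exp_add, show l * a + -l * a = 0 by ring, Real.exp_zero]
  ring

theorem integrableOn_damping_Iic (hc : 0 ≤ c) (hd : 0 ≤ d) (hk : k ≠ 0)
    (hr : 0 < dampingRate β c d) (b : ℝ) :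
    IntegrableOn (fun s => damping β c d k ξ s b) (Iic b) ∧
      ∫ s in Iic b, damping β c d k ξ s b ≤ dampingMass β c d := by
  set l := dampingRate β c d with hl
  set M := Real.exp (d * β ^ 2 / 12) with hM
  have e : ∀ s, M * Real.exp (-l * (b - s)) = (M * Real.exp (-l * b)) * Real.exp (l * s) := by
    intro s; rw [mul_assoc, ← Real.exp_add (_ * _)]; congr 2; ring
  have hi : IntegrableOn (fun s => M * Real.exp (-l * (b - s))) (Iic b) := by
    simp only [e]
    exact (integrableOn_exp_mul_Iic hr b).const_mul _
  have hle : ∀ s ∈ Iic b, damping β c d k ξ s b ≤ M * Real.exp (-l * (b - s)) := fun s hs =>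
    damping_le_exp hc hd hk hs
  have hint : IntegrableOn (fun s => damping β c d k ξ s b) (Iic b) := by
    refine Integrable.mono' hi (continuous_damping_left β c d k ξ b).aestronglyMeasurable ?_
    filter_upwards [ae_restrict_mem measurableSet_Iic] with s hs
    rw [Real.norm_of_nonneg (damping_pos _ _ _ _ _ _ _).le]
    exact hle s hs
  refine ⟨hint, (setIntegral_mono_on hint hi measurableSet_Iic hle).trans (le_of_eq ?_)⟩
  simp only [e]
  rw [integral_const_mul, integral_exp_mul_Iic hr, dampingMass, ← hl, ← hM,
    mul_assoc, ← mul_div_assoc, ← Real.exp_add, show -l * b + l * b = 0 by ring, Real.exp_zero]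
  ring

end Damping

/-! ### Explicit solution for `α = 0` -/

theorem FreqSystem.temperature_eq {β νx νy ηx ηy : ℝ} {k : ℤ} {ξ : ℝ} {w θ : ℝ → ℂ}
    (h : FreqSystem 0 β νx νy ηx ηy k ξ w θ) (t : ℝ) :
    θ t = damping β ηx ηy k ξ 0 t * θ 0 := by
  have hd : ∀ s, HasDerivAt (fun s => (damping β ηx ηy k ξ s t : ℂ) * θ s) 0 s := fun s => by
    refine ((hasDerivAt_damping_left β ηx ηy k ξ s t).ofReal_comp.mul
      (h.temperature s)).congr_deriv ?_
    push_cast; ring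
  have := is_const_of_deriv_eq_zero (fun s => (hd s).differentiableAt) (fun s => (hd s).deriv) t 0
  rw [damping_self] at this
  simpa using this

/-- The Duhamel kernel. -/
def duhamelKernel (β νx νy ηx ηy : ℝ) (k : ℤ) (ξ t s : ℝ) : ℝ :=
  damping β νx νy k ξ s t * damping β ηx ηy k ξ 0 s

theorem continuous_duhamelKernel (β νx νy ηx ηy : ℝ) (k : ℤ) (t : ℝ) :
    Continuous fun q : ℝ × ℝ => duhamelKernel β νx νy ηx ηy k q.1 t q.2 :=
  ((continuous_damping β νx νy k).comp (continuous_fst.prodMk (continuous_snd.prodMk continuous_const))).mul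
    ((continuous_damping β ηx ηy k).comp (continuous_fst.prodMk (continuous_const.prodMk continuous_snd)))

theorem continuous_duhamelKernel_right (β νx νy ηx ηy : ℝ) (k : ℤ) (ξ t : ℝ) :
    Continuous fun s => duhamelKernel β νx νy ηx ηy k ξ t s :=
  (continuous_duhamelKernel β νx νy ηx ηy k t).comp (continuous_const.prodMk continuous_id)

/-- Duhamel: weighting `w s` by the damping from `s` to `t` removes the diffusion from its
derivative, and only the source is left to integrate. -/
theorem FreqSystem.vorticity_eq {β νx νy ηx ηy : ℝ} {k : ℤ} {ξ : ℝ} {w θ : ℝ → ℂ}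
    (h : FreqSystem 0 β νx νy ηx ηy k ξ w θ) (t : ℝ) :
    w t = damping β νx νy k ξ 0 t * w 0 +
      ((∫ s in (0 : ℝ)..t, duhamelKernel β νx νy ηx ηy k ξ t s : ℝ) : ℂ) *
        (Complex.I * k * θ 0) := by
  have hd : ∀ s, HasDerivAt (fun s => (damping β νx νy k ξ s t : ℂ) * w s)
      ((duhamelKernel β νx νy ηx ηy k ξ t s : ℂ) * (Complex.I * k * θ 0)) s := fun s => by
    refine ((hasDerivAt_damping_left β νx νy k ξ s t).ofReal_comp.mul
      (h.vorticity s)).congr_deriv ?_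
    rw [h.temperature_eq s, duhamelKernel]
    push_cast; ring
  have hc : Continuous fun s => (duhamelKernel β νx νy ηx ηy k ξ t s : ℂ) * (Complex.I * k * θ 0) :=
    (Complex.continuous_ofReal.comp (continuous_duhamelKernel_right _ _ _ _ _ _ _ _)).mul
      continuous_const
  have := intervalIntegral.integral_eq_sub_of_hasDerivAt (a := 0) (b := t) (fun s _ => hd s)
    (hc.intervalIntegrable _ _)
  rw [intervalIntegral.integral_mul_const, intervalIntegral.integral_ofReal, damping_self,
    Complex.ofReal_one, one_mul] at this
  rw [this]; ring

/-! ### Bounds for the profile and for the remainder -/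

section Profile

variable {β νx νy ηx ηy : ℝ} {k : ℤ}

open Classical in
/-- The coefficient of the initial vorticity in the profile. -/
def profileFree (β νx νy ηx ηy t : ℝ) (k : ℤ) (ξ : ℝ) : ℝ :=
  if νx = ηx ∧ νy = ηy then 0
  else if νx ≤ ηx ∧ νy ≤ ηy ∧ (β ≠ 0 ∨ νx ≠ ηx) then damping β νx νy k ξ 0 t
  else if ηx ≤ νx ∧ ηy ≤ νy ∧ (β ≠ 0 ∨ νx ≠ ηx) then 0
  else damping β νx νy k ξ 0 t

open Classical in
/-- The coefficient of the buoyancy `ik θ₀` in the profile. -/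
def profileForced (β νx νy ηx ηy t : ℝ) (k : ℤ) (ξ : ℝ) : ℝ :=
  if νx = ηx ∧ νy = ηy then ∫ s in (0 : ℝ)..t, duhamelKernel β νx νy ηx ηy k ξ t s
  else if νx ≤ ηx ∧ νy ≤ ηy ∧ (β ≠ 0 ∨ νx ≠ ηx) then
    ∫ s in Ioi (0 : ℝ), duhamelKernel β νx νy ηx ηy k ξ t s
  else if ηx ≤ νx ∧ ηy ≤ νy ∧ (β ≠ 0 ∨ νx ≠ ηx) then
    ∫ s in Iic t, duhamelKernel β νx νy ηx ηy k ξ t s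
  else ∫ s in (0 : ℝ)..t, duhamelKernel β νx νy ηx ηy k ξ t s

theorem profileFt_zero_freq (ω₀ θ₀ : L2) (t ξ : ℝ) :
    profileFt β νx νy ηx ηy ω₀ θ₀ t 0 ξ = 0 := by
  simp [profileFt]

theorem profileFt_eq (hk : k ≠ 0) (ω₀ θ₀ : L2) (t ξ : ℝ) :
    profileFt β νx νy ηx ηy ω₀ θ₀ t k ξ =
      profileFree β νx νy ηx ηy t k ξ * ft ω₀ k ξ +
        profileForced β νx νy ηx ηy t k ξ * (Complex.I * k * ft θ₀ k ξ) := by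
  simp only [profileFt, profileFree, profileForced, duhamelKernel, if_neg hk]
  split_ifs <;> simp

theorem measurable_profileFree (β νx νy ηx ηy t : ℝ) (k : ℤ) :
    Measurable (profileFree β νx νy ηx ηy t k) := by
  have h : Measurable fun ξ => damping β νx νy k ξ 0 t :=
    ((continuous_damping β νx νy k).comp
      (continuous_id.prodMk (continuous_const.prodMk continuous_const))).measurable
  unfold profileFree
  split_ifs
  exacts [measurable_const, h, measurable_const, h]

theorem measurable_profileForced (β νx νy ηx ηy t : ℝ) (k : ℤ) :
    Measurable (profileForced β νx νy ηx ηy t k) := by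
  have hK := (continuous_duhamelKernel β νx νy ηx ηy k t).stronglyMeasurable
  have h : ∀ S : Set ℝ, Measurable fun ξ => ∫ s in S, duhamelKernel β νx νy ηx ηy k ξ t s :=
    fun S => hK.integral_prod_right.measurable
  have h' : Measurable fun ξ => ∫ s in (0 : ℝ)..t, duhamelKernel β νx νy ηx ηy k ξ t s := by
    unfold intervalIntegral
    exact (h _).sub (h _)
  unfold profileForced
  split_ifs
  exacts [h', h _, h _, h']

/-- Separates the damping common to both equations from the excesses. Viscous excess acts on `[s,
t]` and thermal excess on `[0, s]`, so they concentrate the kernel near `s = t` and near `s = 0`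
respectively. -/
theorem duhamelKernel_eq_min (a b : ℝ) (ξ t s : ℝ) : duhamelKernel β νx νy ηx ηy k ξ t s =
    damping β a b k ξ 0 t *
      (damping β (νx - a) (νy - b) k ξ s t * damping β (ηx - a) (ηy - b) k ξ 0 s) := by
  have h1 := damping_add β a b (νx - a) (νy - b) k ξ s t
  have h2 := damping_add β a b (ηx - a) (ηy - b) k ξ 0 s
  rw [add_sub_cancel, add_sub_cancel] at h1 h2
  rw [duhamelKernel, ← h1, ← h2, ← damping_mul β a b k ξ 0 s t]
  ring

theorem damping_zero_zero (ξ a b : ℝ) : damping β 0 0 k ξ a b = 1 := by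
  simp [damping]

/-- The rate for the part of the vorticity outside the profile. -/
def fastDecay (β νx νy ηx ηy t : ℝ) : ℝ :=
  Real.exp (-(max ηy νy) * (β ^ 2 * t ^ 3 / 12) - max ηx νx * t)

/-- The rate for the profile. -/
def slowDecay (β νx νy ηx ηy t : ℝ) : ℝ :=
  Real.exp (-(min ηy νy) * (β ^ 2 * t ^ 3 / 12) - min ηx νx * t / 2)

theorem damping_le_slowDecay {a b : ℝ} (ha : min ηx νx ≤ a) (hb : min ηy νy ≤ b)
    (h0a : 0 ≤ min ηx νx) (h0b : 0 ≤ min ηy νy) (hk : k ≠ 0) (ξ : ℝ) {t : ℝ} (ht : 0 ≤ t) :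
    damping β a b k ξ 0 t ≤ slowDecay β νx νy ηx ηy t := by
  refine (damping_le (h0a.trans ha) (h0b.trans hb) hk ht).trans (Real.exp_le_exp.2 ?_)
  have h1 : 0 ≤ β ^ 2 * t ^ 3 / 12 := by positivity
  have h2 := mul_le_mul_of_nonneg_right hb h1
  have h3 := mul_le_mul_of_nonneg_right ha ht
  have h4 := mul_nonneg h0a ht
  simp only [sub_zero]
  linarith

theorem damping_le_fastDecay {a b : ℝ} (ha : a = max ηx νx) (hb : b = max ηy νy)
    (h0a : 0 ≤ a) (h0b : 0 ≤ b) (hk : k ≠ 0) (ξ : ℝ) {t : ℝ} (ht : 0 ≤ t) :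
    damping β a b k ξ 0 t ≤ fastDecay β νx νy ηx ηy t := by
  have := damping_le h0a h0b hk ht (β := β) (ξ := ξ)
  rw [fastDecay, ← ha, ← hb]
  simpa using this

theorem integral_duhamelKernel_nonneg (ξ : ℝ) {t : ℝ} (ht : 0 ≤ t) :
    0 ≤ ∫ s in (0 : ℝ)..t, duhamelKernel β νx νy ηx ηy k ξ t s :=
  intervalIntegral.integral_nonneg ht fun _ _ =>
    (mul_pos (damping_pos _ _ _ _ _ _ _) (damping_pos _ _ _ _ _ _ _)).le

theorem intervalIntegral_le_of_Ioi {f : ℝ → ℝ} (h0 : ∀ s, 0 ≤ f s) {a b : ℝ} (hab : a ≤ b)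
    (hf : IntegrableOn f (Ioi a)) : ∫ s in a..b, f s ≤ ∫ s in Ioi a, f s := by
  rw [intervalIntegral.integral_of_le hab]
  exact setIntegral_mono_set hf (ae_of_all _ h0) (ae_of_all _ fun _ hs => hs.1)

theorem intervalIntegral_le_of_Iic {f : ℝ → ℝ} (h0 : ∀ s, 0 ≤ f s) {a b : ℝ} (hab : a ≤ b)
    (hf : IntegrableOn f (Iic b)) : ∫ s in a..b, f s ≤ ∫ s in Iic b, f s := by
  rw [intervalIntegral.integral_of_le hab]
  exact setIntegral_mono_set hf (ae_of_all _ h0) (ae_of_all _ fun _ hs => hs.2)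

/-- The Duhamel integral is controlled by the least damping when one of the two excess dampings is
effective. -/
theorem integral_duhamelKernel_le {a b : ℝ} (hax : a ≤ νx) (hay : a ≤ ηx) (hbx : b ≤ νy)
    (hby : b ≤ ηy) (hr : 0 < dampingRate β (νx - a) (νy - b) ∨ 0 < dampingRate β (ηx - a) (ηy - b))
    (hk : k ≠ 0) (ξ : ℝ) {t : ℝ} (ht : 0 ≤ t) :
    ∫ s in (0 : ℝ)..t, duhamelKernel β νx νy ηx ηy k ξ t s ≤ damping β a b k ξ 0 t *
      max (dampingMass β (νx - a) (νy - b)) (dampingMass β (ηx - a) (ηy - b)) := by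
  simp only [duhamelKernel_eq_min a b]
  rw [intervalIntegral.integral_const_mul]
  refine mul_le_mul_of_nonneg_left ?_ (damping_pos _ _ _ _ _ _ _).le
  have h1 := sub_nonneg.2 hax
  have h2 := sub_nonneg.2 hay
  have h3 := sub_nonneg.2 hbx
  have h4 := sub_nonneg.2 hby
  have c1 := continuous_damping_left β (νx - a) (νy - b) k ξ t
  have c2 := continuous_damping_right β (ηx - a) (ηy - b) k ξ 0
  rcases hr with hr | hr
  · refine le_trans ?_ (le_max_left _ _)
    have h := integrableOn_damping_Iic h1 h3 hk hr t (ξ := ξ)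
    refine le_trans ?_ ((intervalIntegral_le_of_Iic (fun s => (damping_pos _ _ _ _ _ _ _).le) ht
      h.1).trans h.2)
    refine intervalIntegral.integral_mono_on ht ((c1.mul c2).intervalIntegrable _ _)
      (c1.intervalIntegrable _ _) fun s hs => ?_
    exact mul_le_of_le_one_right (damping_pos _ _ _ _ _ _ _).le (damping_le_one h2 h4 hs.1)
  · refine le_trans ?_ (le_max_right _ _)
    have h := integrableOn_damping_Ioi h2 h4 hk hr 0 (ξ := ξ)
    refine le_trans ?_ ((intervalIntegral_le_of_Ioi (fun s => (damping_pos _ _ _ _ _ _ _).le) ht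
      h.1).trans h.2)
    refine intervalIntegral.integral_mono_on ht ((c1.mul c2).intervalIntegrable _ _)
      (c2.intervalIntegrable _ _) fun s hs => ?_
    exact mul_le_of_le_one_left (damping_pos _ _ _ _ _ _ _).le (damping_le_one h1 h3 hs.2)

theorem dampingMass_nonneg {c d : ℝ} (hc : 0 ≤ c) (hd : 0 ≤ d) : 0 ≤ dampingMass β c d := by
  unfold dampingMass dampingRate; positivity

/-- Half of the exponential rate pays for the factor `t`. This is why `slowDecay` keeps only half of
the horizontal rate. -/
theorem mul_exp_neg_le {c : ℝ} (hc : 0 < c) (t : ℝ) :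
    t * Real.exp (-c * t) ≤ 2 / c * Real.exp (-c * t / 2) := by
  have h1 : t ≤ 2 / c * Real.exp (c * t / 2) := by
    have := Real.add_one_le_exp (c * t / 2)
    rw [div_mul_eq_mul_div, le_div_iff₀ hc]
    nlinarith
  calc t * Real.exp (-c * t) ≤ 2 / c * Real.exp (c * t / 2) * Real.exp (-c * t) :=
        mul_le_mul_of_nonneg_right h1 (Real.exp_pos _).le
    _ = _ := by rw [mul_assoc, ← Real.exp_add]; congr 2; ring

/-- Without excess damping the Duhamel integral still decays when the horizontal damping does. -/
theorem integral_duhamelKernel_le_slowDecay (hνx : 0 ≤ νx) (hνy : 0 ≤ νy) (hηx : 0 ≤ ηx)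
    (hηy : 0 ≤ ηy) (hk : k ≠ 0) (ξ : ℝ) {t : ℝ} (ht : 0 ≤ t) :
    ∫ s in (0 : ℝ)..t, duhamelKernel β νx νy ηx ηy k ξ t s ≤ t * slowDecay β νx νy ηx ηy t ∧
      (0 < min ηx νx → ∫ s in (0 : ℝ)..t, duhamelKernel β νx νy ηx ηy k ξ t s ≤
        2 / min ηx νx * slowDecay β νx νy ηx ηy t) := by
  have h0 : 0 ≤ min ηx νx := le_min hηx hνx
  have h0' : 0 ≤ min ηy νy := le_min hηy hνy
  have key : ∫ s in (0 : ℝ)..t, duhamelKernel β νx νy ηx ηy k ξ t s ≤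
      t * damping β (min ηx νx) (min ηy νy) k ξ 0 t := by
    have : ∫ s in (0 : ℝ)..t, duhamelKernel β νx νy ηx ηy k ξ t s ≤
        ∫ s in (0 : ℝ)..t, damping β (min ηx νx) (min ηy νy) k ξ 0 t := by
      refine intervalIntegral.integral_mono_on ht
        ((continuous_duhamelKernel_right _ _ _ _ _ _ _ _).intervalIntegrable _ _)
        (continuous_const.intervalIntegrable _ _) fun s hs => ?_
      rw [duhamelKernel_eq_min (min ηx νx) (min ηy νy)]
      refine mul_le_of_le_one_right (damping_pos _ _ _ _ _ _ _).le (mul_le_one₀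
        (damping_le_one (sub_nonneg.2 (min_le_right _ _)) (sub_nonneg.2 (min_le_right _ _)) hs.2)
        (damping_pos _ _ _ _ _ _ _).le
        (damping_le_one (sub_nonneg.2 (min_le_left _ _)) (sub_nonneg.2 (min_le_left _ _)) hs.1))
    simpa using this
  refine ⟨key.trans (mul_le_mul_of_nonneg_left
    (damping_le_slowDecay le_rfl le_rfl h0 h0' hk ξ ht) ht), fun hpos => ?_⟩
  refine (key.trans (mul_le_mul_of_nonneg_left (damping_le h0 h0' hk ht) ht)).trans ?_
  have h1 := mul_exp_neg_le hpos t
  have h2 := mul_le_mul_of_nonneg_left h1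
    (Real.exp_pos (-(min ηy νy) * (β ^ 2 * t ^ 3 / 12))).le
  calc _ = Real.exp (-(min ηy νy) * (β ^ 2 * t ^ 3 / 12)) * (t * Real.exp (-min ηx νx * t)) := by
        rw [sub_zero, sub_eq_add_neg, Real.exp_add, ← neg_mul]; ring
    _ ≤ _ := h2
    _ = _ := by
        rw [slowDecay, sub_eq_add_neg, Real.exp_add, neg_mul (min ηx νx) t, neg_div]; ring

/-- Uniform bounds of the profile and of the remainder. -/
structure ProfileBound (β νx νy ηx ηy C : ℝ) (k : ℤ) (ξ t : ℝ) : Prop where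
  free_sub : |damping β νx νy k ξ 0 t - profileFree β νx νy ηx ηy t k ξ| ≤
    C * fastDecay β νx νy ηx ηy t
  forced_sub : |(∫ s in (0 : ℝ)..t, duhamelKernel β νx νy ηx ηy k ξ t s)
    - profileForced β νx νy ηx ηy t k ξ| ≤ C * fastDecay β νx νy ηx ηy t
  free : |profileFree β νx νy ηx ηy t k ξ| ≤ C * slowDecay β νx νy ηx ηy t
  forced : |profileForced β νx νy ηx ηy t k ξ| ≤ C * (1 + t) * slowDecay β νx νy ηx ηy t
  forced_of_not : ¬ (νx = 0 ∧ ηx = 0 ∧ νy = ηy) →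
    |profileForced β νx νy ηx ηy t k ξ| ≤ C * slowDecay β νx νy ηx ηy t

theorem fastDecay_pos (t : ℝ) : 0 < fastDecay β νx νy ηx ηy t := Real.exp_pos _

theorem slowDecay_pos (t : ℝ) : 0 < slowDecay β νx νy ηx ηy t := Real.exp_pos _

/-- If thermal diffusion dominates, the kernel decays away from `s = 0`; extending the integral to
infinity adds a tail that carries the full temperature damping. If viscosity dominates, the kernel
decays backwards from `s = t`; the added piece over `(-∞, 0]` and the free evolution both carry the
viscous damping. In both cases the remainder gets the larger damping and the profile the smaller.
With equal coefficients the kernel is constant in `s`, and the free evolution is the remainder. In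
the remaining mixed case the profile is the whole nonzero-mode vorticity. -/
theorem exists_profileBound (hνx : 0 ≤ νx) (hνy : 0 ≤ νy) (hηx : 0 ≤ ηx) (hηy : 0 ≤ ηy)
    (hpos : β ≠ 0 ∨ 0 < νx ∨ 0 < ηx) :
    ∃ C : ℝ, 0 ≤ C ∧ ∀ k : ℤ, k ≠ 0 → ∀ ξ t : ℝ, 0 ≤ t → ProfileBound β νx νy ηx ηy C k ξ t := by
  have h0 : 0 ≤ min ηx νx := le_min hηx hνx
  have h0' : 0 ≤ min ηy νy := le_min hηy hνy
  have hfp := fun t => fastDecay_pos (β := β) (νx := νx) (νy := νy) (ηx := ηx) (ηy := ηy) t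
  have hsp := fun t => slowDecay_pos (β := β) (νx := νx) (νy := νy) (ηx := ηx) (ηy := ηy) t
  by_cases c1 : νx = ηx ∧ νy = ηy
  · have e1 : ∀ t k ξ, profileFree β νx νy ηx ηy t k ξ = 0 := fun t k ξ => by
      rw [profileFree, if_pos c1]
    have e2 : ∀ t k ξ, profileForced β νx νy ηx ηy t k ξ =
        ∫ s in (0 : ℝ)..t, duhamelKernel β νx νy ηx ηy k ξ t s := fun t k ξ => by
      rw [profileForced, if_pos c1]
    have hC : 0 ≤ 2 / min ηx νx := by positivity
    -- Without horizontal diffusion the quotient is `0` by the convention for division; only the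
    -- bound with the factor `1 + t` is then claimed.
    refine ⟨1 + 2 / min ηx νx, by positivity, fun k hk ξ t ht => ?_⟩
    have hI := integral_duhamelKernel_le_slowDecay (β := β) hνx hνy hηx hηy hk ξ ht
    have hI0 := integral_duhamelKernel_nonneg (β := β) (νx := νx) (νy := νy) (ηx := ηx) (ηy := ηy)
      (k := k) ξ ht
    have hd := damping_le_fastDecay (β := β) (νx := νx) (νy := νy) (ηx := ηx) (ηy := ηy) (a := νx)
      (b := νy) (by rw [c1.1, max_self]) (by rw [c1.2, max_self]) hνx hνy hk ξ ht
    have hf := hfp t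
    have hs := hsp t
    constructor
    · rw [e1, sub_zero, abs_of_pos (damping_pos _ _ _ _ _ _ _)]
      nlinarith [mul_nonneg hC hf.le]
    · rw [e2, sub_self, abs_zero]; positivity
    · rw [e1, abs_zero]; positivity
    · rw [e2, abs_of_nonneg hI0]
      nlinarith [mul_nonneg (mul_nonneg hC hs.le) (add_nonneg zero_le_one ht)]
    · intro hne
      have hm : 0 < min ηx νx := by
        rw [← c1.1, min_self]
        refine lt_of_le_of_ne hνx fun h => hne ⟨h.symm, by rw [← c1.1, ← h], c1.2⟩
      rw [e2, abs_of_nonneg hI0]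
      nlinarith [hI.2 hm]
  by_cases c2 : νx ≤ ηx ∧ νy ≤ ηy ∧ (β ≠ 0 ∨ νx ≠ ηx)
  · have e1 : ∀ t k ξ, profileFree β νx νy ηx ηy t k ξ = damping β νx νy k ξ 0 t :=
      fun t k ξ => by rw [profileFree, if_neg c1, if_pos c2]
    have e3 : ∀ k ξ t s, duhamelKernel β νx νy ηx ηy k ξ t s =
        damping β νx νy k ξ 0 t * damping β (ηx - νx) (ηy - νy) k ξ 0 s := fun k ξ t s => by
      rw [duhamelKernel_eq_min νx νy, sub_self, sub_self, damping_zero_zero, one_mul]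
    have e2 : ∀ t k ξ, profileForced β νx νy ηx ηy t k ξ = damping β νx νy k ξ 0 t *
        ∫ s in Ioi 0, damping β (ηx - νx) (ηy - νy) k ξ 0 s := fun t k ξ => by
      rw [profileForced, if_neg c1, if_pos c2, ← integral_const_mul]; simp only [e3]
    have hx := sub_nonneg.2 c2.1
    have hy := sub_nonneg.2 c2.2.1
    have hr : 0 < dampingRate β (ηx - νx) (ηy - νy) := by
      unfold dampingRate
      rcases hx.eq_or_lt with h | h
      · have hβ : β ≠ 0 := c2.2.2.resolve_right fun h' => h' (by linarith)
        have : 0 < ηy - νy := lt_of_le_of_ne hy fun h' => c1 ⟨by linarith, by linarith⟩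
        positivity
      · positivity
    have hM := dampingMass_nonneg (β := β) hx hy
    refine ⟨1 + dampingMass β (ηx - νx) (ηy - νy), by positivity, fun k hk ξ t ht => ?_⟩
    have hf := hfp t
    have hs := hsp t
    have hd := damping_le_slowDecay (β := β) (νx := νx) (νy := νy) (ηx := ηx) (ηy := ηy)
      (min_le_right _ _) (min_le_right _ _) h0 h0' hk ξ ht
    have hd0 := damping_pos β νx νy k ξ 0 t
    have hI := integrableOn_damping_Ioi hx hy hk hr 0 (ξ := ξ)
    have hIt := integrableOn_damping_Ioi hx hy hk hr t (ξ := ξ)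
    have hI0 : 0 ≤ ∫ s in Ioi 0, damping β (ηx - νx) (ηy - νy) k ξ 0 s :=
      setIntegral_nonneg measurableSet_Ioi fun s _ => (damping_pos _ _ _ _ _ _ _).le
    have hIt0 : 0 ≤ ∫ s in Ioi t, damping β (ηx - νx) (ηy - νy) k ξ t s :=
      setIntegral_nonneg measurableSet_Ioi fun s _ => (damping_pos _ _ _ _ _ _ _).le
    -- The tail over `(t, ∞)`: the excess damping up to time `t` combines with the viscous damping
    -- into the full temperature damping.
    have hsplit : (∫ s in (0 : ℝ)..t, duhamelKernel β νx νy ηx ηy k ξ t s)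
        - profileForced β νx νy ηx ηy t k ξ = - (damping β ηx ηy k ξ 0 t *
          ∫ s in Ioi t, damping β (ηx - νx) (ηy - νy) k ξ t s) := by
      have h1 := intervalIntegral.integral_interval_add_Ioi (μ := volume)
        (f := fun s => damping β (ηx - νx) (ηy - νy) k ξ 0 s) (a := 0) (b := t) hI.1
        (hI.1.mono_set (Ioi_subset_Ioi ht))
      have h2 : ∫ s in Ioi t, damping β (ηx - νx) (ηy - νy) k ξ 0 s =
          damping β (ηx - νx) (ηy - νy) k ξ 0 t *
            ∫ s in Ioi t, damping β (ηx - νx) (ηy - νy) k ξ t s := by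
        rw [← integral_const_mul]; simp only [damping_mul]
      have h3 := damping_add β νx νy (ηx - νx) (ηy - νy) k ξ 0 t
      rw [add_sub_cancel, add_sub_cancel] at h3
      simp only [e2, e3]
      rw [intervalIntegral.integral_const_mul, ← h1, h2, ← h3]
      ring
    have hdf := damping_le_fastDecay (β := β) (νx := νx) (νy := νy) (ηx := ηx) (ηy := ηy) (a := ηx)
      (b := ηy) (max_eq_left c2.1).symm (max_eq_left c2.2.1).symm hηx hηy hk ξ ht
    have hfo : |profileForced β νx νy ηx ηy t k ξ| ≤
        (1 + dampingMass β (ηx - νx) (ηy - νy)) * slowDecay β νx νy ηx ηy t := by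
      rw [e2, abs_of_nonneg (mul_nonneg hd0.le hI0)]
      have := mul_le_mul hd hI.2 hI0 hs.le
      nlinarith
    constructor
    · rw [e1, sub_self, abs_zero]; positivity
    · rw [hsplit, abs_neg, abs_of_nonneg (mul_nonneg (damping_pos _ _ _ _ _ _ _).le hIt0)]
      have := mul_le_mul hdf hIt.2 hIt0 hf.le
      nlinarith
    · rw [e1, abs_of_pos hd0]
      nlinarith [mul_nonneg hM hs.le]
    · refine hfo.trans ?_
      refine mul_le_mul_of_nonneg_right ?_ hs.le
      nlinarith
    · exact fun _ => hfo
  by_cases c3 : ηx ≤ νx ∧ ηy ≤ νy ∧ (β ≠ 0 ∨ νx ≠ ηx)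
  · have e1 : ∀ t k ξ, profileFree β νx νy ηx ηy t k ξ = 0 :=
      fun t k ξ => by rw [profileFree, if_neg c1, if_neg c2, if_pos c3]
    have e3 : ∀ k ξ t s, duhamelKernel β νx νy ηx ηy k ξ t s =
        damping β ηx ηy k ξ 0 t * damping β (νx - ηx) (νy - ηy) k ξ s t := fun k ξ t s => by
      rw [duhamelKernel_eq_min ηx ηy, sub_self, sub_self, damping_zero_zero, mul_one]
    have e2 : ∀ t k ξ, profileForced β νx νy ηx ηy t k ξ = damping β ηx ηy k ξ 0 t *
        ∫ s in Iic t, damping β (νx - ηx) (νy - ηy) k ξ s t := fun t k ξ => by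
      rw [profileForced, if_neg c1, if_neg c2, if_pos c3, ← integral_const_mul]; simp only [e3]
    have hx := sub_nonneg.2 c3.1
    have hy := sub_nonneg.2 c3.2.1
    have hr : 0 < dampingRate β (νx - ηx) (νy - ηy) := by
      unfold dampingRate
      rcases hx.eq_or_lt with h | h
      · have hβ : β ≠ 0 := c3.2.2.resolve_right fun h' => h' (by linarith)
        have : 0 < νy - ηy := lt_of_le_of_ne hy fun h' => c1 ⟨by linarith, by linarith⟩
        positivity
      · positivity
    have hM := dampingMass_nonneg (β := β) hx hy
    refine ⟨1 + dampingMass β (νx - ηx) (νy - ηy), by positivity, fun k hk ξ t ht => ?_⟩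
    have hf := hfp t
    have hs := hsp t
    have hd := damping_le_slowDecay (β := β) (νx := νx) (νy := νy) (ηx := ηx) (ηy := ηy)
      (min_le_left _ _) (min_le_left _ _) h0 h0' hk ξ ht
    have hd0 := damping_pos β ηx ηy k ξ 0 t
    have hI := integrableOn_damping_Iic hx hy hk hr t (ξ := ξ)
    have hIt := integrableOn_damping_Iic hx hy hk hr 0 (ξ := ξ)
    have hI0 : 0 ≤ ∫ s in Iic t, damping β (νx - ηx) (νy - ηy) k ξ s t :=
      setIntegral_nonneg measurableSet_Iic fun s _ => (damping_pos _ _ _ _ _ _ _).le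
    have hIt0 : 0 ≤ ∫ s in Iic 0, damping β (νx - ηx) (νy - ηy) k ξ s 0 :=
      setIntegral_nonneg measurableSet_Iic fun s _ => (damping_pos _ _ _ _ _ _ _).le
    -- The piece over `(-∞, 0]`: here the excess damping over `[0, t]` turns the temperature damping
    -- into the viscous one.
    have hsplit : (∫ s in (0 : ℝ)..t, duhamelKernel β νx νy ηx ηy k ξ t s)
        - profileForced β νx νy ηx ηy t k ξ = - (damping β νx νy k ξ 0 t *
          ∫ s in Iic 0, damping β (νx - ηx) (νy - ηy) k ξ s 0) := by
      have h1 := intervalIntegral.integral_Iic_sub_Iic (μ := volume)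
        (f := fun s => damping β (νx - ηx) (νy - ηy) k ξ s t) (a := 0) (b := t)
        (hI.1.mono_set (Iic_subset_Iic.2 ht)) hI.1
      have h2 : ∫ s in Iic 0, damping β (νx - ηx) (νy - ηy) k ξ s t =
          damping β (νx - ηx) (νy - ηy) k ξ 0 t *
            ∫ s in Iic 0, damping β (νx - ηx) (νy - ηy) k ξ s 0 := by
        rw [← integral_const_mul]; simp only [mul_comm _ (damping _ _ _ _ _ _ 0), damping_mul]
      have h3 := damping_add β ηx ηy (νx - ηx) (νy - ηy) k ξ 0 t
      rw [add_sub_cancel, add_sub_cancel] at h3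
      simp only [e2, e3]
      rw [intervalIntegral.integral_const_mul, ← h1, h2, ← h3]
      ring
    have hdf := damping_le_fastDecay (β := β) (νx := νx) (νy := νy) (ηx := ηx) (ηy := ηy) (a := νx)
      (b := νy) (max_eq_right c3.1).symm (max_eq_right c3.2.1).symm hνx hνy hk ξ ht
    have hfo : |profileForced β νx νy ηx ηy t k ξ| ≤
        (1 + dampingMass β (νx - ηx) (νy - ηy)) * slowDecay β νx νy ηx ηy t := by
      rw [e2, abs_of_nonneg (mul_nonneg hd0.le hI0)]
      have := mul_le_mul hd hI.2 hI0 hs.le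
      nlinarith
    constructor
    · rw [e1, sub_zero, abs_of_pos (damping_pos _ _ _ _ _ _ _)]
      nlinarith [mul_nonneg hM hf.le]
    · rw [hsplit, abs_neg, abs_of_nonneg (mul_nonneg (damping_pos _ _ _ _ _ _ _).le hIt0)]
      have := mul_le_mul hdf hIt.2 hIt0 hf.le
      nlinarith
    · rw [e1, abs_zero]; positivity
    · refine hfo.trans ?_
      refine mul_le_mul_of_nonneg_right ?_ hs.le
      nlinarith
    · exact fun _ => hfo
  have e1 : ∀ t k ξ, profileFree β νx νy ηx ηy t k ξ = damping β νx νy k ξ 0 t :=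
    fun t k ξ => by rw [profileFree, if_neg c1, if_neg c2, if_neg c3]
  have e2 : ∀ t k ξ, profileForced β νx νy ηx ηy t k ξ =
      ∫ s in (0 : ℝ)..t, duhamelKernel β νx νy ηx ηy k ξ t s := fun t k ξ => by
    rw [profileForced, if_neg c1, if_neg c2, if_neg c3]
  obtain ⟨M, hM, hforced⟩ : ∃ M : ℝ, 0 ≤ M ∧ ∀ k : ℤ, k ≠ 0 → ∀ ξ t : ℝ, 0 ≤ t →
      ∫ s in (0 : ℝ)..t, duhamelKernel β νx νy ηx ηy k ξ t s ≤ M * slowDecay β νx νy ηx ηy t := by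
    -- Under `hc`, failure of the two ordered cases forces `νx ≠ ηx`, so one horizontal excess is
    -- positive. Otherwise `β = 0` and `νx = ηx > 0`, and half of the horizontal damping absorbs the
    -- length of the interval.
    by_cases hc : β ≠ 0 ∨ νx ≠ ηx
    · have hx : νx ≠ ηx := by
        intro h
        rcases le_total νy ηy with h' | h'
        · exact c2 ⟨h.le, h', hc⟩
        · exact c3 ⟨h.ge, h', hc⟩
      have b1 : 0 ≤ νy - min ηy νy := sub_nonneg.2 (min_le_right _ _)
      have b2 : 0 ≤ ηy - min ηy νy := sub_nonneg.2 (min_le_left _ _)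
      have b3 : 0 ≤ νx - min ηx νx := sub_nonneg.2 (min_le_right _ _)
      have hr : 0 < dampingRate β (νx - min ηx νx) (νy - min ηy νy) ∨
          0 < dampingRate β (ηx - min ηx νx) (ηy - min ηy νy) := by
        unfold dampingRate
        rcases lt_or_gt_of_ne hx with h | h
        · right
          rw [min_eq_right h.le]
          have := sub_pos.2 h
          positivity
        · left
          rw [min_eq_left h.le]
          have := sub_pos.2 h
          positivity
      have hM := (dampingMass_nonneg (β := β) b3 b1).trans (le_max_left _
        (dampingMass β (ηx - min ηx νx) (ηy - min ηy νy)))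
      refine ⟨_, hM, fun k hk ξ t ht => ?_⟩
      refine (integral_duhamelKernel_le (min_le_right _ _) (min_le_left _ _) (min_le_right _ _)
        (min_le_left _ _) hr hk ξ ht).trans ?_
      rw [mul_comm]
      exact mul_le_mul_of_nonneg_left (damping_le_slowDecay le_rfl le_rfl h0 h0' hk ξ ht) hM
    · push Not at hc
      have hm : 0 < min ηx νx := by
        rw [hc.2, min_self]
        rcases hpos with h | h | h
        · exact absurd hc.1 h
        · rwa [← hc.2]
        · exact h
      exact ⟨2 / min ηx νx, by positivity, fun k hk ξ t ht =>
        (integral_duhamelKernel_le_slowDecay hνx hνy hηx hηy hk ξ ht).2 hm⟩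
  refine ⟨1 + M, by positivity, fun k hk ξ t ht => ?_⟩
  have hf := hfp t
  have hs := hsp t
  have hd := damping_le_slowDecay (β := β) (νx := νx) (νy := νy) (ηx := ηx) (ηy := ηy)
    (min_le_right _ _) (min_le_right _ _) h0 h0' hk ξ ht
  have hI0 := integral_duhamelKernel_nonneg (β := β) (νx := νx) (νy := νy) (ηx := ηx) (ηy := ηy)
      (k := k) ξ ht
  have hfo : |profileForced β νx νy ηx ηy t k ξ| ≤ (1 + M) * slowDecay β νx νy ηx ηy t := by
    rw [e2, abs_of_nonneg hI0]
    nlinarith [hforced k hk ξ t ht]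
  constructor
  · rw [e1, sub_self, abs_zero]; positivity
  · rw [e2, sub_self, abs_zero]; positivity
  · rw [e1, abs_of_pos (damping_pos _ _ _ _ _ _ _)]
    nlinarith [mul_nonneg hM hs.le]
  · refine hfo.trans ?_
    refine mul_le_mul_of_nonneg_right ?_ hs.le
    nlinarith
  · exact fun _ => hfo

end Profile

/-! ### Sobolev norms as weighted sums over frequencies -/

section Weighted

/-- The weighted sum over all frequencies that defines the Sobolev norms. -/
def freqSum (N : ℕ) (e : ℤ → ℝ → ℝ) : ℝ≥0∞ :=
  ∑' k : ℤ, ∫⁻ ξ : ℝ, ENNReal.ofReal ((1 + (k : ℝ) ^ 2 + ξ ^ 2) ^ N) * ENNReal.ofReal (e k ξ)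

variable {N : ℕ} {e e' : ℤ → ℝ → ℝ} {C : ℝ}

theorem freqSum_mono (h : ∀ k, ∀ᵐ ξ, e k ξ ≤ e' k ξ) : freqSum N e ≤ freqSum N e' := by
  refine ENNReal.tsum_le_tsum fun k => lintegral_mono_ae ?_
  filter_upwards [h k] with ξ hξ
  gcongr

theorem freqSum_const_mul (hC : 0 ≤ C) :
    freqSum N (fun k ξ => C * e k ξ) = ENNReal.ofReal C * freqSum N e := by
  rw [freqSum, freqSum, ← ENNReal.tsum_mul_left]
  refine tsum_congr fun k => ?_
  rw [← lintegral_const_mul' _ _ ENNReal.ofReal_ne_top]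
  refine lintegral_congr fun ξ => ?_
  rw [ENNReal.ofReal_mul hC]
  ring

theorem freqSum_le (hC : 0 ≤ C) (h : ∀ k, ∀ᵐ ξ, e k ξ ≤ C * e' k ξ) :
    freqSum N e ≤ ENNReal.ofReal C * freqSum N e' :=
  (freqSum_mono h).trans_eq (freqSum_const_mul hC)

theorem freqSum_add (he : ∀ k ξ, 0 ≤ e k ξ) (he' : ∀ k ξ, 0 ≤ e' k ξ)
    (hm : ∀ k, AEMeasurable (e k)) :
    freqSum N (fun k ξ => e k ξ + e' k ξ) = freqSum N e + freqSum N e' := by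
  rw [freqSum, freqSum, freqSum, ← ENNReal.tsum_add]
  refine tsum_congr fun k => ?_
  rw [← lintegral_add_left']
  · refine lintegral_congr fun ξ => ?_
    rw [ENNReal.ofReal_add (he k ξ) (he' k ξ)]
    ring
  · have : Continuous fun ξ : ℝ => (1 + (k : ℝ) ^ 2 + ξ ^ 2) ^ N := by fun_prop
    exact this.measurable.ennreal_ofReal.aemeasurable.mul (hm k).ennreal_ofReal

theorem freqSum_zero_le (N : ℕ) (e : ℤ → ℝ → ℝ) : freqSum 0 e ≤ freqSum N e := by
  refine ENNReal.tsum_le_tsum fun k => lintegral_mono fun ξ => ?_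
  refine mul_le_mul_left (ENNReal.ofReal_le_ofReal ?_) _
  rw [pow_zero]
  exact one_le_pow₀ (by nlinarith [sq_nonneg (k : ℝ), sq_nonneg ξ])

theorem freqSum_succ (N : ℕ) (e : ℤ → ℝ → ℝ) :
    freqSum (N + 1) e = freqSum N fun k ξ => (1 + (k : ℝ) ^ 2 + ξ ^ 2) * e k ξ := by
  refine tsum_congr fun k => lintegral_congr fun ξ => ?_
  have h : 0 ≤ 1 + (k : ℝ) ^ 2 + ξ ^ 2 := by positivity
  rw [ENNReal.ofReal_mul h, pow_succ, ENNReal.ofReal_mul (pow_nonneg h N), mul_assoc]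

/-- Squaring removes the root, so that norm inequalities become pointwise inequalities between
densities. -/
theorem multNorm_sq (N : ℕ) (m : ℤ → ℝ → ℂ) (f : L2) :
    multNorm N m f ^ 2 = freqSum N fun k ξ => ‖m k ξ * ft f k ξ‖ ^ 2 := by
  rw [multNorm, ← ENNReal.rpow_natCast, ← ENNReal.rpow_mul]
  norm_num only [Nat.cast_ofNat, one_div, ENNReal.rpow_one]
  refine tsum_congr fun k => lintegral_congr fun ξ => ?_
  rw [← ofReal_norm, ENNReal.ofReal_pow (norm_nonneg _)]

theorem sobNorm_sq (N : ℕ) (f : L2) : sobNorm N f ^ 2 = freqSum N fun k ξ => ‖ft f k ξ‖ ^ 2 := by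
  simp only [sobNorm, multNorm_sq, one_mul]

theorem dxNorm_sq (N : ℕ) (f : L2) :
    dxNorm N f ^ 2 = freqSum N fun k ξ => ‖Complex.I * k * ft f k ξ‖ ^ 2 := multNorm_sq N _ f

theorem aemeasurable_norm_sq_ft (f : L2) (k : ℤ) : AEMeasurable fun ξ => ‖ft f k ξ‖ ^ 2 :=
  (aestronglyMeasurable_ft f k).norm.aemeasurable.pow_const 2

theorem sobNorm_le (hC : 0 ≤ C) {f g : L2} (h : ∀ k, ∀ᵐ ξ, ‖ft f k ξ‖ ≤ C * ‖ft g k ξ‖) :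
    sobNorm N f ≤ ENNReal.ofReal C * sobNorm N g := by
  refine (ENNReal.pow_le_pow_left_iff two_ne_zero).1 ?_
  rw [mul_pow, sobNorm_sq, sobNorm_sq, ← ENNReal.ofReal_pow hC]
  refine freqSum_le (sq_nonneg C) fun k => ?_
  filter_upwards [h k] with ξ hξ
  rw [← mul_pow]
  exact pow_le_pow_left₀ (norm_nonneg _) hξ 2

theorem freqSum_le_data {F : ℤ → ℝ → ℂ} {w g : L2}
    (h : ∀ k, ∀ᵐ ξ, ‖F k ξ‖ ≤ C * (‖ft w k ξ‖ + ‖Complex.I * k * ft g k ξ‖)) :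
    freqSum N (fun k ξ => ‖F k ξ‖ ^ 2) ≤
      ENNReal.ofReal (2 * C ^ 2) * (sobNorm N w ^ 2 + dxNorm N g ^ 2) := by
  rw [sobNorm_sq, dxNorm_sq, ← freqSum_add (fun _ _ => sq_nonneg _) (fun _ _ => sq_nonneg _)
    (aemeasurable_norm_sq_ft w)]
  refine freqSum_le (by positivity) fun k => ?_
  filter_upwards [h k] with ξ hξ
  refine (pow_le_pow_left₀ (norm_nonneg _) hξ 2).trans ?_
  nlinarith [mul_nonneg (sq_nonneg C) (sq_nonneg (‖ft w k ξ‖ - ‖Complex.I * k * ft g k ξ‖))]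

theorem sobNorm_le_data (hC : 0 ≤ C) {f w g : L2}
    (h : ∀ k, ∀ᵐ ξ, ‖ft f k ξ‖ ≤ C * (‖ft w k ξ‖ + ‖Complex.I * k * ft g k ξ‖)) :
    sobNorm N f ≤ ENNReal.ofReal (2 * C) * (sobNorm N w + dxNorm N g) := by
  refine (ENNReal.pow_le_pow_left_iff two_ne_zero).1 ?_
  rw [mul_pow, sobNorm_sq, ← ENNReal.ofReal_pow (by positivity)]
  refine (freqSum_le_data h).trans (mul_le_mul' (ENNReal.ofReal_le_ofReal ?_) ?_)
  · nlinarith [sq_nonneg C]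
  · rw [add_sq]
    exact add_le_add_left le_self_add _

theorem memH_iff {f : L2} : MemH N f ↔ freqSum N (fun k ξ => ‖ft f k ξ‖ ^ 2) < ⊤ := by
  rw [MemH, ← sobNorm_sq, ENNReal.pow_lt_top_iff]
  simp

theorem norm_I_mul_intCast_mul_sq (k : ℤ) (z : ℂ) : ‖Complex.I * k * z‖ ^ 2 = (k : ℝ) ^ 2 * ‖z‖ ^ 2 := by
  rw [norm_mul, norm_mul, Complex.norm_I, one_mul, Complex.norm_intCast, mul_pow, sq_abs]

theorem norm_I_mul_shear_mul_sq (x : ℝ) (z : ℂ) : ‖Complex.I * x * z‖ ^ 2 = x ^ 2 * ‖z‖ ^ 2 := by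
  rw [norm_mul, norm_mul, Complex.norm_I, one_mul, Complex.norm_real, mul_pow, Real.norm_eq_abs,
    sq_abs]

theorem dxNorm_lt_top {f : L2} (h : MemH (N + 1) f) : dxNorm N f < ⊤ := by
  have h1 := memH_iff.1 h
  rw [freqSum_succ] at h1
  have : dxNorm N f ^ 2 < ⊤ := by
    rw [dxNorm_sq]
    refine (freqSum_mono fun k => ae_of_all _ fun ξ => ?_).trans_lt h1
    rw [norm_I_mul_intCast_mul_sq]
    exact mul_le_mul_of_nonneg_right (by nlinarith [sq_nonneg ξ]) (sq_nonneg _)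
  simpa [ENNReal.pow_lt_top_iff] using this

/-- The density of the energy at one frequency. -/
def energyDensity (α β t : ℝ) (k : ℤ) (ξ : ℝ) (w g : ℂ) : ℝ :=
  α * ‖w‖ ^ 2 + ((k : ℝ) ^ 2 + (ξ - β * k * t) ^ 2) * ‖g‖ ^ 2

/-- The three norms merge into one density, which is the quantity that the pointwise system
controls. -/
theorem energy_eq {α : ℝ} (hα : 0 ≤ α) (β t : ℝ) (w g : L2) : energy N α β t w g =
    freqSum N fun k ξ => energyDensity α β t k ξ (ft w k ξ) (ft g k ξ) := by
  have h1 : ∀ k : ℤ, ∀ ξ : ℝ, 0 ≤ α * ‖ft w k ξ‖ ^ 2 := fun k ξ => by positivity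
  have h2 : ∀ k : ℤ, ∀ ξ : ℝ, 0 ≤ (k : ℝ) ^ 2 * ‖ft g k ξ‖ ^ 2 := fun k ξ => by positivity
  have h3 : ∀ k : ℤ, ∀ ξ : ℝ, 0 ≤ (ξ - β * k * t) ^ 2 * ‖ft g k ξ‖ ^ 2 := fun k ξ => by positivity
  have e2 : dxNorm N g ^ 2 = freqSum N fun k ξ => (k : ℝ) ^ 2 * ‖ft g k ξ‖ ^ 2 := by
    rw [dxNorm_sq]; simp only [norm_I_mul_intCast_mul_sq]
  have e3 : dyShearNorm N (t * β) g ^ 2 =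
      freqSum N fun k ξ => (ξ - β * k * t) ^ 2 * ‖ft g k ξ‖ ^ 2 := by
    rw [dyShearNorm, multNorm_sq]
    congr 1; ext k ξ
    rw [← norm_I_mul_shear_mul_sq]
    congr 4
    push_cast; ring
  rw [energy, e2, e3, sobNorm_sq, ← freqSum_const_mul hα, ← freqSum_add h1 h2
    fun k => (aemeasurable_norm_sq_ft w k).const_mul α, ← freqSum_add
      (fun k ξ => add_nonneg (h1 k ξ) (h2 k ξ)) h3 fun k =>
        ((aemeasurable_norm_sq_ft w k).const_mul α).add ((aemeasurable_norm_sq_ft g k).const_mul _)]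
  congr 1; ext k ξ
  rw [energyDensity]; ring

theorem energy_lt_top {α β : ℝ} (hα : 0 ≤ α) {w g : L2} (hw : MemH N w) (hg : MemH (N + 1) g) :
    energy N α β 0 w g < ⊤ := by
  rw [energy_eq hα]
  have h1 : freqSum N (fun k ξ => α * ‖ft w k ξ‖ ^ 2) < ⊤ := by
    rw [freqSum_const_mul hα]
    exact ENNReal.mul_lt_top ENNReal.ofReal_lt_top (memH_iff.1 hw)
  have h2 := memH_iff.1 hg
  rw [freqSum_succ] at h2
  refine lt_of_le_of_lt (freqSum_mono fun k => ae_of_all _ fun ξ => ?_)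
    ((freqSum_add (N := N) (fun k ξ => mul_nonneg hα (sq_nonneg ‖ft w k ξ‖))
      (fun k ξ => mul_nonneg (by positivity : (0 : ℝ) ≤ 1 + (k : ℝ) ^ 2 + ξ ^ 2) (sq_nonneg ‖ft g k ξ‖))
      fun k => (aemeasurable_norm_sq_ft w k).const_mul α).trans_lt (ENNReal.add_lt_top.2 ⟨h1, h2⟩))
  rw [energyDensity, mul_zero, sub_zero]
  nlinarith [sq_nonneg ‖ft g k ξ‖]

end Weighted

/-! ### Temperature and vorticity for `α = 0` -/

section NoStratification

variable {β νx νy ηx ηy : ℝ} {N : ℕ} {ω θ : ℝ → L2}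

theorem sobNorm_nonAverage_temperature_le (hηx : 0 ≤ ηx) (hηy : 0 ≤ ηy)
    (hsol : IsSolution 0 β νx νy ηx ηy ω θ) {t : ℝ} (ht : 0 ≤ t) :
    sobNorm N (nonAverage (comoving β t (θ t))) ≤
      ENNReal.ofReal (Real.exp (-ηx * t - ηy * (β ^ 2 * t ^ 3 / 12))) * sobNorm N (θ 0) := by
  refine sobNorm_le (Real.exp_pos _).le fun k => ?_
  obtain ⟨W, Θ, hs, -, hΘ, h⟩ := freq_representation hsol k
  filter_upwards [ft_nonAverage (comoving β t (θ t)) k, h t ht] with ξ h1 h2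
  rw [h1]
  split_ifs with hk
  · rw [norm_zero]; positivity
  · rw [h2.2, (hs ξ).temperature_eq t, hΘ, norm_mul, Complex.norm_real,
      Real.norm_of_nonneg (damping_pos _ _ _ _ _ _ _).le]
    refine mul_le_mul_of_nonneg_right ((damping_le hηx hηy hk ht).trans_eq ?_) (norm_nonneg _)
    congr 1; ring

/-- The coefficients are measurable in `ξ` and bounded uniformly in the frequency, so the prescribed
transform is square integrable and comes from an `L²` function. -/
theorem exists_profile {C : ℝ} (hC : 0 ≤ C)
    (hb : ∀ k : ℤ, k ≠ 0 → ∀ ξ t : ℝ, 0 ≤ t → ProfileBound β νx νy ηx ηy C k ξ t)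
    {w g : L2} (hw : MemH N w) (hg : MemH (N + 1) g) {t : ℝ} (ht : 0 ≤ t) :
    ∃ p : L2, IsProfile β νx νy ηx ηy w g t p := by
  have hs := slowDecay_pos (β := β) (νx := νx) (νy := νy) (ηx := ηx) (ηy := ηy) t
  refine exists_ft_eq (g := profileFt β νx νy ηx ηy w g t) (fun k => ?_) ?_
  · by_cases hk : k = 0
    · subst hk
      have e : profileFt β νx νy ηx ηy w g t 0 = fun _ => 0 := funext (profileFt_zero_freq w g t)
      rw [e]
      exact aestronglyMeasurable_const
    · have e : profileFt β νx νy ηx ηy w g t k = fun ξ =>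
          profileFree β νx νy ηx ηy t k ξ * ft w k ξ +
            profileForced β νx νy ηx ηy t k ξ * (Complex.I * k * ft g k ξ) :=
        funext (profileFt_eq hk w g t)
      rw [e]
      refine AEStronglyMeasurable.add ?_ ?_
      · exact (Complex.measurable_ofReal.comp
          (measurable_profileFree _ _ _ _ _ _ _)).aestronglyMeasurable.mul
          (aestronglyMeasurable_ft w k)
      · exact (Complex.measurable_ofReal.comp
          (measurable_profileForced _ _ _ _ _ _ _)).aestronglyMeasurable.mul
          ((aestronglyMeasurable_ft g k).const_mul _)
  · have hb' : ∀ k, ∀ᵐ ξ, ‖profileFt β νx νy ηx ηy w g t k ξ‖ ≤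
        (C * (1 + t) * slowDecay β νx νy ηx ηy t) *
          (‖ft w k ξ‖ + ‖Complex.I * k * ft g k ξ‖) := fun k => ae_of_all _ fun ξ => by
      by_cases hk : k = 0
      · subst hk
        rw [profileFt_zero_freq, norm_zero]; positivity
      · rw [profileFt_eq hk, mul_add]
        refine (norm_add_le _ _).trans (add_le_add ?_ ?_)
        · rw [norm_mul, Complex.norm_real]
          refine mul_le_mul_of_nonneg_right ((hb k hk ξ t ht).free.trans ?_) (norm_nonneg _)
          exact mul_le_mul_of_nonneg_right (by nlinarith) hs.le
        · rw [norm_mul, Complex.norm_real]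
          exact mul_le_mul_of_nonneg_right (hb k hk ξ t ht).forced (norm_nonneg _)
    have h := (freqSum_zero_le N _).trans (freqSum_le_data (N := N) hb')
    refine lt_of_eq_of_lt ?_ (h.trans_lt (ENNReal.mul_lt_top ENNReal.ofReal_lt_top
      (ENNReal.add_lt_top.2 ⟨ENNReal.pow_lt_top hw, ENNReal.pow_lt_top (dxNorm_lt_top hg)⟩)))
    refine tsum_congr fun k => lintegral_congr fun ξ => ?_
    rw [pow_zero, ENNReal.ofReal_one, one_mul, ← ofReal_norm, ENNReal.ofReal_pow (norm_nonneg _)]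

theorem norm_add_mul_le {a b A : ℝ} (z w : ℂ) (ha : |a| ≤ A) (hb : |b| ≤ A) :
    ‖(a : ℂ) * z + b * w‖ ≤ A * (‖z‖ + ‖w‖) := by
  refine (norm_add_le _ _).trans ?_
  rw [norm_mul, norm_mul, Complex.norm_real, Complex.norm_real, mul_add]
  exact add_le_add (mul_le_mul_of_nonneg_right ha (norm_nonneg _))
    (mul_le_mul_of_nonneg_right hb (norm_nonneg _))

theorem vorticity_profile (hνx : 0 ≤ νx) (hνy : 0 ≤ νy) (hηx : 0 ≤ ηx) (hηy : 0 ≤ ηy)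
    (hpos : β ≠ 0 ∨ 0 < νx ∨ 0 < ηx) :
    ∃ C : ℝ, ∀ (N : ℕ) (ω θ : ℝ → L2), IsSolution 0 β νx νy ηx ηy ω θ →
      MemH N (ω 0) → MemH (N + 1) (θ 0) →
      ∃ ω₁ : ℝ → L2, ∀ t : ℝ, 0 ≤ t →
        IsProfile β νx νy ηx ηy (ω 0) (θ 0) t (ω₁ t) ∧
        sobNorm N (nonAverage (comoving β t (ω t)) - ω₁ t) ≤
          ENNReal.ofReal (C * fastDecay β νx νy ηx ηy t) * (sobNorm N (ω 0) + dxNorm N (θ 0)) ∧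
        sobNorm N (ω₁ t) ≤
          ENNReal.ofReal (C * (1 + t) * slowDecay β νx νy ηx ηy t) *
            (sobNorm N (ω 0) + dxNorm N (θ 0)) ∧
        (¬ (νx = 0 ∧ ηx = 0 ∧ νy = ηy) → sobNorm N (ω₁ t) ≤
          ENNReal.ofReal (C * slowDecay β νx νy ηx ηy t) *
            (sobNorm N (ω 0) + dxNorm N (θ 0))) := by
  obtain ⟨C, hC, hb⟩ := exists_profileBound hνx hνy hηx hηy hpos
  -- The factor `2` is lost in `sobNorm_le_data`, when the square of a sum of two data terms is
  -- split.
  refine ⟨2 * C, fun N ω θ hsol hω hθ => ?_⟩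
  -- The profile is taken to be `0` at negative times, which play no role.
  have hex : ∀ t : ℝ, ∃ p : L2, 0 ≤ t → IsProfile β νx νy ηx ηy (ω 0) (θ 0) t p := fun t => by
    by_cases ht : 0 ≤ t
    · exact (exists_profile hC hb hω hθ ht).imp fun _ h _ => h
    · exact ⟨0, fun h => absurd h ht⟩
  choose ω₁ hω₁ using hex
  refine ⟨ω₁, fun t ht => ?_⟩
  have hf := fastDecay_pos (β := β) (νx := νx) (νy := νy) (ηx := ηx) (ηy := ηy) t
  have hs := slowDecay_pos (β := β) (νx := νx) (νy := νy) (ηx := ηx) (ηy := ηy) t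
  have hslow : ∀ A : ℝ, 0 ≤ A → C ≤ A → (∀ k : ℤ, k ≠ 0 → ∀ ξ : ℝ,
      |profileForced β νx νy ηx ηy t k ξ| ≤ A * slowDecay β νx νy ηx ηy t) →
      sobNorm N (ω₁ t) ≤ ENNReal.ofReal (2 * (A * slowDecay β νx νy ηx ηy t)) *
        (sobNorm N (ω 0) + dxNorm N (θ 0)) := fun A hA hCA hforced => by
    refine sobNorm_le_data (by positivity) fun k => ?_
    filter_upwards [hω₁ t ht k] with ξ h1
    rw [h1]
    by_cases hk : k = 0
    · subst hk
      rw [profileFt_zero_freq, norm_zero]; positivity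
    · rw [profileFt_eq hk]
      exact norm_add_mul_le _ _ ((hb k hk ξ t ht).free.trans
        (mul_le_mul_of_nonneg_right hCA hs.le)) (hforced k hk ξ)
  refine ⟨hω₁ t ht, ?_, ?_, fun hne => ?_⟩
  · rw [mul_assoc]
    refine sobNorm_le_data (by positivity) fun k => ?_
    obtain ⟨W, Θ, hsys, hW, hΘ, h⟩ := freq_representation hsol k
    filter_upwards [ft_sub (nonAverage (comoving β t (ω t))) (ω₁ t) k,
      ft_nonAverage (comoving β t (ω t)) k, h t ht, hω₁ t ht k] with ξ h1 h2 h3 h4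
    rw [h1, h2, h4]
    by_cases hk : k = 0
    · subst hk
      rw [profileFt_zero_freq, if_pos rfl, sub_zero, norm_zero]; positivity
    · rw [if_neg hk, h3.1, (hsys ξ).vorticity_eq t, hW, hΘ, profileFt_eq hk]
      have e : ∀ a b c d z w : ℂ, a * z + b * w - (c * z + d * w) = (a - c) * z + (b - d) * w :=
        fun _ _ _ _ _ _ => by ring
      rw [e, ← Complex.ofReal_sub, ← Complex.ofReal_sub]
      exact norm_add_mul_le _ _ (hb k hk ξ t ht).free_sub (hb k hk ξ t ht).forced_sub
  · have := hslow (C * (1 + t)) (by positivity) (by nlinarith) fun k hk ξ => (hb k hk ξ t ht).forced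
    rwa [← mul_assoc, ← mul_assoc] at this
  · have := hslow C hC le_rfl fun k hk ξ => (hb k hk ξ t ht).forced_of_not hne
    rwa [← mul_assoc] at this

end NoStratification

/-! ### Energy estimates for `α > 0` -/

section Energy

variable {α β νx νy ηx ηy : ℝ} {k : ℤ} {ξ : ℝ} {w θ : ℝ → ℂ}

theorem hasDerivAt_norm_sq_complex {f : ℝ → ℂ} {f' : ℂ} {t : ℝ} (h : HasDerivAt f f' t) :
    HasDerivAt (fun s => ‖f s‖ ^ 2) (2 * ((f t).re * f'.re + (f t).im * f'.im)) t := by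
  refine h.norm_sq.congr_deriv ?_
  rw [Complex.inner, Complex.mul_re, Complex.conj_re, Complex.conj_im]
  ring

theorem norm_sq_eq_re_im (z : ℂ) : ‖z‖ ^ 2 = z.re ^ 2 + z.im ^ 2 := by
  rw [Complex.sq_norm, Complex.normSq_apply]; ring

theorem hasDerivAt_shear (β : ℝ) (k : ℤ) (ξ t : ℝ) :
    HasDerivAt (fun s : ℝ => ξ - β * k * s) (-(β * k)) t := by
  simpa using ((hasDerivAt_id t).const_mul (β * (k : ℝ))).const_sub ξ

theorem hasDerivAt_laplaceSymbol (β : ℝ) (k : ℤ) (ξ t : ℝ) :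
    HasDerivAt (fun s : ℝ => (k : ℝ) ^ 2 + (ξ - β * k * s) ^ 2)
      (-2 * (β * k) * (ξ - β * k * t)) t := by
  refine (((hasDerivAt_shear β k ξ t).pow 2).const_add ((k : ℝ) ^ 2)).congr_deriv ?_
  norm_num
  ring

/-- The weight `k² + (ξ - βkt)²` on `θ` cancels the denominator of the coupling, and the factor `α`
on `w` then makes the two coupling terms opposite. Dissipation and the derivative of the weight
remain. -/
theorem FreqSystem.hasDerivAt_energyDensity (h : FreqSystem α β νx νy ηx ηy k ξ w θ) (t : ℝ) :
    HasDerivAt (fun s => energyDensity α β s k ξ (w s) (θ s))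
      (-2 * α * (νx * k ^ 2 + νy * (ξ - β * k * t) ^ 2) * ‖w t‖ ^ 2
        + (-2 * (β * k) * (ξ - β * k * t) - 2 * (ηx * k ^ 2 + ηy * (ξ - β * k * t) ^ 2) *
          (k ^ 2 + (ξ - β * k * t) ^ 2)) * ‖θ t‖ ^ 2) t := by
  have h1 := hasDerivAt_norm_sq_complex (h.vorticity t)
  have h2 := hasDerivAt_norm_sq_complex (h.temperature t)
  refine ((h1.const_mul α).add ((hasDerivAt_laplaceSymbol β k ξ t).mul h2)).congr_deriv ?_
  simp only [norm_sq_eq_re_im]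
  generalize ξ - β * k * t = z
  -- For `k = 0` the weight may vanish, but then both sides are `0`.
  have hL : (k : ℝ) / (k ^ 2 + z ^ 2) * (k ^ 2 + z ^ 2) = k := by
    by_cases hk : (k : ℝ) = 0
    · rw [hk]; simp
    · have : (k : ℝ) ^ 2 + z ^ 2 ≠ 0 := by positivity
      field_simp
  have e : (α * (Complex.I * k) / (((k : ℝ) ^ 2 + z ^ 2 : ℝ) : ℂ)) =
      ((α * ((k : ℝ) / (k ^ 2 + z ^ 2)) : ℝ) : ℂ) * Complex.I := by
    push_cast; ring
  rw [e]
  generalize (k : ℝ) / (k ^ 2 + z ^ 2) = q at hL ⊢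
  generalize νx * (k : ℝ) ^ 2 + νy * z ^ 2 = P
  generalize ηx * (k : ℝ) ^ 2 + ηy * z ^ 2 = R
  simp
  linear_combination (2 * α * ((θ t).im * (w t).re - (θ t).re * (w t).im)) * hL

theorem energyDensity_nonneg (hα : 0 ≤ α) (t : ℝ) (a b : ℂ) :
    0 ≤ energyDensity α β t k ξ a b := by
  unfold energyDensity; positivity

theorem le_of_deriv_nonpos {f f' : ℝ → ℝ} {a b : ℝ} (hab : a ≤ b)
    (hf : ∀ s, HasDerivAt f (f' s) s) (h : ∀ s ∈ Ioo a b, f' s ≤ 0) : f b ≤ f a := by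
  refine antitoneOn_of_deriv_nonpos (convex_Icc a b)
    (fun s _ => (hf s).continuousAt.continuousWithinAt)
    (fun s _ => (hf s).differentiableAt.differentiableWithinAt) (fun s hs => ?_)
    (left_mem_Icc.2 hab) (right_mem_Icc.2 hab) hab
  rw [interior_Icc] at hs
  rw [(hf s).deriv]
  exact h s hs

/-- The squared damping up to the final time `b` is the integrating factor. -/
theorem damped_le_of_deriv_le {f f' : ℝ → ℝ} {a b c d : ℝ} (hab : a ≤ b)
    (hf : ∀ s, HasDerivAt f (f' s) s)
    (h : ∀ s ∈ Ioo a b, f' s + 2 * (c * k ^ 2 + d * (ξ - β * k * s) ^ 2) * f s ≤ 0) :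
    f b ≤ damping β c d k ξ a b ^ 2 * f a := by
  have h1 : ∀ s, HasDerivAt (fun s => damping β c d k ξ s b ^ 2 * f s)
      (damping β c d k ξ s b ^ 2 * (f' s + 2 * (c * k ^ 2 + d * (ξ - β * k * s) ^ 2) * f s)) s :=
    fun s => by
      refine (((hasDerivAt_damping_left β c d k ξ s b).pow 2).mul (hf s)).congr_deriv ?_
      simp only [Pi.pow_apply]
      push_cast; ring
  have h2 := le_of_deriv_nonpos hab h1 fun s hs =>
    mul_nonpos_of_nonneg_of_nonpos (sq_nonneg _) (h s hs)
  simpa [damping_self] using h2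

/-- The sign condition says that the weight is not increasing, so its derivative can be dropped and
the smaller diffusivities give the damping. -/
theorem FreqSystem.energyDensity_le_of_decreasing (h : FreqSystem α β νx νy ηx ηy k ξ w θ)
    (hα : 0 ≤ α) {c d : ℝ} (hcν : c ≤ νx) (hcη : c ≤ ηx) (hdν : d ≤ νy) (hdη : d ≤ ηy) {a b : ℝ}
    (hab : a ≤ b) (hz : ∀ s ∈ Ioo a b, 0 ≤ β * k * (ξ - β * k * s)) :
    energyDensity α β b k ξ (w b) (θ b) ≤
      damping β c d k ξ a b ^ 2 * energyDensity α β a k ξ (w a) (θ a) := by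
  refine damped_le_of_deriv_le hab h.hasDerivAt_energyDensity fun s hs => ?_
  have h0 := hz s hs
  rw [energyDensity]
  set z := ξ - β * k * s
  have h1 : 0 ≤ α * ‖w s‖ ^ 2 * ((νx - c) * k ^ 2 + (νy - d) * z ^ 2) := by
    have := sub_nonneg.2 hcν; have := sub_nonneg.2 hdν; positivity
  have h2 : 0 ≤ ‖θ s‖ ^ 2 * (k ^ 2 + z ^ 2) * ((ηx - c) * k ^ 2 + (ηy - d) * z ^ 2) := by
    have := sub_nonneg.2 hcη; have := sub_nonneg.2 hdη; positivity
  have h3 : 0 ≤ ‖θ s‖ ^ 2 * (β * k * z) := by positivity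
  linarith

/-- Dividing by the weight leaves `|θ|²` without a factor and puts `1 / (k² + (ξ - βks)²)` on the
vorticity. Under the reversed sign condition this factor does not increase, so the quotient is
damped. -/
theorem FreqSystem.energyDensity_le_of_increasing (h : FreqSystem α β νx νy ηx ηy k ξ w θ)
    (hk : k ≠ 0) (hα : 0 ≤ α) {c d : ℝ} (hcν : c ≤ νx) (hcη : c ≤ ηx) (hdν : d ≤ νy) (hdη : d ≤ ηy)
    {a b : ℝ} (hab : a ≤ b) (hz : ∀ s ∈ Ioo a b, β * k * (ξ - β * k * s) ≤ 0) :
    energyDensity α β b k ξ (w b) (θ b) / (k ^ 2 + (ξ - β * k * b) ^ 2) ≤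
      damping β c d k ξ a b ^ 2 *
        (energyDensity α β a k ξ (w a) (θ a) / (k ^ 2 + (ξ - β * k * a) ^ 2)) := by
  have hk' : (k : ℝ) ≠ 0 := Int.cast_ne_zero.2 hk
  have hL : ∀ s, (k : ℝ) ^ 2 + (ξ - β * k * s) ^ 2 ≠ 0 := fun s => by positivity
  have hd : ∀ s, HasDerivAt (fun s => energyDensity α β s k ξ (w s) (θ s) /
      (k ^ 2 + (ξ - β * k * s) ^ 2)) _ s := fun s =>
    (h.hasDerivAt_energyDensity s).div (hasDerivAt_laplaceSymbol β k ξ s) (hL s)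
  refine damped_le_of_deriv_le hab hd fun s hs => ?_
  have h0 := hz s hs
  have hLs := hL s
  simp only [energyDensity]
  set z := ξ - β * k * s
  have hLpos : 0 < (k : ℝ) ^ 2 + z ^ 2 := by positivity
  have h1 : 0 ≤ α * ‖w s‖ ^ 2 * ((νx - c) * k ^ 2 + (νy - d) * z ^ 2) * (k ^ 2 + z ^ 2) := by
    have := sub_nonneg.2 hcν; have := sub_nonneg.2 hdν; positivity
  have h2 : 0 ≤ ‖θ s‖ ^ 2 * (k ^ 2 + z ^ 2) ^ 2 * ((ηx - c) * k ^ 2 + (ηy - d) * z ^ 2) := by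
    have := sub_nonneg.2 hcη; have := sub_nonneg.2 hdη; positivity
  have h3 : α * ‖w s‖ ^ 2 * (β * k * z) ≤ 0 := mul_nonpos_of_nonneg_of_nonpos (by positivity) h0
  have e : ∀ A B D F L : ℝ, L ≠ 0 → (A * L - B * D) / L ^ 2 + F * (B / L) =
      (A * L - B * D + F * B * L) / L ^ 2 := fun A B D F L hL => by field_simp
  rw [e _ _ _ _ _ hLpos.ne']
  refine div_nonpos_of_nonpos_of_nonneg ?_ (sq_nonneg _)
  linarith

/-- The weight is monotone on either side of the critical time `ξ / (βk)`. The two preceding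
estimates are chained there, the dampings multiply to the one over `[0, t]`, and the only loss is
the ratio of the weights at the end and at the splitting time. -/
theorem FreqSystem.energyDensity_le_enhanced (h : FreqSystem α β νx νy ηx ηy k ξ w θ)
    (hk : k ≠ 0) (hβ : β ≠ 0) (hα : 0 ≤ α) (hνx : 0 ≤ νx) (hνy : 0 ≤ νy) (hηx : 0 ≤ ηx)
    (hηy : 0 ≤ ηy) {t : ℝ} (ht : 0 ≤ t) :
    energyDensity α β t k ξ (w t) (θ t) ≤ (2 * (1 + β ^ 2)) * (1 + t ^ 2) *
      Real.exp (-(min νy ηy) * (β ^ 2 * t ^ 3 / 12) - min ηx νx * t) *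
        energyDensity α β 0 k ξ (w 0) (θ 0) := by
  have hk' : (k : ℝ) ≠ 0 := Int.cast_ne_zero.2 hk
  have hL : ∀ s, 0 < (k : ℝ) ^ 2 + (ξ - β * k * s) ^ 2 := fun s => by positivity
  set c := min ηx νx
  set d := min νy ηy
  have hc : 0 ≤ c := le_min hηx hνx
  have hd : 0 ≤ d := le_min hνy hηy
  -- The critical time clamped to `[0, t]`; if it lies outside, one of the two phases is empty.
  set u := max 0 (min t (ξ / (β * k))) with hu
  have hu0 : 0 ≤ u := le_max_left _ _
  have hut : u ≤ t := max_le ht (min_le_left _ _)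
  have hz : ∀ s, β * k * (ξ - β * k * s) = (β * k) ^ 2 * (ξ / (β * k) - s) := fun s => by
    field_simp
  have h1 := h.energyDensity_le_of_decreasing hα (min_le_right _ _ : c ≤ νx) (min_le_left _ _)
    (min_le_left _ _ : d ≤ νy) (min_le_right _ _) hu0 fun s hs => by
      rw [hz]
      have : s ≤ ξ / (β * k) := by
        rcases lt_max_iff.1 hs.2 with h' | h'
        · exact absurd hs.1 (not_lt.2 h'.le)
        · exact h'.le.trans (min_le_right _ _)
      have := sub_nonneg.2 this
      positivity
  have h2 := h.energyDensity_le_of_increasing hk hα (min_le_right _ _ : c ≤ νx) (min_le_left _ _)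
    (min_le_left _ _ : d ≤ νy) (min_le_right _ _) hut fun s hs => by
      rw [hz]
      have : ξ / (β * k) ≤ s := by
        have h' := (le_max_right 0 (min t (ξ / (β * k)))).trans hs.1.le
        exact (min_le_iff.1 h').resolve_left (not_le.2 hs.2)
      exact mul_nonpos_of_nonneg_of_nonpos (sq_nonneg _) (sub_nonpos.2 this)
  have hE0 := energyDensity_nonneg (β := β) (k := k) (ξ := ξ) hα 0 (w 0) (θ 0)
  -- Between `u` and `t` the shifted frequency moves by at most `|βk| t`, which gives the growth
  -- factor `1 + t²`.
  have hratio : (k : ℝ) ^ 2 + (ξ - β * k * t) ^ 2 ≤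
      2 * (1 + β ^ 2) * (1 + t ^ 2) * (k ^ 2 + (ξ - β * k * u) ^ 2) := by
    have e : ξ - β * k * t = (ξ - β * k * u) - β * k * (t - u) := by ring
    rw [e]
    set z := ξ - β * k * u
    have h3 : (t - u) ^ 2 ≤ t ^ 2 := pow_le_pow_left₀ (sub_nonneg.2 hut) (by linarith) 2
    have h4 := mul_le_mul_of_nonneg_left h3 (mul_nonneg (sq_nonneg β) (sq_nonneg (k : ℝ)))
    have h5 : (z - β * k * (t - u)) ^ 2 ≤ 2 * z ^ 2 + 2 * (β ^ 2 * k ^ 2 * (t - u) ^ 2) := by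
      nlinarith [sq_nonneg (z + β * k * (t - u))]
    have h6 : 0 ≤ (k : ℝ) ^ 2 + 2 * (β ^ 2 + t ^ 2) * k ^ 2 +
      2 * ((β ^ 2 + t ^ 2 + β ^ 2 * t ^ 2) * z ^ 2) := by positivity
    nlinarith
  rw [div_le_iff₀ (hL t)] at h2
  -- Since the damping is at most `1`, its square is simply bounded by the damping itself.
  have hD : damping β c d k ξ 0 t ^ 2 ≤
      Real.exp (-d * (β ^ 2 * t ^ 3 / 12) - c * t) := by
    have h3 := damping_le (β := β) (ξ := ξ) hc hd hk ht
    rw [sub_zero] at h3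
    have h4 := damping_le_one (β := β) (ξ := ξ) (k := k) hc hd ht
    nlinarith [damping_pos β c d k ξ 0 t]
  calc _ ≤ _ := h2
    _ ≤ damping β c d k ξ u t ^ 2 *
        (damping β c d k ξ 0 u ^ 2 * energyDensity α β 0 k ξ (w 0) (θ 0) /
          (k ^ 2 + (ξ - β * k * u) ^ 2)) *
        (2 * (1 + β ^ 2) * (1 + t ^ 2) * (k ^ 2 + (ξ - β * k * u) ^ 2)) := by
        have := (hL u).le
        gcongr
    _ = 2 * (1 + β ^ 2) * (1 + t ^ 2) * (damping β c d k ξ 0 u * damping β c d k ξ u t) ^ 2 *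
        energyDensity α β 0 k ξ (w 0) (θ 0) := by
        have := (hL u).ne'
        field_simp
    _ ≤ _ := by
        rw [damping_mul]
        gcongr

theorem FreqSystem.energyDensity_antitone_of_zero (h : FreqSystem α β νx νy ηx ηy 0 ξ w θ)
    (hα : 0 ≤ α) (hνx : 0 ≤ νx) (hνy : 0 ≤ νy) (hηx : 0 ≤ ηx) (hηy : 0 ≤ ηy) {t : ℝ} (ht : 0 ≤ t) :
    energyDensity α β t 0 ξ (w t) (θ t) ≤ energyDensity α β 0 0 ξ (w 0) (θ 0) := by
  have := h.energyDensity_le_of_decreasing hα hνx hηx hνy hηy ht fun s _ => by simp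
  simpa [damping_zero_zero] using this

/-- Thermal diffusion absorbs the growth of the weight up to the term `β² / (2η) |θ|²`. Relative to
the energy this is at most `β² / (2η) / (k² + (ξ - βkt)²)`, whose time integral is bounded uniformly
in the frequency. It is compensated by the bounded weight `exp H`. -/
theorem FreqSystem.energyDensity_le_bounded (h : FreqSystem α β νx νy ηx ηy k ξ w θ)
    (hk : k ≠ 0) (hα : 0 ≤ α) (hνx : 0 ≤ νx) (hνy : 0 ≤ νy) (hηx : 0 ≤ ηx) (hηy : 0 ≤ ηy) {η : ℝ}
    (hη : 0 < η) (hη' : η ≤ ηx ∨ η ≤ ηy) {t : ℝ} (ht : 0 ≤ t) :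
    energyDensity α β t k ξ (w t) (θ t) ≤
      Real.exp (π * |β| / (2 * η)) * energyDensity α β 0 k ξ (w 0) (θ 0) := by
  have hk' : (k : ℝ) ≠ 0 := Int.cast_ne_zero.2 hk
  have hL : ∀ s, 0 < (k : ℝ) ^ 2 + (ξ - β * k * s) ^ 2 := fun s => by positivity
  -- Chosen so that `H'` is minus the integrable growth rate; the arctangent keeps `H` bounded for
  -- all times.
  set H : ℝ → ℝ := fun s => β / (2 * η * k ^ 2) * Real.arctan ((ξ - β * k * s) / k) with hH
  have hHd : ∀ s, HasDerivAt H (-(β ^ 2 / (2 * η) / (k ^ 2 + (ξ - β * k * s) ^ 2))) s := fun s => by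
    refine ((((hasDerivAt_shear β k ξ s).div_const (k : ℝ)).arctan).const_mul
      (β / (2 * η * k ^ 2))).congr_deriv ?_
    have h1 := (hL s).ne'
    have h2 : 1 + ((ξ - β * k * s) / k) ^ 2 = (k ^ 2 + (ξ - β * k * s) ^ 2) / k ^ 2 := by
      field_simp
    rw [h2]
    field_simp
  have hd : ∀ s, HasDerivAt (fun s => Real.exp (H s) * energyDensity α β s k ξ (w s) (θ s))
      (Real.exp (H s) * (-(β ^ 2 / (2 * η) / (k ^ 2 + (ξ - β * k * s) ^ 2)) *
        energyDensity α β s k ξ (w s) (θ s) +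
        (-2 * α * (νx * k ^ 2 + νy * (ξ - β * k * s) ^ 2) * ‖w s‖ ^ 2
        + (-2 * (β * k) * (ξ - β * k * s) - 2 * (ηx * k ^ 2 + ηy * (ξ - β * k * s) ^ 2) *
          (k ^ 2 + (ξ - β * k * s) ^ 2)) * ‖θ s‖ ^ 2))) s := fun s => by
    refine ((hHd s).exp.mul (h.hasDerivAt_energyDensity s)).congr_deriv ?_
    ring
  have hle := le_of_deriv_nonpos ht hd fun s _ => by
    refine mul_nonpos_of_nonneg_of_nonpos (Real.exp_pos _).le ?_
    have hLs := hL s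
    simp only [energyDensity]
    set z := ξ - β * k * s
    set L := (k : ℝ) ^ 2 + z ^ 2 with hLdef
    have h1 : 0 ≤ α * (νx * k ^ 2 + νy * z ^ 2) * ‖w s‖ ^ 2 := by positivity
    have h2 : 0 ≤ β ^ 2 / (2 * η) / L * (α * ‖w s‖ ^ 2) := by positivity
    have h3 : β ^ 2 / (2 * η) / L * (L * ‖θ s‖ ^ 2) = β ^ 2 / (2 * η) * ‖θ s‖ ^ 2 := by
      field_simp
    -- The mixed product `k² z²` occurs with either of the two thermal diffusivities, so one
    -- positive coefficient suffices.
    have h4 : η * (k ^ 2 * z ^ 2) ≤ (ηx * k ^ 2 + ηy * z ^ 2) * L := by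
      have a1 : 0 ≤ ηx * (k ^ 2 * k ^ 2) := by positivity
      have a2 : 0 ≤ ηy * (z ^ 2 * z ^ 2) := by positivity
      have a3 : 0 ≤ (k : ℝ) ^ 2 * z ^ 2 := by positivity
      rw [hLdef]
      rcases hη' with h' | h'
      · nlinarith [mul_le_mul_of_nonneg_right h' a3, mul_nonneg hηy a3]
      · nlinarith [mul_le_mul_of_nonneg_right h' a3, mul_nonneg hηx a3]
    -- Completing the square: the growth term is split between the dissipation and the constant that
    -- `H` pays for.
    have h5 : -2 * (β * k) * z ≤ 2 * (η * (k ^ 2 * z ^ 2)) + β ^ 2 / (2 * η) := by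
      have : 0 ≤ (2 * η * (k * z) + β) ^ 2 / (2 * η) := by positivity
      have e : (2 * η * (k * z) + β) ^ 2 / (2 * η) =
        2 * (η * (k ^ 2 * z ^ 2)) + β ^ 2 / (2 * η) + 2 * (β * k) * z := by field_simp; ring
      linarith
    have h6 := mul_nonneg (sub_nonneg.2 (h5.trans (add_le_add_left
      (mul_le_mul_of_nonneg_left h4 zero_le_two) _))) (sq_nonneg ‖θ s‖)
    linarith
  have hπ : ∀ x, |Real.arctan x| ≤ π / 2 := fun x =>
    abs_le.2 ⟨(Real.neg_pi_div_two_lt_arctan x).le, (Real.arctan_lt_pi_div_two x).le⟩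
  have hHb : ∀ s, |H s| ≤ π * |β| / (4 * η) := fun s => by
    have h1 := one_le_sq_of_ne_zero hk
    rw [hH, abs_mul, abs_div, abs_of_pos (by positivity : 0 < 2 * η * (k : ℝ) ^ 2)]
    calc |β| / (2 * η * k ^ 2) * |Real.arctan ((ξ - β * k * s) / k)|
        ≤ |β| / (2 * η * 1) * (π / 2) := by
          gcongr
          exact hπ _
      _ = _ := by field_simp; ring
  have hE0 := energyDensity_nonneg (β := β) (k := k) (ξ := ξ) hα 0 (w 0) (θ 0)
  calc energyDensity α β t k ξ (w t) (θ t)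
      = Real.exp (-H t) * (Real.exp (H t) * energyDensity α β t k ξ (w t) (θ t)) := by
        rw [← mul_assoc, ← Real.exp_add]; simp
    _ ≤ Real.exp (-H t) * (Real.exp (H 0) * energyDensity α β 0 k ξ (w 0) (θ 0)) := by gcongr
    _ = Real.exp (-H t + H 0) * energyDensity α β 0 k ξ (w 0) (θ 0) := by
        rw [← mul_assoc, ← Real.exp_add]
    _ ≤ _ := by
        gcongr
        have h1 := (abs_le.1 (hHb t)).1
        have h2 := (abs_le.1 (hHb 0)).2
        have : π * |β| / (2 * η) = π * |β| / (4 * η) + π * |β| / (4 * η) := by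
          field_simp; ring
        linarith

theorem energy_bounded (hνx : 0 ≤ νx) (hνy : 0 ≤ νy) (hηx : 0 ≤ ηx) (hηy : 0 ≤ ηy)
    (hpos : 0 < ηx ∨ 0 < ηy) :
    ∃ C : ℝ, ∀ α : ℝ, 0 < α → ∀ (N : ℕ) (ω θ : ℝ → L2), IsSolution α β νx νy ηx ηy ω θ →
      ∀ t : ℝ, 0 ≤ t →
        energy N α β t (comoving β t (ω t)) (comoving β t (θ t)) ≤
          ENNReal.ofReal C * energy N α β 0 (ω 0) (θ 0) := by
  obtain ⟨η, hη, hη'⟩ : ∃ η : ℝ, 0 < η ∧ (η ≤ ηx ∨ η ≤ ηy) := by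
    rcases hpos with h | h
    exacts [⟨ηx, h, .inl le_rfl⟩, ⟨ηy, h, .inr le_rfl⟩]
  refine ⟨Real.exp (π * |β| / (2 * η)), fun α hα N ω θ hsol t ht => ?_⟩
  rw [energy_eq hα.le, energy_eq hα.le]
  refine freqSum_le (Real.exp_pos _).le fun k => ?_
  obtain ⟨W, Θ, hs, hW, hΘ, h⟩ := freq_representation hsol k
  filter_upwards [h t ht] with ξ h1
  rw [h1.1, h1.2, ← hW, ← hΘ]
  by_cases hk : k = 0
  · subst hk
    refine ((hs ξ).energyDensity_antitone_of_zero hα.le hνx hνy hηx hηy ht).trans ?_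
    refine le_mul_of_one_le_left (energyDensity_nonneg hα.le _ _ _) (Real.one_le_exp ?_)
    positivity
  · exact (hs ξ).energyDensity_le_bounded hk hα.le hνx hνy hηx hηy hη hη' ht

theorem energy_nonAverage_le (hβ : β ≠ 0) (hα : 0 ≤ α) (hνx : 0 ≤ νx) (hνy : 0 ≤ νy) (hηx : 0 ≤ ηx)
    (hηy : 0 ≤ ηy) {N : ℕ} {ω θ : ℝ → L2} (hsol : IsSolution α β νx νy ηx ηy ω θ) {t : ℝ}
    (ht : 0 ≤ t) :
    energy N α β t (nonAverage (comoving β t (ω t))) (nonAverage (comoving β t (θ t))) ≤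
      ENNReal.ofReal (2 * (1 + β ^ 2) * (1 + t ^ 2) *
        Real.exp (-(min νy ηy) * (β ^ 2 * t ^ 3 / 12) - min ηx νx * t)) *
        energy N α β 0 (nonAverage (ω 0)) (nonAverage (θ 0)) := by
  rw [energy_eq hα, energy_eq hα]
  refine freqSum_le (by positivity) fun k => ?_
  obtain ⟨W, Θ, hs, hW, hΘ, h⟩ := freq_representation hsol k
  filter_upwards [h t ht, ft_nonAverage (comoving β t (ω t)) k,
    ft_nonAverage (comoving β t (θ t)) k, ft_nonAverage (ω 0) k, ft_nonAverage (θ 0) k]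
    with ξ h1 h2 h3 h4 h5
  rw [h2, h3, h4, h5]
  split_ifs with hk
  · simp [energyDensity]
  · rw [h1.1, h1.2, ← hW, ← hΘ]
    exact (hs ξ).energyDensity_le_enhanced hk hβ hα hνx hνy hηx hηy ht

end Energy

/-! ### Growth for the equation `f'' = -κ f / (1 + z²)` -/

section Oscillator

/-- The parameter of the growing quadratic form. -/
def growthParam (κ : ℝ) : ℝ := κ / (2 * (κ + 2))

/-- A quadratic form that grows along the equation `f'' = -κ f / (1 + z²)`. -/
def growthForm (κ z a b : ℝ) : ℝ :=
  κ * a ^ 2 + (1 + z ^ 2) * b ^ 2 - 2 * growthParam κ * z * (a * b)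

variable {κ : ℝ} {f g : ℝ → ℝ}

theorem growthParam_pos (hκ : 0 < κ) : 0 < growthParam κ := by unfold growthParam; positivity

theorem growthParam_mul (hκ : 0 < κ) : growthParam κ * (2 * (κ + 2)) = κ := by
  unfold growthParam; field_simp

/-- The parameter is so small that the cross term costs at most half of `κ a²` together with `(z
b)²`. -/
theorem growthForm_ge (hκ : 0 < κ) {z : ℝ} (a b : ℝ) :
    κ / 2 * a ^ 2 + b ^ 2 ≤ growthForm κ z a b := by
  have h1 := growthParam_pos hκ
  have h2 := growthParam_mul hκ
  unfold growthForm
  set δ := growthParam κ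
  have h3 : δ ≤ 1 / 2 := by nlinarith
  have h4 : 4 * δ ≤ κ := by nlinarith
  have h5 : 2 * δ ^ 2 / κ ≤ 1 := by rw [div_le_one hκ]; nlinarith
  have h6 : 0 ≤ κ / 2 * (a - 2 * δ * (z * b) / κ) ^ 2 := by positivity
  have e : κ / 2 * (a - 2 * δ * (z * b) / κ) ^ 2 =
      κ / 2 * a ^ 2 - 2 * δ * z * (a * b) + 2 * δ ^ 2 / κ * (z * b) ^ 2 := by field_simp; ring
  nlinarith [mul_le_mul_of_nonneg_right h5 (sq_nonneg (z * b))]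

theorem growthForm_le (hκ : 0 < κ) {z : ℝ} (hz : 1 ≤ z) (a b : ℝ) :
    growthForm κ z a b ≤ (κ + 1) * a ^ 2 + 3 * (z * b) ^ 2 := by
  have h1 := growthParam_pos hκ
  have h2 := growthParam_mul hκ
  unfold growthForm
  set δ := growthParam κ
  have h3 : δ ≤ 1 / 2 := by nlinarith
  have h4 : b ^ 2 ≤ (z * b) ^ 2 := by
    rw [mul_pow]; exact le_mul_of_one_le_left (sq_nonneg b) (one_le_pow₀ hz)
  have h5 : 0 ≤ δ * (a + z * b) ^ 2 := by positivity
  have h6 : δ * a ^ 2 ≤ 1 / 2 * a ^ 2 := mul_le_mul_of_nonneg_right h3 (sq_nonneg a)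
  have h7 : δ * (z * b) ^ 2 ≤ 1 / 2 * (z * b) ^ 2 := mul_le_mul_of_nonneg_right h3 (sq_nonneg _)
  nlinarith [sq_nonneg a, sq_nonneg (z * b)]

/-- The rate of growth of the quadratic form. -/
def growthRate (κ : ℝ) : ℝ := min (1 / 3) (growthParam κ * κ / 2 / (κ + 1))

theorem growthRate_pos (hκ : 0 < κ) : 0 < growthRate κ := by
  have := growthParam_pos hκ
  unfold growthRate; positivity

/-- Without the cross term the derivative of the form would be `2 z b²` and would not see `a`. The
cross term contributes a positive multiple of `a²`; half of what remains of it for `z ≥ 1` absorbs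
the new mixed term. The two entries of `growthRate` match the coefficients in `growthForm_le`. -/
theorem growthForm_deriv_ge (hκ : 0 < κ) {z : ℝ} (hz : 1 ≤ z) (a b : ℝ) :
    growthRate κ * growthForm κ z a b ≤ z * (2 * z * (1 - growthParam κ) * b ^ 2 +
      2 * growthParam κ * κ * z / (1 + z ^ 2) * a ^ 2 - 2 * growthParam κ * (a * b)) := by
  have h1 := growthParam_pos hκ
  have h2 := growthParam_mul hκ
  have hr := growthRate_pos hκ
  have h3 := mul_le_mul_of_nonneg_left (growthForm_le hκ hz a b) hr.le
  have h4 : growthRate κ * 3 ≤ 1 := by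
    have := min_le_left (1 / 3) (growthParam κ * κ / 2 / (κ + 1))
    unfold growthRate; linarith
  have h5 : growthRate κ * (κ + 1) ≤ growthParam κ * κ / 2 := by
    rw [← le_div_iff₀ (by positivity)]; exact min_le_right _ _
  set δ := growthParam κ
  have h6 : 1 / 2 ≤ z ^ 2 / (1 + z ^ 2) := by
    rw [div_le_div_iff₀ two_pos (by positivity)]; nlinarith
  have h7 : 0 ≤ 1 - 2 * δ - 2 * δ / κ := by
    have : 2 * δ / κ = 1 / (κ + 2) := by
      rw [div_eq_div_iff hκ.ne' (by positivity)]; linarith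
    have e : 1 - 2 * δ - 1 / (κ + 2) = 1 / (κ + 2) := by
      have : 2 * δ = κ / (κ + 2) := by rw [eq_div_iff (by positivity)]; linarith
      rw [this]; field_simp; ring
    rw [this, e]; positivity
  have h8 : 0 ≤ δ * κ / 2 * (a - 2 * (z * b) / κ) ^ 2 := by positivity
  have e8 : δ * κ / 2 * (a - 2 * (z * b) / κ) ^ 2 =
      δ * κ / 2 * a ^ 2 - 2 * δ * (z * (a * b)) + 2 * δ / κ * (z * b) ^ 2 := by field_simp; ring
  have h9 := mul_le_mul_of_nonneg_left h6 (by positivity : 0 ≤ 2 * δ * κ * a ^ 2)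
  have e9 : z * (2 * z * (1 - δ) * b ^ 2 + 2 * δ * κ * z / (1 + z ^ 2) * a ^ 2 - 2 * δ * (a * b)) =
      2 * (1 - δ) * (z * b) ^ 2 + 2 * δ * κ * a ^ 2 * (z ^ 2 / (1 + z ^ 2))
        - 2 * δ * (z * (a * b)) := by ring
  rw [e9]
  nlinarith [mul_nonneg h7 (sq_nonneg (z * b)), mul_le_mul_of_nonneg_right h4 (sq_nonneg (z * b)),
    mul_le_mul_of_nonneg_right h5 (sq_nonneg a)]

/-- The first-order system of the equation `f'' = -κ f / (1 + z²)`. -/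
structure Oscillator (κ : ℝ) (f g : ℝ → ℝ) : Prop where
  fst : ∀ z, HasDerivAt f (g z) z
  snd : ∀ z, HasDerivAt g (-κ / (1 + z ^ 2) * f z) z

theorem Oscillator.hasDerivAt_growthForm (h : Oscillator κ f g) (z : ℝ) :
    HasDerivAt (fun z => growthForm κ z (f z) (g z)) (2 * z * (1 - growthParam κ) * g z ^ 2 +
      2 * growthParam κ * κ * z / (1 + z ^ 2) * f z ^ 2 - 2 * growthParam κ * (f z * g z)) z := by
  have h0 : HasDerivAt (fun z : ℝ => 1 + z ^ 2) (2 * z) z := by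
    simpa using (hasDerivAt_pow 2 z).const_add 1
  have h1 := (((h.fst z).pow 2).const_mul κ).add (h0.mul ((h.snd z).pow 2))
  have h2 := ((hasDerivAt_id z).const_mul (2 * growthParam κ)).mul ((h.fst z).mul (h.snd z))
  refine (h1.sub h2).congr_deriv ?_
  have hz : 1 + z ^ 2 ≠ 0 := by positivity
  simp
  field_simp
  ring

theorem Oscillator.growthForm_mono (h : Oscillator κ f g) (hκ : 0 < κ) {a b : ℝ} (ha : 1 ≤ a)
    (hab : a ≤ b) : growthForm κ a (f a) (g a) ≤ growthForm κ b (f b) (g b) := by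
  have := le_of_deriv_nonpos hab (fun z => (h.hasDerivAt_growthForm z).neg) fun z hz => by
    have hz1 : 1 ≤ z := ha.trans hz.1.le
    have h1 := growthForm_deriv_ge hκ hz1 (f z) (g z)
    have h2 := (by positivity : 0 ≤ κ / 2 * f z ^ 2 + g z ^ 2).trans
      (growthForm_ge hκ (z := z) (f z) (g z))
    have h3 := (mul_nonneg (growthRate_pos hκ).le h2).trans h1
    exact neg_nonpos.2 (nonneg_of_mul_nonneg_right h3 (by linarith))
  simpa using this

/-- The form `G` satisfies `z G' ≥ r G` with `r = growthRate κ` and is nondecreasing, so `G'` is at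
least `r G(a) / z`. Iterating would give a power of `b / a`; a logarithm is enough for
unboundedness. -/
theorem Oscillator.growthForm_log (h : Oscillator κ f g) (hκ : 0 < κ) {a b : ℝ} (ha : 1 ≤ a)
    (hab : a ≤ b) : growthRate κ * Real.log (b / a) * growthForm κ a (f a) (g a) ≤
      growthForm κ b (f b) (g b) := by
  have hG0 := (by positivity : 0 ≤ κ / 2 * f a ^ 2 + g a ^ 2).trans
      (growthForm_ge hκ (z := a) (f a) (g a))
  set G0 := growthForm κ a (f a) (g a)
  have hr := growthRate_pos hκ
  have hanti : AntitoneOn (fun z => growthRate κ * G0 * Real.log z - growthForm κ z (f z) (g z))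
      (Icc a b) := by
    have hd : ∀ z ∈ Icc a b, HasDerivAt
        (fun z => growthRate κ * G0 * Real.log z - growthForm κ z (f z) (g z))
        (growthRate κ * G0 * z⁻¹ - (2 * z * (1 - growthParam κ) * g z ^ 2 +
      2 * growthParam κ * κ * z / (1 + z ^ 2) * f z ^ 2 - 2 * growthParam κ * (f z * g z))) z :=
      fun z hz => ((Real.hasDerivAt_log (by linarith [hz.1])).const_mul _).sub
        (h.hasDerivAt_growthForm z)
    refine antitoneOn_of_deriv_nonpos (convex_Icc a b)
      (fun z hz => (hd z hz).continuousAt.continuousWithinAt)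
      (fun z hz => (hd z (interior_subset hz)).differentiableAt.differentiableWithinAt)
      fun z hz => ?_
    have hz' := interior_subset hz
    rw [(hd z hz').deriv]
    have hz1 : 1 ≤ z := ha.trans hz'.1
    have h1 := growthForm_deriv_ge hκ hz1 (f z) (g z)
    have h2 := mul_le_mul_of_nonneg_left (h.growthForm_mono hκ ha hz'.1) hr.le
    rw [sub_nonpos, ← div_eq_mul_inv, div_le_iff₀ (by linarith), mul_comm _ z]
    exact h2.trans h1
  have h1 := hanti (left_mem_Icc.2 hab) (right_mem_Icc.2 hab) hab
  rw [Real.log_div (by linarith) (by linarith)]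
  simp only at h1
  nlinarith

/-- The spacing of the two points at which the solution is observed. -/
def observationGap (κ : ℝ) : ℝ := 1 / (4 * (1 + 1200 * κ))

/-- At a zero of `f` the form is carried by `g`, so one value of `f` cannot control it. On the short
interval `[a, b]` the slope `g` is nearly constant, because `|g'| ≤ κ|f| / (1 + z²)` and
monotonicity bounds `f` by the form at `b`. Hence `b g(b)` is close to a multiple of `f b - f a`,
with an error absorbed by the form. -/
theorem Oscillator.growthForm_le_two_points (h : Oscillator κ f g) (hκ : 0 < κ) {a b : ℝ}
    (ha : 1 ≤ a) (hlo : observationGap κ * b / 2 ≤ b - a) (hhi : b - a ≤ 2 * observationGap κ * b) :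
    growthForm κ b (f b) (g b) ≤
      (2 * (κ + 1) + 72 / observationGap κ ^ 2) * (f b ^ 2 + f a ^ 2) := by
  set ρ := observationGap κ with hρ
  have hρ0 : 0 < ρ := by rw [hρ]; unfold observationGap; positivity
  have hρ1 : ρ * (4 * (1 + 1200 * κ)) = 1 := by rw [hρ]; unfold observationGap; field_simp
  have hρ4 : ρ ≤ 1 / 4 := by nlinarith [mul_pos hρ0 hκ]
  have hb0 : 0 < b := by
    by_contra hb
    push Not at hb
    nlinarith
  have hab : a < b := by nlinarith [mul_pos hρ0 hb0]
  have hab2 : b / 2 ≤ a := by nlinarith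
  set G := growthForm κ b (f b) (g b)
  have hG0 : 0 ≤ G := (by positivity : 0 ≤ κ / 2 * f b ^ 2 + g b ^ 2).trans
      (growthForm_ge hκ (z := b) (f b) (g b))
  set M := Real.sqrt (2 * κ * G)
  have hM2 : M ^ 2 = 2 * κ * G := Real.sq_sqrt (by positivity)
  have hM0 : 0 ≤ M := Real.sqrt_nonneg _
  -- Monotonicity bounds `f` on the whole interval by the value of the form at the right end.
  have hf : ∀ z ∈ Icc a b, κ * |f z| ≤ M := fun z hz => by
    refine Real.le_sqrt_of_sq_le ?_
    have h1 := growthForm_ge hκ (z := z) (f z) (g z)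
    have h2 := h.growthForm_mono hκ (ha.trans hz.1) hz.2
    rw [mul_pow, sq_abs]
    nlinarith [sq_nonneg (g z), mul_le_mul_of_nonneg_left (h1.trans h2) hκ.le]
  have hl : 0 < b - a := sub_pos.2 hab
  have hg' : ∀ z ∈ Icc a b, ‖-κ / (1 + z ^ 2) * f z‖ ≤ 4 * M / b ^ 2 := fun z hz => by
    have hz2 : b / 2 ≤ z := hab2.trans hz.1
    rw [norm_mul, norm_div, norm_neg, Real.norm_eq_abs, Real.norm_eq_abs, Real.norm_eq_abs,
      abs_of_pos hκ, abs_of_pos (by positivity : 0 < 1 + z ^ 2), div_mul_eq_mul_div,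
      div_le_div_iff₀ (by positivity) (by positivity)]
    have h3 : b ^ 2 ≤ 4 * (1 + z ^ 2) := by nlinarith
    calc κ * |f z| * b ^ 2 ≤ M * (4 * (1 + z ^ 2)) :=
          mul_le_mul (hf z hz) h3 (by positivity) hM0
      _ = _ := by ring
  have hg : ∀ z ∈ Icc a b, ‖g z - g b‖ ≤ 4 * M / b ^ 2 * (b - a) := fun z hz => by
    have h1 := (convex_Icc a b).norm_image_sub_le_of_norm_hasDerivWithin_le
      (fun x _ => (h.snd x).hasDerivWithinAt) hg' (right_mem_Icc.2 hab.le) hz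
    refine h1.trans (mul_le_mul_of_nonneg_left ?_ (by positivity))
    rw [Real.norm_eq_abs, abs_sub_comm, abs_of_nonneg (by linarith [hz.2])]
    linarith [hz.1]
  have hfl := (convex_Icc a b).norm_image_sub_le_of_norm_hasDerivWithin_le
    (fun x _ => ((h.fst x).sub ((hasDerivAt_id x).mul_const (g b))).hasDerivWithinAt)
    (fun x hx => by simpa using hg x hx) (left_mem_Icc.2 hab.le) (right_mem_Icc.2 hab.le)
  simp only [Pi.sub_apply, id, Real.norm_eq_abs, abs_of_pos hl] at hfl
  have hbg : (b - a) * |g b| ≤ |f b| + |f a| + 4 * M / b ^ 2 * (b - a) * (b - a) := by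
    rw [← abs_of_pos hl, ← abs_mul, abs_of_pos hl]
    have e : (b - a) * g b = f b - f a - (f b - b * g b - (f a - a * g b)) := by ring
    rw [e]
    refine (abs_sub _ _).trans (add_le_add (abs_sub _ _) hfl)
  have hbg2 : b * |g b| ≤ 2 / ρ * (|f b| + |f a|) + 8 * M * ρ := by
    have h1 : b * |g b| ≤ b / (b - a) * (|f b| + |f a|) + 4 * M * ((b - a) / b) := by
      have h2 := mul_le_mul_of_nonneg_left hbg (by positivity : 0 ≤ b / (b - a))
      have e1 : b / (b - a) * ((b - a) * |g b|) = b * |g b| := by field_simp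
      have e2 : b / (b - a) * (|f b| + |f a| + 4 * M / b ^ 2 * (b - a) * (b - a)) =
          b / (b - a) * (|f b| + |f a|) + 4 * M * ((b - a) / b) := by field_simp
      rwa [e1, e2] at h2
    have h3 : b / (b - a) ≤ 2 / ρ := by
      rw [div_le_div_iff₀ hl hρ0]; linarith
    have h4 : (b - a) / b ≤ 2 * ρ := by rwa [div_le_iff₀ hb0]
    have h5 := mul_le_mul_of_nonneg_right h3 (by positivity : 0 ≤ |f b| + |f a|)
    have h6 := mul_le_mul_of_nonneg_left h4 (by positivity : 0 ≤ 4 * M)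
    linarith
  have hbg3 : (b * g b) ^ 2 ≤ 12 / ρ ^ 2 * (f b ^ 2 + f a ^ 2) + 384 * κ * ρ ^ 2 * G := by
    have h1 : (b * g b) ^ 2 ≤ (2 / ρ * (|f b| + |f a|) + 8 * M * ρ) ^ 2 := by
      rw [← sq_abs (b * g b), abs_mul, abs_of_pos hb0]
      exact pow_le_pow_left₀ (by positivity) hbg2 2
    refine h1.trans ?_
    have e : (12 / ρ ^ 2 * (f b ^ 2 + f a ^ 2) + 384 * κ * ρ ^ 2 * G) =
        3 * ((2 / ρ * |f b|) ^ 2 + (2 / ρ * |f a|) ^ 2 + (8 * M * ρ) ^ 2) := by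
      have : (8 * M * ρ) ^ 2 = 64 * (2 * κ * G) * ρ ^ 2 := by rw [← hM2]; ring
      rw [this, mul_pow, mul_pow, sq_abs, sq_abs]
      field_simp; ring
    rw [e, mul_add]
    nlinarith [sq_nonneg (2 / ρ * |f b| - 2 / ρ * |f a|), sq_nonneg (2 / ρ * |f b| - 8 * M * ρ),
      sq_nonneg (2 / ρ * |f a| - 8 * M * ρ)]
  have hle := growthForm_le hκ (ha.trans hab.le) (f b) (g b)
  -- This smallness is what the size of `observationGap` is for: at most half of `G` has to be moved
  -- to the left.
  have hsmall : 3 * (384 * κ * ρ ^ 2) ≤ 1 / 2 := by nlinarith [mul_pos hρ0 hκ]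
  have := mul_le_mul_of_nonneg_right hsmall hG0
  have h72 : 72 / ρ ^ 2 = 6 * (12 / ρ ^ 2) := by ring
  rw [h72]
  have : 0 ≤ 2 * (κ + 1) * f a ^ 2 := by positivity
  nlinarith

theorem observationGap_pos (hκ : 0 < κ) : 0 < observationGap κ := by
  unfold observationGap; positivity

theorem observationGap_le (hκ : 0 < κ) : observationGap κ ≤ 1 / 4 := by
  unfold observationGap
  refine one_div_le_one_div_of_le (by norm_num) ?_
  linarith

/-- Logarithmic growth of the oscillator, observed at two points. -/
theorem exists_oscillator_growth (hκ : 0 < κ) : ∃ c : ℝ, 0 < c ∧ ∀ f g : ℝ → ℝ, Oscillator κ f g →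
    ∀ z a b : ℝ, 1 ≤ z → z ≤ a → observationGap κ * b / 2 ≤ b - a →
      b - a ≤ 2 * observationGap κ * b → a ≤ b →
      c * Real.log (b / z) * (f z ^ 2 + g z ^ 2) ≤ f b ^ 2 + f a ^ 2 := by
  have hρ := observationGap_pos hκ
  have hr := growthRate_pos hκ
  have hC : 0 < 2 * (κ + 1) + 72 / observationGap κ ^ 2 := by positivity
  refine ⟨growthRate κ * min (κ / 2) 1 / (2 * (κ + 1) + 72 / observationGap κ ^ 2), by positivity,
    fun f g h z a b hz hza hlo hhi hab => ?_⟩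
  have h1 := h.growthForm_le_two_points hκ (hz.trans hza) hlo hhi
  have h2 := h.growthForm_log hκ hz (hza.trans hab)
  have h3 := growthForm_ge hκ (z := z) (f z) (g z)
  have hlog : 0 ≤ Real.log (b / z) :=
    Real.log_nonneg ((one_le_div (by linarith)).2 (hza.trans hab))
  have h4 : min (κ / 2) 1 * (f z ^ 2 + g z ^ 2) ≤ growthForm κ z (f z) (g z) := by
    have a1 := mul_le_mul_of_nonneg_right (min_le_left (κ / 2) 1) (sq_nonneg (f z))
    have a2 := mul_le_mul_of_nonneg_right (min_le_right (κ / 2) 1) (sq_nonneg (g z))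
    linarith
  have h5 := mul_le_mul_of_nonneg_left h4 (mul_nonneg hr.le hlog)
  rw [div_mul_eq_mul_div, div_mul_eq_mul_div, div_le_iff₀ hC]
  linarith

end Oscillator

/-! ### One frequency without diffusion -/

section InviscidFrequency

variable {α β : ℝ} {k : ℤ} {ξ : ℝ} {w θ : ℝ → ℂ}

theorem FreqSystem.inviscid_vorticity (h : FreqSystem α β 0 0 0 0 k ξ w θ) (t : ℝ) :
    HasDerivAt w (Complex.I * k * θ t) t := by
  simpa using h.vorticity t

theorem FreqSystem.inviscid_buoyancy (h : FreqSystem α β 0 0 0 0 k ξ w θ) (t : ℝ) :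
    HasDerivAt (fun t => Complex.I * k * θ t)
      (((-(α * k ^ 2 / (k ^ 2 + (ξ - β * k * t) ^ 2)) : ℝ) : ℂ) * w t) t := by
  refine ((h.temperature t).const_mul (Complex.I * (k : ℂ))).congr_deriv ?_
  push_cast
  linear_combination (α * (k : ℂ) ^ 2 / ((k : ℂ) ^ 2 + (ξ - β * k * t) ^ 2) * w t) * Complex.I_sq

theorem FreqSystem.vorticity_const (h : FreqSystem α β 0 0 0 0 0 ξ w θ) (t : ℝ) : w t = w 0 :=
  is_const_of_deriv_eq_zero (fun s => (h.inviscid_vorticity s).differentiableAt)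
    (fun s => by simpa using (h.inviscid_vorticity s).deriv) t 0

theorem FreqSystem.vorticity_linear (h : FreqSystem 0 β 0 0 0 0 k ξ w θ) (t : ℝ) :
    w t = w 0 + t * (Complex.I * k * θ 0) := by
  rw [h.vorticity_eq t]
  simp [duhamelKernel, damping_zero_zero]

/-- In the pair `(w, ikθ)` the coupling is at most `α`, uniformly in the frequency. The upper bound
that follows propagates `H^N` regularity; the lower bound keeps the data from being lost before the
growth begins. -/
theorem FreqSystem.exists_hasDerivAt_sum_sq (h : FreqSystem α β 0 0 0 0 k ξ w θ) (hα : 0 ≤ α) :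
    ∃ S' : ℝ → ℝ, ∀ t,
      HasDerivAt (fun t => ‖w t‖ ^ 2 + ‖Complex.I * k * θ t‖ ^ 2) (S' t) t ∧
        |S' t| ≤ (1 + α) * (‖w t‖ ^ 2 + ‖Complex.I * k * θ t‖ ^ 2) := by
  refine ⟨_, fun t => ⟨(hasDerivAt_norm_sq_complex (h.inviscid_vorticity t)).add
    (hasDerivAt_norm_sq_complex (h.inviscid_buoyancy t)), ?_⟩⟩
  have hq0 : 0 ≤ α * (k : ℝ) ^ 2 / (k ^ 2 + (ξ - β * k * t) ^ 2) := by positivity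
  have hq1 : α * (k : ℝ) ^ 2 / (k ^ 2 + (ξ - β * k * t) ^ 2) ≤ α := by
    refine div_le_of_le_mul₀ (by positivity) hα ?_
    exact mul_le_mul_of_nonneg_left (by nlinarith [sq_nonneg (ξ - β * k * t)]) hα
  generalize α * (k : ℝ) ^ 2 / (k ^ 2 + (ξ - β * k * t) ^ 2) = q at hq0 hq1 ⊢
  generalize Complex.I * k * θ t = p
  rw [Complex.re_ofReal_mul, Complex.im_ofReal_mul, norm_sq_eq_re_im, norm_sq_eq_re_im]
  generalize w t = v
  have e : 2 * (v.re * p.re + v.im * p.im) + 2 * (p.re * (-q * v.re) + p.im * (-q * v.im)) =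
      (1 - q) * (2 * (v.re * p.re + v.im * p.im)) := by ring
  rw [e, abs_mul]
  refine mul_le_mul (abs_le.2 ⟨by linarith, by linarith⟩) (abs_le.2 ⟨?_, ?_⟩) (abs_nonneg _)
    (by positivity)
  · nlinarith [sq_nonneg (v.re + p.re), sq_nonneg (v.im + p.im)]
  · nlinarith [sq_nonneg (v.re - p.re), sq_nonneg (v.im - p.im)]

theorem FreqSystem.sum_sq_le (h : FreqSystem α β 0 0 0 0 k ξ w θ) (hα : 0 ≤ α) {t : ℝ}
    (ht : 0 ≤ t) : ‖w t‖ ^ 2 + ‖Complex.I * k * θ t‖ ^ 2 ≤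
      Real.exp ((1 + α) * t) * (‖w 0‖ ^ 2 + ‖Complex.I * k * θ 0‖ ^ 2) := by
  obtain ⟨S', hS⟩ := h.exists_hasDerivAt_sum_sq hα
  have hd := fun s => (((hasDerivAt_id s).const_mul (-(1 + α))).exp).mul (hS s).1
  have := le_of_deriv_nonpos ht hd fun s _ => by
    have h1 := (abs_le.1 (hS s).2).2
    have h2 := (Real.exp_pos (-(1 + α) * id s)).le
    nlinarith
  have h3 := mul_le_mul_of_nonneg_left this (Real.exp_pos ((1 + α) * t)).le
  simp only [Pi.mul_apply, id, mul_zero, Real.exp_zero, one_mul] at h3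
  rwa [← mul_assoc, ← Real.exp_add, show (1 + α) * t + -(1 + α) * t = 0 by ring, Real.exp_zero,
    one_mul] at h3

theorem FreqSystem.le_sum_sq (h : FreqSystem α β 0 0 0 0 k ξ w θ) (hα : 0 ≤ α) {t : ℝ}
    (ht : 0 ≤ t) : Real.exp (-(1 + α) * t) * (‖w 0‖ ^ 2 + ‖Complex.I * k * θ 0‖ ^ 2) ≤
      ‖w t‖ ^ 2 + ‖Complex.I * k * θ t‖ ^ 2 := by
  obtain ⟨S', hS⟩ := h.exists_hasDerivAt_sum_sq hα
  have hd := fun s => ((((hasDerivAt_id s).const_mul (1 + α)).exp).mul (hS s).1).neg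
  have := le_of_deriv_nonpos ht hd fun s _ => by
    have h1 := (abs_le.1 (hS s).2).1
    have h2 := (Real.exp_pos ((1 + α) * id s)).le
    nlinarith
  have h3 := mul_le_mul_of_nonneg_left this (Real.exp_pos (-(1 + α) * t)).le
  simp only [Pi.mul_apply, Pi.neg_apply, id, mul_zero, Real.exp_zero, one_mul] at h3
  rw [mul_neg, mul_neg, neg_le_neg_iff, ← mul_assoc, ← Real.exp_add,
    show -(1 + α) * t + (1 + α) * t = 0 by ring, Real.exp_zero, one_mul] at h3
  exact h3

theorem hasDerivAt_re {f : ℝ → ℂ} {f' : ℂ} {t : ℝ} (h : HasDerivAt f f' t) :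
    HasDerivAt (fun t => (f t).re) f'.re t :=
  Complex.reCLM.hasFDerivAt.comp_hasDerivAt t h

theorem hasDerivAt_im {f : ℝ → ℂ} {f' : ℂ} {t : ℝ} (h : HasDerivAt f f' t) :
    HasDerivAt (fun t => (f t).im) f'.im t :=
  Complex.imCLM.hasFDerivAt.comp_hasDerivAt t h

/-- The substitution `z = |β| (t - ξ / (βk))` centres time at the critical time and removes `k` from
the equation. The absolute value makes `z` increase with `t` for either sign of `β`. -/
theorem oscillator_of_hasDerivAt (hβ : β ≠ 0) (hk : k ≠ 0) {u p : ℝ → ℝ}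
    (hu : ∀ t, HasDerivAt u (p t) t)
    (hp : ∀ t, HasDerivAt p (-(α * k ^ 2 / (k ^ 2 + (ξ - β * k * t) ^ 2)) * u t) t) :
    Oscillator (α / β ^ 2) (fun z => u (z / |β| + ξ / (β * k)))
      (fun z => p (z / |β| + ξ / (β * k)) / |β|) := by
  have hβ' : |β| ≠ 0 := abs_ne_zero.2 hβ
  have hk' : (k : ℝ) ≠ 0 := Int.cast_ne_zero.2 hk
  have hs : ∀ z : ℝ, HasDerivAt (fun z => z / |β| + ξ / (β * k)) (1 / |β|) z := fun z =>
    ((hasDerivAt_id z).div_const _).add_const _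
  constructor
  · intro z
    refine ((hu _).comp z (hs z)).congr_deriv ?_
    ring
  · intro z
    refine (((hp _).comp z (hs z)).div_const |β|).congr_deriv ?_
    have e : (ξ - β * k * (z / |β| + ξ / (β * k))) ^ 2 = k ^ 2 * z ^ 2 := by
      have : ξ - β * k * (z / |β| + ξ / (β * k)) = -(β / |β|) * (k * z) := by field_simp; ring
      rw [this, mul_pow, neg_sq, div_pow, sq_abs, div_self (pow_ne_zero 2 hβ)]
      ring
    have e2 : α * (k : ℝ) ^ 2 / (k ^ 2 + k ^ 2 * z ^ 2) = α / (1 + z ^ 2) := by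
      field_simp
    rw [e, e2, ← sq_abs β]
    field_simp

/-- Logarithmic growth of the vorticity, uniformly on bounded sets of frequencies. -/
theorem exists_freq_growth (hα : 0 < α) (hβ : β ≠ 0) {R : ℝ} (hR : 0 ≤ R) :
    ∃ c B T₀ s : ℝ, 0 < c ∧ 0 < B ∧ 0 < s ∧ ∀ (k : ℤ) (ξ : ℝ) (w θ : ℝ → ℂ), k ≠ 0 → |ξ| ≤ R →
      FreqSystem α β 0 0 0 0 k ξ w θ → ∀ t, T₀ ≤ t →
        c * Real.log (t / B) * (‖w 0‖ ^ 2 + ‖Complex.I * k * θ 0‖ ^ 2) ≤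
          ‖w t‖ ^ 2 + ‖w (s * t)‖ ^ 2 := by
  have hb : 0 < |β| := abs_pos.2 hβ
  have hκ : 0 < α / β ^ 2 := by positivity
  obtain ⟨c, hc, hosc⟩ := exists_oscillator_growth hκ
  have hρ := observationGap_pos hκ
  have hρ4 := observationGap_le hκ
  set ρ := observationGap (α / β ^ 2)
  -- At this time the rescaled variable is at least `1` for every `|ξ| ≤ R` and `k ≠ 0`.
  set t₀ := (R + 1) / |β| with ht₀
  have ht₀0 : 0 ≤ t₀ := by positivity
  -- The observation times `t` and `(1 - ρ) t` must be the same for all frequencies in the window.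
  -- For `t` beyond the third constant, the shift `ξ / (βk)` changes the rescaled time by a factor
  -- between `1/2` and `3/2`, which the tolerance in the two-point estimate allows. The second
  -- constant compares `t` with the quotient `b / z`.
  refine ⟨c * (min 1 (1 / β ^ 2) * Real.exp (-(1 + α) * t₀)), 2 * (2 * R + 1) / |β|,
    2 * (3 * R + 1) / |β|, 1 - ρ, by positivity, by positivity, by linarith,
    fun k ξ w θ hk hξ h t ht => ?_⟩
  have hkb : |ξ / (β * k)| * |β| ≤ R := by
    rw [abs_div, abs_mul, div_mul_eq_mul_div, mul_comm |β|, mul_div_mul_right _ _ hb.ne']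
    refine (div_le_self (abs_nonneg _) ?_).trans hξ
    have := Int.one_le_abs hk
    exact_mod_cast this
  set τ := ξ / (β * k) with hτ
  have hτ1 : τ * |β| ≤ R := (mul_le_mul_of_nonneg_right (le_abs_self _) hb.le).trans hkb
  have hτ2 : -R ≤ τ * |β| := by
    have := (mul_le_mul_of_nonneg_right (neg_abs_le τ) hb.le)
    linarith
  have ht' : 2 * (3 * R + 1) ≤ t * |β| := by rwa [div_le_iff₀ hb] at ht
  have ht₀b : t₀ * |β| = R + 1 := by rw [ht₀]; field_simp
  set z := (t₀ - τ) * |β| with hz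
  set b := (t - τ) * |β| with hbdef
  set a := ((1 - ρ) * t - τ) * |β| with ha
  have hz1 : 1 ≤ z := by rw [hz]; linarith
  have hz2 : z ≤ 2 * R + 1 := by rw [hz]; linarith
  have hbl : t * |β| / 2 ≤ b := by rw [hbdef]; linarith
  have hbu : b ≤ 3 * (t * |β|) / 2 := by rw [hbdef]; linarith
  have hba : b - a = ρ * (t * |β|) := by rw [hbdef, ha]; ring
  have htb0 : 0 ≤ t * |β| := by linarith
  have hρt := mul_nonneg hρ.le htb0
  have hρt4 := mul_le_mul_of_nonneg_right hρ4 htb0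
  have hab : a ≤ b := by linarith
  have hza : z ≤ a := by linarith
  have hlo : ρ * b / 2 ≤ b - a := by
    linarith [mul_le_mul_of_nonneg_left hbu hρ.le]
  have hhi : b - a ≤ 2 * ρ * b := by
    linarith [mul_le_mul_of_nonneg_left hbl hρ.le]
  have h1 := hosc _ _ (oscillator_of_hasDerivAt hβ hk
    (fun t => hasDerivAt_re (h.inviscid_vorticity t))
    (fun t => (hasDerivAt_re (h.inviscid_buoyancy t)).congr_deriv (Complex.re_ofReal_mul _ _)))
    z a b hz1 hza hlo hhi hab
  have h2 := hosc _ _ (oscillator_of_hasDerivAt hβ hk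
    (fun t => hasDerivAt_im (h.inviscid_vorticity t))
    (fun t => (hasDerivAt_im (h.inviscid_buoyancy t)).congr_deriv (Complex.im_ofReal_mul _ _)))
    z a b hz1 hza hlo hhi hab
  have ez : z / |β| + τ = t₀ := by rw [hz]; field_simp; ring
  have eb : b / |β| + τ = t := by rw [hbdef]; field_simp; ring
  have ea : a / |β| + τ = (1 - ρ) * t := by rw [ha]; field_simp; ring
  simp only [← hτ, ez, eb, ea, div_pow, sq_abs] at h1 h2
  have h3 := h.le_sum_sq hα.le ht₀0
  have hlog1 : Real.log (t / (2 * (2 * R + 1) / |β|)) ≤ Real.log (b / z) := by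
    refine Real.log_le_log ?_ ?_
    · have : 0 < t := by
        by_contra hneg
        linarith [mul_nonpos_of_nonpos_of_nonneg (not_lt.1 hneg) hb.le]
      positivity
    · rw [div_div_eq_mul_div, div_le_div_iff₀ (by positivity) (by linarith)]
      linarith [mul_le_mul hbl hz2 (by linarith) (by linarith)]
  have hlog0 : 0 ≤ Real.log (t / (2 * (2 * R + 1) / |β|)) := by
    refine Real.log_nonneg ?_
    rw [div_div_eq_mul_div, one_le_div (by positivity)]
    linarith
  have h4 : min 1 (1 / β ^ 2) * (‖w t₀‖ ^ 2 + ‖Complex.I * k * θ t₀‖ ^ 2) ≤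
      ‖w t₀‖ ^ 2 + ‖Complex.I * k * θ t₀‖ ^ 2 / β ^ 2 := by
    have a1 := mul_le_mul_of_nonneg_right (min_le_left 1 (1 / β ^ 2)) (sq_nonneg ‖w t₀‖)
    have a2 := mul_le_mul_of_nonneg_right (min_le_right 1 (1 / β ^ 2))
      (sq_nonneg ‖Complex.I * k * θ t₀‖)
    rw [div_mul_eq_mul_div, one_mul] at a2
    linarith
  have hm : 0 ≤ min 1 (1 / β ^ 2) := by positivity
  have hS0 : 0 ≤ ‖w 0‖ ^ 2 + ‖Complex.I * k * θ 0‖ ^ 2 := by positivity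
  calc c * (min 1 (1 / β ^ 2) * Real.exp (-(1 + α) * t₀)) *
        Real.log (t / (2 * (2 * R + 1) / |β|)) * (‖w 0‖ ^ 2 + ‖Complex.I * k * θ 0‖ ^ 2)
      = c * Real.log (t / (2 * (2 * R + 1) / |β|)) * (min 1 (1 / β ^ 2) *
        (Real.exp (-(1 + α) * t₀) * (‖w 0‖ ^ 2 + ‖Complex.I * k * θ 0‖ ^ 2))) := by ring
    _ ≤ c * Real.log (b / z) * (min 1 (1 / β ^ 2) *
        (‖w t₀‖ ^ 2 + ‖Complex.I * k * θ t₀‖ ^ 2)) :=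
        mul_le_mul (mul_le_mul_of_nonneg_left hlog1 hc.le) (mul_le_mul_of_nonneg_left h3 hm)
          (by positivity) (mul_nonneg hc.le (hlog0.trans hlog1))
    _ ≤ c * Real.log (b / z) * (‖w t₀‖ ^ 2 + ‖Complex.I * k * θ t₀‖ ^ 2 / β ^ 2) :=
        mul_le_mul_of_nonneg_left h4 (mul_nonneg hc.le (hlog0.trans hlog1))
    _ ≤ _ := by
        rw [norm_sq_eq_re_im, norm_sq_eq_re_im, norm_sq_eq_re_im, norm_sq_eq_re_im]
        rw [add_div]
        linarith

end InviscidFrequency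

/-! ### Sobolev norms without diffusion -/

section Inviscid

variable {α β : ℝ} {N : ℕ} {ω θ : ℝ → L2}

theorem memH_comoving (hα : 0 ≤ α) (hsol : IsSolution α β 0 0 0 0 ω θ) (hω : MemH N (ω 0))
    (hθ : MemH (N + 1) (θ 0)) {t : ℝ} (ht : 0 ≤ t) : MemH N (comoving β t (ω t)) := by
  have h : sobNorm N (comoving β t (ω t)) ^ 2 ≤
      ENNReal.ofReal (Real.exp ((1 + α) * t)) * (sobNorm N (ω 0) ^ 2 + dxNorm N (θ 0) ^ 2) := by
    rw [sobNorm_sq, sobNorm_sq, dxNorm_sq, ← freqSum_add (fun _ _ => sq_nonneg _)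
      (fun _ _ => sq_nonneg _) (aemeasurable_norm_sq_ft (ω 0))]
    refine freqSum_le (Real.exp_pos _).le fun k => ?_
    obtain ⟨W, Θ, hs, hW, hΘ, h⟩ := freq_representation hsol k
    filter_upwards [h t ht] with ξ h1
    rw [h1.1, ← hW, ← hΘ]
    exact (le_add_of_nonneg_right (sq_nonneg _)).trans ((hs ξ).sum_sq_le hα ht)
  have := h.trans_lt (ENNReal.mul_lt_top ENNReal.ofReal_lt_top
    (ENNReal.add_lt_top.2 ⟨ENNReal.pow_lt_top hω, ENNReal.pow_lt_top (dxNorm_lt_top hθ)⟩))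
  rw [MemH]
  simpa [ENNReal.pow_lt_top_iff] using this

theorem limsup_ne_top_of_sq_le {u : ℝ → ℝ≥0∞} {Q : ℝ≥0∞} (hQ : Q < ⊤)
    (h : ∀ t, 0 ≤ t → u t ^ 2 ≤ Q) : limsup u atTop ≠ ⊤ := by
  refine (lt_of_le_of_lt (limsup_le_of_le (a := 1 + Q) (by isBoundedDefault) ?_)
    (ENNReal.add_lt_top.2 ⟨ENNReal.one_lt_top, hQ⟩)).ne
  filter_upwards [eventually_ge_atTop 0] with t ht
  rcases le_total (u t) 1 with h1 | h1
  · exact h1.trans le_self_add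
  · exact ((le_self_pow h1 two_ne_zero).trans (h t ht)).trans le_add_self

theorem limsup_eq_top_of_not_bounded {u : ℝ → ℝ≥0∞}
    (h : ∀ M : ℝ≥0∞, M < ⊤ → ¬ ∀ᶠ t in atTop, u t ≤ M) : limsup u atTop = ⊤ := by
  by_contra hne
  obtain ⟨M, hM1, hM2⟩ := exists_between (lt_top_iff_ne_top.2 hne)
  exact h M hM2 ((eventually_lt_of_limsup_lt hM1).mono fun _ => le_of_lt)

theorem sobNorm_sq_le_linear (hsol : IsSolution 0 β 0 0 0 0 ω θ) {t : ℝ} (ht : 0 ≤ t) :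
    sobNorm N (comoving β t (ω t)) ^ 2 ≤
      ENNReal.ofReal 2 * (sobNorm N (ω 0) ^ 2 + ENNReal.ofReal (t ^ 2) * dxNorm N (θ 0) ^ 2) := by
  rw [sobNorm_sq, sobNorm_sq, dxNorm_sq, ← freqSum_const_mul (sq_nonneg t),
    ← freqSum_add (fun _ _ => sq_nonneg _) (fun _ _ => by positivity)
      (aemeasurable_norm_sq_ft (ω 0))]
  refine freqSum_le zero_le_two fun k => ?_
  obtain ⟨W, Θ, hs, hW, hΘ, h⟩ := freq_representation hsol k
  filter_upwards [h t ht] with ξ h1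
  rw [h1.1, ← hW, ← hΘ, (hs ξ).vorticity_linear t]
  have h2 := norm_add_le (W ξ 0) (t * (Complex.I * k * Θ ξ 0))
  rw [norm_mul, Complex.norm_real, Real.norm_of_nonneg ht] at h2
  refine (pow_le_pow_left₀ (norm_nonneg _) h2 2).trans ?_
  nlinarith [sq_nonneg (‖W ξ 0‖ - t * ‖Complex.I * k * Θ ξ 0‖)]

theorem dxNorm_sq_le_linear (hsol : IsSolution 0 β 0 0 0 0 ω θ) {t : ℝ} (ht : 0 ≤ t) :
    ENNReal.ofReal (t ^ 2) * dxNorm N (θ 0) ^ 2 ≤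
      ENNReal.ofReal 2 * (sobNorm N (comoving β t (ω t)) ^ 2 + sobNorm N (ω 0) ^ 2) := by
  rw [sobNorm_sq, sobNorm_sq, dxNorm_sq, ← freqSum_const_mul (sq_nonneg t),
    ← freqSum_add (fun _ _ => sq_nonneg _) (fun _ _ => sq_nonneg _)
      (aemeasurable_norm_sq_ft (comoving β t (ω t)))]
  refine freqSum_le zero_le_two fun k => ?_
  obtain ⟨W, Θ, hs, hW, hΘ, h⟩ := freq_representation hsol k
  filter_upwards [h t ht] with ξ h1
  rw [h1.1, ← hW, ← hΘ]
  have h2 := norm_sub_le (W ξ t) (W ξ 0)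
  rw [(hs ξ).vorticity_linear t, add_sub_cancel_left, ← (hs ξ).vorticity_linear t, norm_mul,
    Complex.norm_real, Real.norm_of_nonneg ht] at h2
  rw [← mul_pow]
  refine (pow_le_pow_left₀ (by positivity) h2 2).trans ?_
  nlinarith [sq_nonneg (‖W ξ t‖ - ‖W ξ 0‖)]

theorem limsup_eq_top_of_dxNorm_ne_zero (hsol : IsSolution 0 β 0 0 0 0 ω θ) (hω : MemH N (ω 0))
    (h : dxNorm N (θ 0) ≠ 0) :
    limsup (fun t => sobNorm N (comoving β t (ω t))) atTop = ⊤ := by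
  refine limsup_eq_top_of_not_bounded fun M hM hev => ?_
  have hlim : Tendsto (fun t : ℝ => ENNReal.ofReal (t ^ 2) * dxNorm N (θ 0) ^ 2) atTop (𝓝 ⊤) := by
    have := ENNReal.Tendsto.mul_const (b := dxNorm N (θ 0) ^ 2)
      (ENNReal.tendsto_ofReal_atTop.comp (tendsto_pow_atTop (α := ℝ) two_ne_zero))
      (Or.inl ENNReal.top_ne_zero)
    rwa [ENNReal.top_mul (pow_ne_zero 2 h)] at this
  have hQ : ENNReal.ofReal 2 * (M ^ 2 + sobNorm N (ω 0) ^ 2) < ⊤ :=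
    ENNReal.mul_lt_top ENNReal.ofReal_lt_top
      (ENNReal.add_lt_top.2 ⟨ENNReal.pow_lt_top hM, ENNReal.pow_lt_top hω⟩)
  obtain ⟨t, ht1, ht2, ht3⟩ := ((hlim.eventually (lt_mem_nhds hQ)).and
    (hev.and (eventually_ge_atTop 0))).exists
  refine absurd (ht1.trans_le (dxNorm_sq_le_linear hsol ht3)) (not_lt.2 ?_)
  gcongr

theorem exists_ft_ne_zero {f : L2} (hf : nonAverage f ≠ 0) :
    ∃ k : ℤ, k ≠ 0 ∧ ¬ ∀ᵐ ξ, ft f k ξ = 0 := by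
  by_contra! h
  refine hf (eq_zero_of_ft_eq_zero fun k => ?_)
  by_cases hk : k = 0
  · filter_upwards [ft_nonAverage f k] with ξ h1
    rw [h1, if_pos hk]
  · filter_upwards [ft_nonAverage f k, h k hk] with ξ h1 h2
    rw [h1, if_neg hk, h2]

theorem ft_eq_zero_of_nonAverage {f : L2} (hf : nonAverage f = 0) {k : ℤ} (hk : k ≠ 0) :
    ∀ᵐ ξ, ft f k ξ = 0 := by
  filter_upwards [ft_nonAverage f k, ft_zero k] with ξ h1 h2
  rw [hf, h2, if_neg hk] at h1
  exact h1.symm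

/-- The growth estimate is uniform only on bounded sets of frequencies, so a nonzero part of the
data is first located in such a set. -/
theorem exists_setLIntegral_ne_zero {F : ℝ → ℝ} (hF : AEMeasurable F) (h0 : ∀ ξ, 0 ≤ F ξ)
    (h : ¬ ∀ᵐ ξ, F ξ = 0) : ∃ R : ℝ, 0 ≤ R ∧ ∫⁻ ξ in Icc (-R) R, ENNReal.ofReal (F ξ) ≠ 0 := by
  by_contra! hall
  refine h ?_
  have h1 : ∀ n : ℕ, ∀ᵐ ξ : ℝ, ξ ∈ Icc (-(n : ℝ)) n → F ξ = 0 := fun n => by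
    have h2 := (lintegral_eq_zero_iff' hF.ennreal_ofReal.restrict).1 (hall n n.cast_nonneg)
    filter_upwards [(ae_restrict_iff' measurableSet_Icc).1 h2] with ξ h3 h4
    exact le_antisymm (ENNReal.ofReal_eq_zero.1 (h3 h4)) (h0 ξ)
  filter_upwards [ae_all_iff.2 h1] with ξ h2
  obtain ⟨n, hn⟩ := exists_nat_ge |ξ|
  exact h2 n (abs_le.1 hn)

theorem setLIntegral_le_sobNorm_sq (N : ℕ) (f : L2) (k : ℤ) (S : Set ℝ) :
    ∫⁻ ξ in S, ENNReal.ofReal (‖ft f k ξ‖ ^ 2) ≤ sobNorm N f ^ 2 := by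
  rw [sobNorm_sq]
  refine (setLIntegral_le_lintegral S _).trans (le_trans ?_ (freqSum_zero_le N _))
  refine le_trans (le_of_eq ?_) (ENNReal.le_tsum k)
  simp

/-- Integrating the pointwise growth over a window where the data do not vanish bounds `log t` times
a positive constant by the squared norms at the times `t` and `s t`. They cannot both stay bounded.
-/
theorem limsup_eq_top_of_shear (hα : 0 < α) (hβ : β ≠ 0) (hsol : IsSolution α β 0 0 0 0 ω θ)
    (h : nonAverage (ω 0) ≠ 0 ∨ nonAverage (θ 0) ≠ 0) :
    limsup (fun t => sobNorm N (comoving β t (ω t))) atTop = ⊤ := by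
  obtain ⟨k, hk, hne⟩ : ∃ k : ℤ, k ≠ 0 ∧
      ¬ ∀ᵐ ξ, ‖ft (ω 0) k ξ‖ ^ 2 + ‖Complex.I * k * ft (θ 0) k ξ‖ ^ 2 = 0 := by
    have key : ∀ k : ℤ, k ≠ 0 → ∀ ξ,
        ‖ft (ω 0) k ξ‖ ^ 2 + ‖Complex.I * k * ft (θ 0) k ξ‖ ^ 2 = 0 →
          ft (ω 0) k ξ = 0 ∧ ft (θ 0) k ξ = 0 := fun k hk ξ h0 => by
      have h1 := (add_eq_zero_iff_of_nonneg (sq_nonneg _) (sq_nonneg _)).1 h0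
      simpa [hk] using h1
    rcases h with h | h
    · obtain ⟨k, hk, hne⟩ := exists_ft_ne_zero h
      exact ⟨k, hk, fun h0 => hne (h0.mono fun ξ hξ => (key k hk ξ hξ).1)⟩
    · obtain ⟨k, hk, hne⟩ := exists_ft_ne_zero h
      exact ⟨k, hk, fun h0 => hne (h0.mono fun ξ hξ => (key k hk ξ hξ).2)⟩
  have hmθ : AEMeasurable fun ξ => ‖Complex.I * k * ft (θ 0) k ξ‖ ^ 2 :=
    ((aestronglyMeasurable_ft (θ 0) k).const_mul _).norm.aemeasurable.pow_const 2
  obtain ⟨R, hR, hD⟩ := exists_setLIntegral_ne_zero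
    (F := fun ξ => ‖ft (ω 0) k ξ‖ ^ 2 + ‖Complex.I * k * ft (θ 0) k ξ‖ ^ 2)
    ((aemeasurable_norm_sq_ft (ω 0) k).add hmθ) (fun ξ => by positivity) hne
  obtain ⟨c, B, T₀, s, hc, hB, hs, hgrow⟩ := exists_freq_growth hα hβ hR
  obtain ⟨W, Θ, hsys, hW, hΘ, hrep⟩ := freq_representation hsol k
  set D := ∫⁻ ξ in Icc (-R) R,
    ENNReal.ofReal (‖ft (ω 0) k ξ‖ ^ 2 + ‖Complex.I * k * ft (θ 0) k ξ‖ ^ 2) with hDdef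
  refine limsup_eq_top_of_not_bounded fun M hM hev => ?_
  have hlim : Tendsto (fun t : ℝ => ENNReal.ofReal (c * Real.log (t / B)) * D) atTop (𝓝 ⊤) := by
    have h1 : Tendsto (fun t : ℝ => c * Real.log (t / B)) atTop atTop :=
      (Real.tendsto_log_atTop.comp (tendsto_id.atTop_div_const hB)).const_mul_atTop hc
    have := ENNReal.Tendsto.mul_const (b := D) (ENNReal.tendsto_ofReal_atTop.comp h1)
      (Or.inl ENNReal.top_ne_zero)
    rwa [ENNReal.top_mul hD] at this
  have hQ : M ^ 2 + M ^ 2 < ⊤ :=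
    ENNReal.add_lt_top.2 ⟨ENNReal.pow_lt_top hM, ENNReal.pow_lt_top hM⟩
  -- Since `s > 0`, the assumed bound also holds eventually along `s t`.
  have hev' : ∀ᶠ t in atTop, sobNorm N (comoving β (s * t) (ω (s * t))) ≤ M :=
    (tendsto_id.const_mul_atTop hs).eventually hev
  obtain ⟨t, ht1, ht2, ht3, ht4, ht5⟩ := ((hlim.eventually (lt_mem_nhds hQ)).and
    (hev.and (hev'.and ((eventually_ge_atTop 0).and (eventually_ge_atTop T₀))))).exists
  refine absurd ht1 (not_lt.2 ?_)
  calc ENNReal.ofReal (c * Real.log (t / B)) * D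
      ≤ ∫⁻ ξ in Icc (-R) R, ENNReal.ofReal (‖ft (comoving β t (ω t)) k ξ‖ ^ 2) +
          ENNReal.ofReal (‖ft (comoving β (s * t) (ω (s * t))) k ξ‖ ^ 2) := by
        rw [hDdef, ← lintegral_const_mul' _ _ ENNReal.ofReal_ne_top]
        refine lintegral_mono_ae ?_
        filter_upwards [ae_restrict_of_ae (hrep t ht4),
          ae_restrict_of_ae (hrep (s * t) (mul_nonneg hs.le ht4)),
          ae_restrict_mem measurableSet_Icc] with ξ h1 h2 h3
        rw [h1.1, h2.1, ← ENNReal.ofReal_add (sq_nonneg _) (sq_nonneg _), ← hW, ← hΘ,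
          ← ENNReal.ofReal_mul' (by positivity)]
        exact ENNReal.ofReal_le_ofReal (hgrow k ξ _ _ hk (abs_le.2 h3) (hsys ξ) t ht5)
    _ = (∫⁻ ξ in Icc (-R) R, ENNReal.ofReal (‖ft (comoving β t (ω t)) k ξ‖ ^ 2)) +
          ∫⁻ ξ in Icc (-R) R, ENNReal.ofReal (‖ft (comoving β (s * t) (ω (s * t))) k ξ‖ ^ 2) :=
        lintegral_add_left' (aemeasurable_norm_sq_ft _ k).ennreal_ofReal.restrict _
    _ ≤ _ := add_le_add
        ((setLIntegral_le_sobNorm_sq N _ k _).trans (pow_le_pow_left₀ zero_le ht2 2))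
        ((setLIntegral_le_sobNorm_sq N _ k _).trans (pow_le_pow_left₀ zero_le ht3 2))

/-- Without shear the weight of the density is constant in time, so the initial energy bounds `α
|w|²`. -/
theorem limsup_ne_top_of_no_shear (hα : 0 < α) (hsol : IsSolution α 0 0 0 0 0 ω θ)
    (hω : MemH N (ω 0)) (hθ : MemH (N + 1) (θ 0)) :
    limsup (fun t => sobNorm N (comoving 0 t (ω t))) atTop ≠ ⊤ := by
  refine limsup_ne_top_of_sq_le (Q := ENNReal.ofReal α⁻¹ * energy N α 0 0 (ω 0) (θ 0))
    (ENNReal.mul_lt_top ENNReal.ofReal_lt_top (energy_lt_top hα.le hω hθ)) fun t ht => ?_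
  rw [energy_eq hα.le, sobNorm_sq]
  refine freqSum_le (inv_nonneg.2 hα.le) fun k => ?_
  obtain ⟨W, Θ, hs, hW, hΘ, h⟩ := freq_representation hsol k
  filter_upwards [h t ht] with ξ h1
  rw [h1.1, ← hW, ← hΘ, ← div_eq_inv_mul, le_div_iff₀ hα]
  have h2 := (hs ξ).energyDensity_le_of_decreasing hα.le le_rfl le_rfl le_rfl le_rfl ht
    fun s _ => by simp
  rw [damping_zero_zero, one_pow, one_mul] at h2
  refine le_trans ?_ h2
  rw [energyDensity, mul_comm]
  exact le_add_of_nonneg_right (by positivity)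

theorem limsup_ne_top_of_average (hα : 0 ≤ α) (hsol : IsSolution α β 0 0 0 0 ω θ)
    (hω : MemH N (ω 0)) (h1 : nonAverage (ω 0) = 0) (h2 : nonAverage (θ 0) = 0) :
    limsup (fun t => sobNorm N (comoving β t (ω t))) atTop ≠ ⊤ := by
  refine limsup_ne_top_of_sq_le (Q := sobNorm N (ω 0) ^ 2) (ENNReal.pow_lt_top hω) fun t ht => ?_
  rw [sobNorm_sq, sobNorm_sq]
  refine freqSum_mono fun k => ?_
  obtain ⟨W, Θ, hs, hW, hΘ, h⟩ := freq_representation hsol k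
  by_cases hk : k = 0
  · subst hk
    filter_upwards [h t ht] with ξ h3
    rw [h3.1, ← hW, (hs ξ).vorticity_const t]
  · filter_upwards [h t ht, ft_eq_zero_of_nonAverage h1 hk, ft_eq_zero_of_nonAverage h2 hk]
      with ξ h3 h4 h5
    have h6 := (hs ξ).sum_sq_le hα ht
    rw [hW, hΘ, h4, h5] at h6
    rw [h3.1, h4]
    simp only [mul_zero, norm_zero, ne_eq, OfNat.ofNat_ne_zero, not_false_eq_true, zero_pow,
      add_zero] at h6 ⊢
    linarith [sq_nonneg ‖Complex.I * k * Θ ξ t‖]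

theorem limsup_eq_top_iff (hα : 0 ≤ α) (hsol : IsSolution α β 0 0 0 0 ω θ) (hω : MemH N (ω 0))
    (hθ : MemH (N + 1) (θ 0)) :
    limsup (fun t => sobNorm N (comoving β t (ω t))) atTop = ⊤ ↔
      (α = 0 ∧ dxNorm N (θ 0) ≠ 0) ∨
        (0 < α ∧ β ≠ 0 ∧ (nonAverage (ω 0) ≠ 0 ∨ nonAverage (θ 0) ≠ 0)) := by
  constructor
  · intro hlim
    by_contra hno
    push Not at hno
    rcases hα.eq_or_lt with h0 | h0
    · subst h0
      refine limsup_ne_top_of_sq_le (Q := ENNReal.ofReal 2 * sobNorm N (ω 0) ^ 2)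
        (ENNReal.mul_lt_top ENNReal.ofReal_lt_top (ENNReal.pow_lt_top hω)) (fun t ht => ?_) hlim
      have := sobNorm_sq_le_linear (N := N) hsol ht
      rwa [hno.1 rfl, zero_pow two_ne_zero, mul_zero, add_zero] at this
    · by_cases hβ : β = 0
      · subst hβ
        exact limsup_ne_top_of_no_shear h0 hsol hω hθ hlim
      · obtain ⟨h1, h2⟩ := hno.2 h0 hβ
        exact limsup_ne_top_of_average hα hsol hω h1 h2 hlim
  · rintro (⟨rfl, h⟩ | ⟨h0, hβ, h⟩)
    · exact limsup_eq_top_of_dxNorm_ne_zero hsol hω h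
    · exact limsup_eq_top_of_shear h0 hβ hsol h

end Inviscid

end Boussinesq

end

open Boussinesq in
theorem theorem2p1 :
    -- the inviscid case
    (∀ α β : ℝ, 0 ≤ α → ∀ (N : ℕ) (ω θ : ℝ → L2), IsSolution α β 0 0 0 0 ω θ →
      MemH N (ω 0) → MemH (N + 1) (θ 0) →
      (∀ t : ℝ, 0 ≤ t → MemH N (comoving β t (ω t))) ∧
      (limsup (fun t : ℝ => sobNorm N (comoving β t (ω t))) atTop = ⊤ ↔
        (α = 0 ∧ dxNorm N (θ 0) ≠ 0) ∨
        (0 < α ∧ β ≠ 0 ∧ (nonAverage (ω 0) ≠ 0 ∨ nonAverage (θ 0) ≠ 0)))) ∧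
    -- `α = 0`: the temperature
    (∀ β νx νy ηx ηy : ℝ, 0 ≤ νx → 0 ≤ νy → 0 ≤ ηx → 0 ≤ ηy →
      ∀ (N : ℕ) (ω θ : ℝ → L2), IsSolution 0 β νx νy ηx ηy ω θ →
      MemH N (ω 0) → MemH (N + 1) (θ 0) → ∀ t : ℝ, 0 ≤ t →
      sobNorm N (nonAverage (comoving β t (θ t))) ≤
        ENNReal.ofReal (Real.exp (-ηx * t - ηy * (β ^ 2 * t ^ 3 / 12))) * sobNorm N (θ 0)) ∧
    -- `α = 0`: the vorticity
    (∀ β νx νy ηx ηy : ℝ, 0 ≤ νx → 0 ≤ νy → 0 ≤ ηx → 0 ≤ ηy →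
      (0 < νx ∨ 0 < νy ∨ 0 < ηx ∨ 0 < ηy) → (β ≠ 0 ∨ 0 < νx ∨ 0 < ηx) →
      ∃ C : ℝ, ∀ (N : ℕ) (ω θ : ℝ → L2), IsSolution 0 β νx νy ηx ηy ω θ →
        MemH N (ω 0) → MemH (N + 1) (θ 0) →
        ∃ ω₁ : ℝ → L2, ∀ t : ℝ, 0 ≤ t →
          IsProfile β νx νy ηx ηy (ω 0) (θ 0) t (ω₁ t) ∧
          sobNorm N (nonAverage (comoving β t (ω t)) - ω₁ t) ≤
            ENNReal.ofReal (C * Real.exp (-(max ηy νy) * (β ^ 2 * t ^ 3 / 12) - max ηx νx * t)) *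
              (sobNorm N (ω 0) + dxNorm N (θ 0)) ∧
          sobNorm N (ω₁ t) ≤
            ENNReal.ofReal (C * (1 + t) *
              Real.exp (-(min ηy νy) * (β ^ 2 * t ^ 3 / 12) - min ηx νx * t / 2)) *
              (sobNorm N (ω 0) + dxNorm N (θ 0)) ∧
          (¬ (νx = 0 ∧ ηx = 0 ∧ νy = ηy) →
            sobNorm N (ω₁ t) ≤
              ENNReal.ofReal (C *
                Real.exp (-(min ηy νy) * (β ^ 2 * t ^ 3 / 12) - min ηx νx * t / 2)) *
                (sobNorm N (ω 0) + dxNorm N (θ 0)))) ∧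
    -- `α > 0`: uniform boundedness of the energy
    (∀ β νx νy ηx ηy : ℝ, 0 ≤ νx → 0 ≤ νy → 0 ≤ ηx → 0 ≤ ηy →
      (0 < min νx ηx ∨ 0 < min νy ηy) →
      ∃ C : ℝ, ∀ α : ℝ, 0 < α → ∀ (N : ℕ) (ω θ : ℝ → L2), IsSolution α β νx νy ηx ηy ω θ →
        MemH N (ω 0) → MemH (N + 1) (θ 0) →
        energy N α β 0 (ω 0) (θ 0) < ⊤ ∧
        ∀ t : ℝ, 0 ≤ t →
          energy N α β t (comoving β t (ω t)) (comoving β t (θ t)) ≤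
            ENNReal.ofReal C * energy N α β 0 (ω 0) (θ 0)) ∧
    -- `α > 0` and shear: enhanced dissipation away from the `x`-averages
    (∀ β : ℝ, β ≠ 0 → ∃ C : ℝ, ∀ α νx νy ηx ηy : ℝ, 0 < α →
      0 ≤ νx → 0 ≤ νy → 0 ≤ ηx → 0 ≤ ηy → (0 < min νx ηx ∨ 0 < min νy ηy) →
      ∀ (N : ℕ) (ω θ : ℝ → L2), IsSolution α β νx νy ηx ηy ω θ →
        MemH N (ω 0) → MemH (N + 1) (θ 0) → ∀ t : ℝ, 0 ≤ t →
        energy N α β t (nonAverage (comoving β t (ω t))) (nonAverage (comoving β t (θ t))) ≤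
          ENNReal.ofReal (C * (1 + t ^ 2) *
            Real.exp (-(min νy ηy) * (β ^ 2 * t ^ 3 / 12) - min ηx νx * t)) *
            energy N α β 0 (nonAverage (ω 0)) (nonAverage (θ 0))) := by
  refine ⟨fun α β hα N ω θ hsol hω hθ => ⟨fun t ht => memH_comoving hα hsol hω hθ ht,
      limsup_eq_top_iff hα hsol hω hθ⟩,
    fun β νx νy ηx ηy _ _ hηx hηy N ω θ hsol _ _ t ht =>
      sobNorm_nonAverage_temperature_le hηx hηy hsol ht,
    fun β νx νy ηx ηy hνx hνy hηx hηy _ hpos => vorticity_profile hνx hνy hηx hηy hpos,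
    fun β νx νy ηx ηy hνx hνy hηx hηy hpos => ?_,
    fun β hβ => ⟨2 * (1 + β ^ 2), fun α νx νy ηx ηy hα hνx hνy hηx hηy _ N ω θ hsol _ _ t ht =>
      energy_nonAverage_le hβ hα.le hνx hνy hηx hηy hsol ht⟩⟩
  -- Boundedness uses only the thermal coefficient in each minimum.
  obtain ⟨C, hC⟩ := energy_bounded (β := β) hνx hνy hηx hηy
    (hpos.imp (fun h => (lt_min_iff.1 h).2) fun h => (lt_min_iff.1 h).2)
  exact ⟨C, fun α hα N ω θ hsol hω hθ => ⟨energy_lt_top hα.le hω hθ, hC α hα N ω θ hsol⟩⟩
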